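/- **Setting.** Let $\Omega$ be a nonempty bounded open subset of $\mathbb R^N$ with Lipschitz boundary, let $m\ge 2$, $I=\{1,\dots,m\}$, and let $(\Omega_i)_{i\in I}$ be disjoint open subsets of $\Omega$ with Lipschitz boundaries such that $\overline\Omega=\bigcup_{i\in I}\overline{\Omega_i}$. For $i\in I$ let $\Upsilon_{ii}$ be the interior of $\operatorname{bdry}\Omega_i\cap\operatorname{bdry}\Omega$ relative to $\operatorname{bdry}\Omega$, and for $i<j$ let $\Upsilon_{ij}=\Upsilon_{ji}$ be the interior of $\operatorname{bdry}\Omega_i\cap\operatorname{bdry}\Omega_j$ relative to $\operatorname{bdry}\Omega_i$. Assume that, for every $i\in I$, $\Upsilon_{ii}\neq\varnothing$, that $J(i)=\{j\in I\smallsetminus\{i\}:\Upsilon_{ij}\ne\varnothing\}\neq\varnothing$, and that the closure of every connected component of $\Omega_i$ meets $\Upsilon_{ii}$ (automatic if $\Omega_i$ is connected). Set $J(i-)=\{j\in J(i):j<i\}$, $J(i+)=\{j\in J(i):j>i\}$ and $K=\{(i,j): i\in I,\ j\in J(i+)\}$. Let $S$ be surface measure, and let $\mathsf T_i\colon H^1(\Omega_i)\to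 L^2(\operatorname{bdry}\Omega_i)$ be the Sobolev trace operator, i.e. the bounded linear operator with $\mathsf T_iv=v|_{\operatorname{bdry}\Omega_i}$ for all $v\in C^1(\overline{\Omega_i})$. Let $\mathcal H_i=\{u\in H^1(\Omega_i):\mathsf T_iu=0 \text{ a.e. on }\Upsilon_{ii}\}$, with scalar product $\langle u,v\rangle=\int_{\Omega_i}(Du)^\top Dv$, and $\mathsf T_{ij}\colon\mathcal H_i\to L^2(\Upsilon_{ij})$, $u\mapsto(\mathsf T_iu)|_{\Upsilon_{ij}}$ for $j\in J(i)$. For $f\in L^2(\Omega_i)$ and $h=(h_j)_{j\in J(i)}\in\bigoplus_{j\in J(i)}L^2(\Upsilon_{ij})$, let $Q_i(f,h)$ be the weak solution in $\mathcal H_i$ of $-\Delta u=f$ on $\Omega_i$, $u=0$ on $\Upsilon_{ii}$, $\nu_i^\top Du=h_j$ on $\Upsilon_{ij}$ for $j\in J(i+)$, and $\nu_i^\top Du=-h_j$ on $\Upsilon_{ij}$ for $j\in J(i-)$ ($\nu_i$ the unit outward normal), i.e. the $u\in\mathcal H_i$ such that, for all $v\in\mathcal H_i$, $$\int_{\Omega_i}(Du)^\top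 Dv=\int_{\Omega_i}fv+\sum_{j\in J(i+)}\int_{\Upsilon_{ij}}h_j\,\mathsf T_{ij}v\,dS-\sum_{j\in J(i-)}\int_{\Upsilon_{ij}}h_j\,\mathsf T_{ij}v\,dS .$$ For $i\in I$ and $(i,j)\in K$, let $\varphi_i\colon\mathcal H_i\to\left]-\infty,+\infty\right]$ and $\psi_{ij}\colon L^2(\Upsilon_{ij})\to\left]-\infty,+\infty\right]$ be lower semicontinuous, convex and not identically $+\infty$, with subdifferentials $\partial\varphi_i,\partial\psi_{ij}$ and Fenchel conjugates $\varphi_i^*,\psi_{ij}^*$. Let $Z$ be the set of $(u,g)\in\bigoplus_{i\in I}\mathcal H_i\oplus\bigoplus_{(i,j)\in K}L^2(\Upsilon_{ij})$ such that $$g_{ij}\in\partial\psi_{ij}(\mathsf T_{ij}u_i-\mathsf T_{ji}u_j)\ \ \forall (i,j)\in K,\qquad -Q_i\big(0,(g_{ij})_{j\in J(i+)},(g_{ji})_{j\in J(i-)}\big)\in\partial\varphi_i(u_i)\ \ \forall i\in I.$$ Assume $Z\neq\varnothing$ and let $(u_0,g_0)\in\bigoplus_{i\in I}\mathcal H_i\oplus\bigoplus_{(i,j)\in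 K}L^2(\Upsilon_{ij})$. **Proposition.** The objects above are well defined: the trace operators $\mathsf T_i$ exist and are unique, the spaces $\mathcal H_i$ are Hilbert spaces, and the weak solution $Q_i(f,h)$ exists and is unique for all data. There is a unique point $(\bar u,\bar g)$ of $Z$ closest to $(u_0,g_0)$. Moreover, $\bar u=(\bar u_i)_{i\in I}$ minimizes $$\sum_{i\in I}\varphi_i(u_i)+\sum_{(i,j)\in K}\psi_{ij}(\mathsf T_{ij}u_i-\mathsf T_{ji}u_j)$$ over $(u_i)_{i\in I}\in\bigoplus_{i\in I}\mathcal H_i$, and $\bar g=(\bar g_{ij})_{(i,j)\in K}$ minimizes $$\sum_{i\in I}\varphi_i^*\Big(-Q_i\big(0,(g_{ij})_{j\in J(i+)},(g_{ji})_{j\in J(i-)}\big)\Big)+\sum_{(i,j)\in K}\psi_{ij}^*(g_{ij})$$ over $(g_{ij})_{(i,j)\in K}\in\bigoplus_{(i,j)\in K}L^2(\Upsilon_{ij})$. -/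

import Mathlib

open MeasureTheory Topology
open scoped ENNReal ContDiff

noncomputable section

namespace DomainDecomposition

/-! ### Convex analysis in (semi-)inner product spaces -/

section Convex

variable {H : Type*} [SeminormedAddCommGroup H] [InnerProductSpace ℝ H]

/-- The class of lower semicontinuous convex functions with values in `]-∞, +∞]` that are not
identically `+∞`. -/
structure IsGammaZero (f : H → EReal) : Prop where
  ne_bot : ∀ u, f u ≠ ⊥
  proper : ∃ u, f u ≠ ⊤
  lsc : LowerSemicontinuous f
  convex : ∀ u v : H, ∀ a b : ℝ, 0 < a → 0 < b → a + b = 1 →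
    f (a • u + b • v) ≤ (a : EReal) * f u + (b : EReal) * f v

/-- The subdifferential of `f` at `u`. -/
def subdifferential (f : H → EReal) (u : H) : Set H :=
  {w | ∀ v, f u + ((inner ℝ (v - u) w : ℝ) : EReal) ≤ f v}

/-- The Legendre-Fenchel conjugate of `f`. -/
def conjugate (f : H → EReal) (w : H) : EReal :=
  ⨆ u : H, ((inner ℝ u w : ℝ) : EReal) - f u

end Convex

/-! ### Domains, surface measure, Sobolev spaces -/

/-- The Euclidean space `ℝ^N`. -/
abbrev E (N : ℕ) : Type := EuclideanSpace ℝ (Fin N)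

variable {N : ℕ}

/-- `U` has a Lipschitz boundary: near each boundary point `x`, in suitable Cartesian coordinates
with last axis along the unit vector `e`, `U` is the set of points lying strictly below the graph
of a Lipschitz function `g` of the other coordinates (that is, `g` is invariant along `e`). -/
def HasLipschitzBoundary (U : Set (E N)) : Prop :=
  ∀ x ∈ frontier U, ∃ e : E N, ‖e‖ = 1 ∧ ∃ g : E N → ℝ,
    (∃ L : NNReal, LipschitzWith L g) ∧ (∀ (y : E N) (t : ℝ), g (y + t • e) = g y) ∧
    ∃ V ∈ 𝓝 x, ∀ y ∈ V, (y ∈ U ↔ inner ℝ e y < g y)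

/-- The interior of `B` relative to `A` (for `B ⊆ A`), as a subset of the ambient space. -/
def relInterior (A B : Set (E N)) : Set (E N) :=
  Subtype.val '' interior (Subtype.val ⁻¹' B : Set A)

/-- The `(N-1)`-dimensional surface measure: the Hausdorff measure, normalized so that it is
Lebesgue measure on `(N-1)`-dimensional Euclidean spaces. -/
def surf (N : ℕ) : Measure (E N) := Measure.euclideanHausdorffMeasure (N - 1)

/-- `L²(A)` with respect to surface measure, for a subset `A` of a hypersurface. -/
abbrev L2Surf (A : Set (E N)) : Type := Lp ℝ 2 ((surf N).restrict A)

/-- `L²(U)` with respect to Lebesgue measure. -/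
abbrev L2Vol (U : Set (E N)) : Type := Lp ℝ 2 ((volume : Measure (E N)).restrict U)

/-- `L²(U; ℝ^N)` with respect to Lebesgue measure. -/
abbrev L2VolVec (U : Set (E N)) : Type := Lp (E N) 2 ((volume : Measure (E N)).restrict U)

/-- Restriction of surface `L²` functions to a smaller set. -/
def restrictSurf {A B : Set (E N)} (h : B ⊆ A) (f : L2Surf A) : L2Surf B :=
  MemLp.toLp f ((Lp.memLp f).mono_measure (Measure.restrict_mono_set (surf N) h))

/-- `G` is the weak gradient of `u` on the open set `U`. -/
def HasWeakGradient (U : Set (E N)) (u : E N → ℝ) (G : E N → E N) : Prop :=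
  ∀ θ : E N → ℝ, ContDiff ℝ ∞ θ → HasCompactSupport θ → tsupport θ ⊆ U → ∀ v : E N,
    ∫ x in U, u x * fderiv ℝ θ x v = - ∫ x in U, inner ℝ (G x) v * θ x

lemma integrable_mul_of_compactSupport {U : Set (E N)} {u w : E N → ℝ}
    (hu : MemLp u 2 ((volume : Measure (E N)).restrict U)) (hw : Continuous w)
    (hc : HasCompactSupport w) : Integrable (fun x => u x * w x) (volume.restrict U) := by
  have h2 : MemLp w 2 ((volume : Measure (E N)).restrict U) :=
    hw.memLp_of_hasCompactSupport hc
  exact hu.integrable_mul h2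

/-- The Sobolev space `H¹(U)`, as the space of pairs `(u, Du)` in `L²(U) × L²(U; ℝ^N)` where `Du`
is the weak gradient of `u`. Its scalar product is `∫ u v + ∫ Du · Dv`. -/
def H1 (U : Set (E N)) : Submodule ℝ (WithLp 2 (L2Vol U × L2VolVec U)) where
  carrier := {p | HasWeakGradient U p.fst p.snd}
  zero_mem' := by
    intro θ _ _ _ v
    have e1 : ∫ x in U, (0 : L2Vol U) x * fderiv ℝ θ x v = 0 :=
      integral_eq_zero_of_ae ((Lp.coeFn_zero ℝ 2 (volume.restrict U)).mono fun x hx => by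
        beta_reduce; rw [hx]; simp)
    have e2 : ∫ x in U, inner ℝ ((0 : L2VolVec U) x) v * θ x = 0 :=
      integral_eq_zero_of_ae ((Lp.coeFn_zero (E N) 2 (volume.restrict U)).mono fun x hx => by
        beta_reduce; rw [hx]; simp)
    exact e1.trans (by rw [← neg_zero, ← e2]; rfl)
  add_mem' := by
    intro p q hp hq θ h1 h2 h3 v
    have d : Continuous (fun x => fderiv ℝ θ x v) :=
      (h1.continuous_fderiv (by simp)).clm_apply continuous_const
    have dc : HasCompactSupport (fun x => fderiv ℝ θ x v) := h2.fderiv_apply ℝ v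
    have i1 := integrable_mul_of_compactSupport (Lp.memLp p.fst) d dc
    have i2 := integrable_mul_of_compactSupport (Lp.memLp q.fst) d dc
    have j1 := integrable_mul_of_compactSupport ((Lp.memLp p.snd).inner_const v) h1.continuous h2
    have j2 := integrable_mul_of_compactSupport ((Lp.memLp q.snd).inner_const v) h1.continuous h2
    have e1 : ∫ x in U, (p + q).fst x * fderiv ℝ θ x v =
        ∫ x in U, (p.fst x * fderiv ℝ θ x v + q.fst x * fderiv ℝ θ x v) :=
      integral_congr_ae ((Lp.coeFn_add p.fst q.fst).mono fun x hx => by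
        simp only [WithLp.add_fst, hx, Pi.add_apply]; ring)
    have e2 : ∫ x in U, inner ℝ ((p + q).snd x) v * θ x =
        ∫ x in U, (inner ℝ (p.snd x) v * θ x + inner ℝ (q.snd x) v * θ x) :=
      integral_congr_ae ((Lp.coeFn_add p.snd q.snd).mono fun x hx => by
        simp only [WithLp.add_snd, hx, Pi.add_apply, inner_add_left]; ring)
    rw [e1, e2, integral_add i1 i2, integral_add j1 j2, hp θ h1 h2 h3 v, hq θ h1 h2 h3 v]
    ring
  smul_mem' := by
    intro c p hp θ h1 h2 h3 v
    have e1 : ∫ x in U, (c • p).fst x * fderiv ℝ θ x v =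
        ∫ x in U, c * (p.fst x * fderiv ℝ θ x v) :=
      integral_congr_ae ((Lp.coeFn_smul c p.fst).mono fun x hx => by
        simp only [WithLp.smul_fst, hx, Pi.smul_apply, smul_eq_mul]; ring)
    have e2 : ∫ x in U, inner ℝ ((c • p).snd x) v * θ x =
        ∫ x in U, c * (inner ℝ (p.snd x) v * θ x) :=
      integral_congr_ae ((Lp.coeFn_smul c p.snd).mono fun x hx => by
        simp only [WithLp.smul_snd, hx, Pi.smul_apply, real_inner_smul_left]; ring)
    rw [e1, e2, integral_const_mul, integral_const_mul, hp θ h1 h2 h3 v]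
    ring

/-- `T` is a Sobolev trace operator on `U`: a bounded linear operator
`H¹(U) → L²(bdry U)` such that `T v = v|_{bdry U}` for every `v ∈ C¹(closure U)`, i.e. for every
restriction of a `C¹` function on `ℝ^N`. -/
def IsTraceOperator (U : Set (E N)) (T : H1 U →L[ℝ] L2Surf (frontier U)) : Prop :=
  ∀ v : E N → ℝ, ContDiff ℝ 1 v → ∀ u : H1 U,
    (u : WithLp 2 (L2Vol U × L2VolVec U)).fst =ᵐ[volume.restrict U] v →
    T u =ᵐ[(surf N).restrict (frontier U)] v

open Classical in
/-- The Sobolev trace operator on `U` (the zero operator if there is none, which does not occur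
for bounded open sets with Lipschitz boundary). -/
def trace (U : Set (E N)) : H1 U →L[ℝ] L2Surf (frontier U) :=
  if h : ∃ T, IsTraceOperator U T then h.choose else 0

/-- The subspace of those `u ∈ H¹(U)` with `trace u = 0` almost everywhere on `Γ ⊆ bdry U`. -/
def traceZero (U Γ : Set (E N)) : Submodule ℝ (H1 U) where
  carrier := {u | ∀ᵐ x ∂((surf N).restrict (frontier U)), x ∈ Γ → trace U u x = 0}
  zero_mem' := by
    have h := Lp.coeFn_zero ℝ 2 ((surf N).restrict (frontier U))
    rw [Set.mem_ofPred_eq, map_zero]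
    exact h.mono fun x hx _ => hx
  add_mem' := by
    intro a b ha hb
    have h := Lp.coeFn_add (trace U a) (trace U b)
    rw [Set.mem_ofPred_eq] at ha hb ⊢
    rw [map_add]
    filter_upwards [h, ha, hb] with x hx h1 h2 h3
    rw [hx, Pi.add_apply, h1 h3, h2 h3, add_zero]
  smul_mem' := by
    intro c a ha
    have h := Lp.coeFn_smul c (trace U a)
    rw [Set.mem_ofPred_eq] at ha ⊢
    rw [map_smul]
    filter_upwards [h, ha] with x hx h1 h3
    rw [hx, Pi.smul_apply, h1 h3, smul_zero]

/-- The space `H¹_{0,Γ}(U)`, to be endowed with the scalar product `∫ Du · Dv` (and not with that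
of `H¹(U)`). -/
def HZero (U Γ : Set (E N)) : Type := ↥(traceZero U Γ)

namespace HZero

variable {U Γ : Set (E N)}

instance : AddCommGroup (HZero U Γ) := inferInstanceAs (AddCommGroup ↥(traceZero U Γ))

instance : Module ℝ (HZero U Γ) := inferInstanceAs (Module ℝ ↥(traceZero U Γ))

/-- The inclusion in `H¹(U)`. -/
def toH1 : HZero U Γ →ₗ[ℝ] H1 U := (traceZero U Γ).subtype

/-- The `L²` class of the function itself. -/
def fn : HZero U Γ →ₗ[ℝ] L2Vol U where
  toFun u := (toH1 u : WithLp 2 (L2Vol U × L2VolVec U)).fst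
  map_add' _ _ := by simp
  map_smul' _ _ := by simp

/-- The weak gradient. -/
def grad : HZero U Γ →ₗ[ℝ] L2VolVec U where
  toFun u := (toH1 u : WithLp 2 (L2Vol U × L2VolVec U)).snd
  map_add' _ _ := by simp
  map_smul' _ _ := by simp

/-- The norm `u ↦ (∫ |Du|²)^{1/2}`. -/
instance : SeminormedAddCommGroup (HZero U Γ) :=
  SeminormedAddCommGroup.induced (HZero U Γ) (L2VolVec U) grad

/-- The scalar product `∫ Du · Dv`. -/
instance : InnerProductSpace ℝ (HZero U Γ) where
  inner u v := ∫ x in U, inner ℝ (grad u x) (grad v x)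
  norm_smul_le c u := by
    change ‖grad (c • u)‖ ≤ ‖c‖ * ‖grad u‖
    rw [map_smul, norm_smul]
  norm_sq_eq_re_inner u := by
    change ‖grad u‖ ^ 2 = _
    rw [← real_inner_self_eq_norm_sq, L2.inner_def]
    rfl
  conj_inner_symm u v := by
    simp only [conj_trivial]
    exact integral_congr_ae (Filter.Eventually.of_forall fun x => real_inner_comm _ _)
  add_left u v w := by
    change ∫ x in U, inner ℝ (grad (u + v) x) (grad w x) =
      (∫ x in U, inner ℝ (grad u x) (grad w x)) + ∫ x in U, inner ℝ (grad v x) (grad w x)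
    rw [← L2.inner_def, ← L2.inner_def, ← L2.inner_def, map_add, inner_add_left]
  smul_left u v c := by
    change ∫ x in U, inner ℝ (grad (c • u) x) (grad v x) =
      (starRingEnd ℝ) c * ∫ x in U, inner ℝ (grad u x) (grad v x)
    rw [← L2.inner_def, ← L2.inner_def, map_smul, inner_smul_left]

/-- The trace of `u ∈ H¹_{0,Γ}(U)` restricted to a subset `A` of `bdry U`. -/
def traceOn {A : Set (E N)} (hA : A ⊆ frontier U) (u : HZero U Γ) : L2Surf A :=
  restrictSurf hA (trace U (toH1 u))

end HZero

/-! ### The decomposition -/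

/-- An open set and the family of its subdomains. -/
structure Decomposition (N m : ℕ) where
  /-- the whole domain `Ω` -/
  Ω : Set (E N)
  /-- the subdomains `Ω_i` -/
  sub : Fin m → Set (E N)

namespace Decomposition

variable {m : ℕ} (D : Decomposition N m)

/-- `Υ_ii` is the interior of `bdry Ω_i ∩ bdry Ω` relative to `bdry Ω` and, for `i < j`,
`Υ_ij = Υ_ji` is the interior of `bdry Ω_i ∩ bdry Ω_j` relative to `bdry Ω_i`. -/
def Υ (i j : Fin m) : Set (E N) :=
  if i = j then relInterior (frontier D.Ω) (frontier (D.sub i) ∩ frontier D.Ω)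
  else relInterior (frontier (D.sub (min i j)))
    (frontier (D.sub (min i j)) ∩ frontier (D.sub (max i j)))

lemma Υ_comm (i j : Fin m) : D.Υ i j = D.Υ j i := by
  by_cases h : i = j
  · subst h; rfl
  · simp only [Υ, h, Ne.symm h, if_false, min_comm i j, max_comm i j]

lemma Υ_subset_left (i j : Fin m) : D.Υ i j ⊆ frontier (D.sub i) := by
  unfold Υ
  split_ifs with h
  · rintro _ ⟨x, hx, rfl⟩
    exact (interior_subset hx).1
  · rintro _ ⟨x, hx, rfl⟩
    have h2 := interior_subset hx
    rcases le_total i j with hij | hij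
    · simpa [hij] using h2.1
    · simpa [hij] using h2.2

lemma Υ_subset_right (i j : Fin m) : D.Υ i j ⊆ frontier (D.sub j) := by
  rw [D.Υ_comm]; exact D.Υ_subset_left j i

/-- `J(i)`: the indices of the neighbors of `Ω_i`. -/
def J (i : Fin m) : Set (Fin m) := {j | j ≠ i ∧ (D.Υ i j).Nonempty}

/-- `K`: the indices `(i, j)`, `i < j`, of the interfaces. -/
def K : Set (Fin m × Fin m) := {k | k.1 < k.2 ∧ k.2 ∈ D.J k.1}

instance (i : Fin m) : Fintype (D.J i) := Fintype.ofFinite _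

instance : Fintype D.K := Fintype.ofFinite _

/-- The geometric assumptions. The last one, which holds in particular if the subdomains are
connected, says that no connected component of a subdomain `Ω_i` is away from the part `Υ_ii` of
its boundary. -/
structure IsAdmissible : Prop where
  isOpen : IsOpen D.Ω
  nonempty : D.Ω.Nonempty
  bounded : Bornology.IsBounded D.Ω
  lipschitz : HasLipschitzBoundary D.Ω
  isOpen_sub : ∀ i, IsOpen (D.sub i)
  sub_subset : ∀ i, D.sub i ⊆ D.Ω
  disjoint_sub : ∀ i j, i ≠ j → Disjoint (D.sub i) (D.sub j)
  lipschitz_sub : ∀ i, HasLipschitzBoundary (D.sub i)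
  closure_eq : closure D.Ω = ⋃ i, closure (D.sub i)
  nonempty_Υ : ∀ i, (D.Υ i i).Nonempty
  nonempty_J : ∀ i, (D.J i).Nonempty
  component : ∀ i, ∀ x ∈ D.sub i,
    (closure (connectedComponentIn (D.sub i) x) ∩ D.Υ i i).Nonempty

/-- `ℋ_i = H¹_{0,Υ_ii}(Ω_i)`. -/
abbrev H (i : Fin m) : Type := HZero (D.sub i) (D.Υ i i)

/-- The trace operator `T_ij : ℋ_i → L²(Υ_ij)`. -/
def T (i j : Fin m) (u : D.H i) : L2Surf (D.Υ i j) :=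
  HZero.traceOn (D.Υ_subset_left i j) u

/-- The trace operator `T_ji : ℋ_j → L²(Υ_ij)`, with values in the same space as `T_ij`. -/
def T' (i j : Fin m) (u : D.H j) : L2Surf (D.Υ i j) :=
  HZero.traceOn (D.Υ_subset_right i j) u

/-- `u` is the weak solution in `ℋ_i` of `-Δu = f` on `Ω_i`, `u = 0` on `Υ_ii`, with normal
derivative `h_j` on `Υ_ij` for `j ∈ J(i+)` and `-h_j` on `Υ_ij` for `j ∈ J(i-)`. -/
def IsWeakSolution (i : Fin m) (f : L2Vol (D.sub i)) (h : (j : D.J i) → L2Surf (D.Υ i j))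
    (u : D.H i) : Prop :=
  ∀ v : D.H i,
    ∫ x in D.sub i, inner ℝ (HZero.grad u x) (HZero.grad v x) =
      (∫ x in D.sub i, f x * HZero.fn v x) +
      ∑ j : D.J i, (if i < j.1 then 1 else -1) * ∫ x in D.Υ i j, h j x * D.T i j v x ∂(surf N)

open Classical in
/-- The operator `Q_i : L²(Ω_i) × 𝒢_i → ℋ_i`, sending the data to the weak solution. -/
def Q (i : Fin m) (f : L2Vol (D.sub i)) (h : (j : D.J i) → L2Surf (D.Υ i j)) : D.H i :=
  if hu : ∃ u, D.IsWeakSolution i f h u then hu.choose else 0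

/-- The primal space `⊕ ℋ_i`. -/
abbrev Primal : Type := PiLp 2 (fun i : Fin m => D.H i)

/-- The dual space `⊕_{(i,j) ∈ K} L²(Υ_ij)`. -/
abbrev Dual : Type := PiLp 2 (fun k : D.K => L2Surf (D.Υ k.1.1 k.1.2))

/-- The family `((g_ij)_{j ∈ J(i+)}, (g_ji)_{j ∈ J(i-)})` in `𝒢_i = ⊕_{j ∈ J(i)} L²(Υ_ij)`. -/
def interfaceData (g : D.Dual) (i : Fin m) (j : D.J i) : L2Surf (D.Υ i j) :=
  if h : i < j.1 then g ⟨(i, j.1), h, j.2⟩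
  else restrictSurf (D.Υ_comm i j.1).subset (g ⟨(j.1, i), lt_of_le_of_ne (not_lt.mp h) j.2.1,
    ⟨j.2.1.symm, by rw [D.Υ_comm]; exact j.2.2⟩⟩)

/-- The jump `T_ij u_i - T_ji u_j` across the interface `k = (i, j)`. -/
def jump (u : D.Primal) (k : D.K) : L2Surf (D.Υ k.1.1 k.1.2) :=
  D.T k.1.1 k.1.2 (u k.1.1) - D.T' k.1.1 k.1.2 (u k.1.2)

variable (φ : (i : Fin m) → D.H i → EReal)
  (ψ : (k : D.K) → L2Surf (D.Υ k.1.1 k.1.2) → EReal)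

/-- The set of pairs `(u, g)` with `g_ij ∈ ∂ψ_ij(T_ij u_i - T_ji u_j)` for every `(i, j) ∈ K` and
`-Q_i(0, (g_ij), (g_ji)) ∈ ∂φ_i(u_i)` for every `i`. -/
def optimalitySet : Set (WithLp 2 (D.Primal × D.Dual)) :=
  {p | (∀ k : D.K, p.snd k ∈ subdifferential (ψ k) (D.jump p.fst k)) ∧
    ∀ i, -D.Q i 0 (D.interfaceData p.snd i) ∈ subdifferential (φ i) (p.fst i)}

/-- `p` is a closest point to `p₀` in the optimality set. -/
def IsSolution (p₀ p : WithLp 2 (D.Primal × D.Dual)) : Prop :=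
  p ∈ D.optimalitySet φ ψ ∧ ∀ q ∈ D.optimalitySet φ ψ, ‖p - p₀‖ ≤ ‖q - p₀‖

/-- `∑ φ_i(u_i) + ∑ ψ_ij(T_ij u_i - T_ji u_j)`. -/
def primalObjective (u : D.Primal) : EReal :=
  ∑ i, φ i (u i) + ∑ k : D.K, ψ k (D.jump u k)

/-- `∑ φ_i*(-Q_i(0, (g_ij), (g_ji))) + ∑ ψ_ij*(g_ij)`. -/
def dualObjective (g : D.Dual) : EReal :=
  ∑ i, conjugate (φ i) (-D.Q i 0 (D.interfaceData g i)) + ∑ k : D.K, conjugate (ψ k) (g k)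

end Decomposition

end DomainDecomposition

end

open MeasureTheory Topology
open scoped ENNReal ContDiff

noncomputable section

namespace DomainDecomposition

/-! ### Hyperplanes and Lipschitz graphs -/

/-! Write Φ(u) = ∑ φ_i(u_i), Ψ(w) = ∑ ψ_ij(w_ij), and let Λ be the bounded operator u ↦ (T_ij u_i -
T_ji u_j). Testing the weak formulation of Q_i(0, ·) with v_i and summing over i gives ∑ ⟨v_i,
Q_i(0, g)⟩ = ⟨Λv, g⟩ (`sum_inner_Q`): the operators Q_i(0, ·) are the components of the adjoint Λ*.
So Z is the Kuhn–Tucker set of pairs with g ∈ ∂Ψ(Λu) and -Λ*g ∈ ∂Φ(u).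

Adding the two subgradient inequalities, tested at v and w, the terms ⟨u, Λ*g⟩ and ⟨Λu, g⟩ cancel.
What is left is Φ(u) + Ψ(Λu) + ⟨w - Λv, g⟩ ≤ Φ(v) + Ψ(w) for all v and w (`mem_optimalitySet_iff`).
For fixed (v, w) the left side is lower semicontinuous and convex in (u, g), so Z is an intersection
of closed convex sublevel sets and has a unique point closest to (u_0, g_0). Every point of Z is
optimal: w = Λv gives primal optimality, and the Fenchel–Young inequality, with equality on Z, gives
dual optimality.

The analytic work is to show that these objects exist. In a boundary chart, integration along lines
transversal to the boundary bounds boundary values by the H¹ norm (`IsChart.lintegral_surf_le`). C¹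
functions are dense in H¹, by a partition of unity and mollifiers whose support is shifted into the
domain (`dense_smoothH1`). The two facts give the trace operator.

The gradient seminorm is definite and complete on ℋ_i by a Poincaré inequality (`exists_poincare`).
It is proved without compact embeddings: the L² norm is controlled near Γ by the chart estimate, and
control is carried along translations through each connected component and then up to the boundary.
This needs Υ_ii, defined relative to bdry Ω, to be open in bdry Ω_i as well
(`exists_ball_inter_frontier_subset`). Riesz representation then gives Q_i. -/

/-- The hyperplane orthogonal to `e`. -/
abbrev Hyp {N : ℕ} (e : E N) : Type := ↥(ℝ ∙ e)ᗮ

/-- The orthogonal projection onto the hyperplane orthogonal to `e`. -/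
abbrev hypProj {N : ℕ} (e : E N) : E N →L[ℝ] Hyp e := (ℝ ∙ e)ᗮ.orthogonalProjectionOnto

section Hyperplane

variable {N : ℕ} {e : E N}

lemma inner_hyp (y : Hyp e) : inner ℝ e (y : E N) = 0 :=
  (Submodule.mem_orthogonal_singleton_iff_inner_right).1 y.2

lemma hypProj_add (he : ‖e‖ = 1) (x : E N) : (hypProj e x : E N) + inner ℝ e x • e = x := by
  have h := (ℝ ∙ e).starProjection_add_starProjection_orthogonal x
  rw [Submodule.starProjection_unit_singleton ℝ he] at h
  rw [add_comm]
  exact h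

lemma hypProj_coe (y : Hyp e) : hypProj e (y : E N) = y :=
  Submodule.orthogonalProjectionOnto_mem_subspace_eq_self y

lemma hypProj_self : hypProj e e = 0 :=
  Submodule.orthogonalProjectionOnto_orthogonalComplement_singleton_eq_zero e

lemma hypProj_add_smul (y : Hyp e) (s : ℝ) : hypProj e ((y : E N) + s • e) = y := by
  rw [map_add, map_smul, hypProj_self, smul_zero, add_zero, hypProj_coe]

lemma inner_add_smul (he : ‖e‖ = 1) (x : E N) (s : ℝ) :
    inner ℝ e (x + s • e) = inner ℝ e x + s := by
  rw [inner_add_right, inner_smul_right, real_inner_self_eq_norm_sq, he]; simp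

/-- Orthogonal coordinates (y, s) preserve volume, so Fubini applies to the lines parallel to `e`.
-/
lemma measurePreserving_hyp (he : ‖e‖ = 1) :
    MeasurePreserving (fun p : Hyp e × ℝ => (p.1 : E N) + p.2 • e) (volume.prod volume) volume := by
  have h1 := ((ℝ ∙ e).measurePreserving_measurableEquivProd (0 : E N)).symm
  rw [InnerProductSpace.euclideanHausdorffMeasure_eq_volume] at h1
  have h2 := (LinearIsometryEquiv.toSpanUnitSingleton (𝕜 := ℝ) e he).measurePreserving
  have h3 := (h2.prod (MeasurePreserving.id (volume : Measure (Hyp e)))).comp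
    (Measure.measurePreserving_swap (μ := (volume : Measure (Hyp e))) (ν := (volume : Measure ℝ)))
  have h4 := h1.comp h3
  refine (congrArg (fun f => MeasurePreserving f (volume.prod volume) volume) ?_).mp h4
  funext p
  simp [add_comm]

lemma lintegral_eq_hyp (he : ‖e‖ = 1) {F : E N → ℝ≥0∞} (hF : Measurable F) :
    ∫⁻ x, F x = ∫⁻ y : Hyp e, ∫⁻ s : ℝ, F ((y : E N) + s • e) := by
  rw [← (measurePreserving_hyp he).lintegral_comp hF, lintegral_prod]
  exact (hF.comp (measurePreserving_hyp he).measurable).aemeasurable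

lemma finrank_hyp (he : ‖e‖ = 1) : Module.finrank ℝ (Hyp e) = N - 1 := by
  have h0 : e ≠ 0 := by rintro rfl; simp at he
  have h := (ℝ ∙ e).finrank_add_finrank_orthogonal
  rw [finrank_span_singleton h0, finrank_euclideanSpace_fin] at h
  have : Module.finrank ℝ (Hyp e) = Module.finrank ℝ ↥(ℝ ∙ e)ᗮ := rfl
  omega

lemma volume_hyp (he : ‖e‖ = 1) :
    (volume : Measure (Hyp e)) = Measure.euclideanHausdorffMeasure (N - 1) := by
  rw [← InnerProductSpace.euclideanHausdorffMeasure_eq_volume, finrank_hyp he]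

/-- Both sides carry the same normalizing constant, so the bound for the unnormalized Hausdorff
measure carries over. -/
lemma euclideanHausdorffMeasure_image_le {X Y : Type*} [EMetricSpace X] [MeasurableSpace X]
    [BorelSpace X] [EMetricSpace Y] [MeasurableSpace Y] [BorelSpace Y] {K : NNReal} {f : X → Y}
    (hf : LipschitzWith K f) (d : ℕ) (s : Set X) :
    (Measure.euclideanHausdorffMeasure d : Measure Y) (f '' s) ≤
      (K : ℝ≥0∞) ^ d * (Measure.euclideanHausdorffMeasure d : Measure X) s := by
  rw [Measure.euclideanHausdorffMeasure_def, Measure.euclideanHausdorffMeasure_def,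
    Measure.smul_apply, Measure.smul_apply, ENNReal.smul_def, ENNReal.smul_def, smul_eq_mul,
    smul_eq_mul, mul_left_comm]
  gcongr
  simpa using hf.hausdorffMeasure_image_le (d := d) (by positivity) s

/-- The parametrization of the graph of `g` by the hyperplane orthogonal to `e`. -/
def graphMap (e : E N) (g : E N → ℝ) (y : Hyp e) : E N := (y : E N) + g y • e

lemma lipschitzWith_graphMap (he : ‖e‖ = 1) {g : E N → ℝ} {L : NNReal} (hg : LipschitzWith L g) :
    LipschitzWith (1 + L) (graphMap e g) := by
  refine LipschitzWith.of_dist_le_mul fun x y => ?_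
  have h1 := hg.dist_le_mul (x : E N) y
  have h2 : graphMap e g x - graphMap e g y = ((x : E N) - y) + (g x - g y) • e := by
    simp only [graphMap]; module
  rw [dist_eq_norm, h2]
  refine (norm_add_le _ _).trans ?_
  rw [norm_smul, he, mul_one, ← dist_eq_norm (g _), ← dist_eq_norm]
  rw [Subtype.dist_eq]
  push_cast
  linarith

lemma graphMap_hypProj (he : ‖e‖ = 1) {g : E N → ℝ}
    (hinv : ∀ (y : E N) (t : ℝ), g (y + t • e) = g y) (x : E N) :
    graphMap e g (hypProj e x) = x + (g x - inner ℝ e x) • e := by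
  have h := hypProj_add he x
  have h2 : g (hypProj e x) = g x := by
    conv_rhs => rw [← h, hinv]
  rw [graphMap, h2]
  conv_rhs => lhs; rw [← h]
  module

lemma hypProj_graphMap (g : E N → ℝ) (y : Hyp e) : hypProj e (graphMap e g y) = y :=
  hypProj_add_smul y _

lemma inner_graphMap (he : ‖e‖ = 1) {g : E N → ℝ}
    (hinv : ∀ (y : E N) (t : ℝ), g (y + t • e) = g y) (y : Hyp e) :
    inner ℝ e (graphMap e g y) = g (graphMap e g y) := by
  rw [graphMap, inner_add_smul he, inner_hyp, hinv, zero_add]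

/-- The part of `A` above `B` lies in the image of `B` under the graph map, which is (1 +
L)-Lipschitz. This replaces the area formula when surface integrals are bounded from above. -/
lemma surf_map_hypProj_le (he : ‖e‖ = 1) {g : E N → ℝ} {L : NNReal} (hg : LipschitzWith L g)
    (hinv : ∀ (y : E N) (t : ℝ), g (y + t • e) = g y) {A : Set (E N)}
    (hA : ∀ x ∈ A, inner ℝ e x = g x) :
    ((surf N).restrict A).map (hypProj e) ≤ ((1 + L : NNReal) ^ (N - 1) : ℝ≥0∞) • volume := by
  refine Measure.le_iff.2 fun B hB => ?_
  rw [Measure.map_apply (hypProj e).measurable hB,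
    Measure.restrict_apply ((hypProj e).measurable hB), Measure.smul_apply, smul_eq_mul,
    volume_hyp he]
  refine le_trans (measure_mono ?_) (euclideanHausdorffMeasure_image_le
    (lipschitzWith_graphMap he hg) (N - 1) B)
  rintro x ⟨hx1, hx2⟩
  refine ⟨hypProj e x, hx1, ?_⟩
  rw [graphMap_hypProj he hinv, hA x hx2]
  simp

lemma measurable_graphMap {g : E N → ℝ} (hg : Continuous g) : Measurable (graphMap e g) := by
  have : Continuous (graphMap e g) := by unfold graphMap; fun_prop
  exact this.measurable

/-- The projection is 1-Lipschitz and undoes the graph map. This is the opposite comparison, used to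
bound surface integrals from below. -/
lemma map_graphMap_le_surf (he : ‖e‖ = 1) {g : E N → ℝ} (hg : Continuous g)
    {B : Set (Hyp e)} {A : Set (E N)} (hBA : ∀ y ∈ B, graphMap e g y ∈ A) :
    (volume.restrict B).map (graphMap e g) ≤ (surf N).restrict A := by
  refine Measure.le_iff.2 fun C hC => ?_
  have hm := measurable_graphMap (e := e) hg
  rw [Measure.map_apply hm hC, Measure.restrict_apply (hm hC), Measure.restrict_apply hC,
    volume_hyp he]
  have h1 : LipschitzWith 1 (hypProj e) := Submodule.lipschitzWith_orthogonalProjectionOnto _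
  have h := euclideanHausdorffMeasure_image_le h1 (N - 1) (C ∩ A)
  rw [ENNReal.coe_one, one_pow, one_mul] at h
  refine le_trans (measure_mono ?_) h
  rintro y ⟨hy1, hy2⟩
  exact ⟨graphMap e g y, ⟨hy1, hBA y hy2⟩, hypProj_graphMap g y⟩

end Hyperplane

/-! ### Elementary estimates -/

/-- Cauchy–Schwarz applied to k^(1/2) and k^(1/2) f. It serves with k = 1 on segments and with k a
mollifier. -/
lemma sq_lintegral_le {α : Type*} [MeasurableSpace α] {μ : Measure α} {f k : α → ℝ≥0∞}
    (hf : AEMeasurable f μ) (hk : AEMeasurable k μ) :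
    (∫⁻ x, k x * f x ∂μ) ^ 2 ≤ (∫⁻ x, k x ∂μ) * ∫⁻ x, k x * f x ^ 2 ∂μ := by
  have h := ENNReal.lintegral_mul_le_Lp_mul_Lq μ (p := 2) (q := 2)
    (by constructor <;> norm_num) (f := fun x => k x ^ (1 / 2 : ℝ))
    (g := fun x => k x ^ (1 / 2 : ℝ) * f x) (hk.pow_const _) ((hk.pow_const _).mul hf)
  have e1 : ∀ a : ℝ≥0∞, a ^ (1 / 2 : ℝ) * a ^ (1 / 2 : ℝ) = a := fun a => by
    rw [← ENNReal.rpow_add_of_nonneg _ _ (by norm_num) (by norm_num)]; norm_num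
  have e2 : ∀ a : ℝ≥0∞, (a ^ (1 / 2 : ℝ)) ^ 2 = a := fun a => by rw [sq, e1]
  simp only [Pi.mul_apply, ← mul_assoc, e1] at h
  have h2 := pow_le_pow_left₀ (zero_le) h 2
  rw [mul_pow, e2, e2] at h2
  refine h2.trans (le_of_eq ?_)
  congr 1
  · refine lintegral_congr fun x => ?_
    rw [ENNReal.rpow_two, e2]
  · refine lintegral_congr fun x => ?_
    rw [ENNReal.rpow_two, mul_pow, e2]

lemma enorm_sq_add_le {F : Type*} [NormedAddCommGroup F] (x y : F) :
    ‖x + y‖ₑ ^ 2 ≤ 2 * ‖x‖ₑ ^ 2 + 2 * ‖y‖ₑ ^ 2 := by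
  refine (pow_le_pow_left₀ zero_le (enorm_add_le x y) 2).trans ?_
  have h := ENNReal.rpow_add_le_mul_rpow_add_rpow ‖x‖ₑ ‖y‖ₑ (p := 2) (by norm_num)
  norm_num at h
  rwa [mul_add] at h

section Line

variable {N : ℕ}

/-- The fundamental theorem of calculus between the two parameters, followed by Cauchy–Schwarz on an
interval of length d. All later estimates integrate this one over families of segments. -/
lemma enorm_sq_line_le {v : E N → ℝ} (hv : ContDiff ℝ 1 v) (x h : E N) {d a b : ℝ}
    (ha : a ∈ Set.Icc 0 d) (hb : b ∈ Set.Icc 0 d) :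
    ‖v (x + a • h)‖ₑ ^ 2 ≤ 2 * ‖v (x + b • h)‖ₑ ^ 2 +
      2 * (ENNReal.ofReal d * ‖h‖ₑ ^ 2) *
        ∫⁻ t in Set.Ioc 0 d, ‖fderiv ℝ v (x + t • h)‖ₑ ^ 2 := by
  have hc : Continuous fun t : ℝ => fderiv ℝ v (x + t • h) :=
    (hv.continuous_fderiv (by simp)).comp (by fun_prop)
  have hd : ∀ t : ℝ, HasDerivAt (fun t : ℝ => v (x + t • h)) (fderiv ℝ v (x + t • h) h) t := by
    intro t
    have h1 : HasDerivAt (fun t : ℝ => x + t • h) h t := by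
      simpa using ((hasDerivAt_id t).smul_const h).const_add x
    exact ((hv.differentiable (by simp) _).hasFDerivAt).comp_hasDerivAt t h1
  have h1 : ∫ t in b..a, fderiv ℝ v (x + t • h) h = v (x + a • h) - v (x + b • h) :=
    intervalIntegral.integral_eq_sub_of_hasDerivAt (fun t _ => hd t)
      ((hc.clm_apply continuous_const).intervalIntegrable _ _)
  have h2 : ‖v (x + a • h) - v (x + b • h)‖ₑ ≤
      ‖h‖ₑ * ∫⁻ t in Set.Ioc 0 d, ‖fderiv ℝ v (x + t • h)‖ₑ := by
    have e1 : ‖∫ t in b..a, fderiv ℝ v (x + t • h) h‖ₑ =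
        ‖∫ t in Set.uIoc b a, fderiv ℝ v (x + t • h) h‖ₑ :=
      enorm_eq_iff_norm_eq.2 (intervalIntegral.norm_intervalIntegral_eq _ _ _ _)
    rw [← h1, e1, ← lintegral_const_mul _ hc.enorm.measurable]
    refine (enorm_integral_le_lintegral_enorm _).trans ?_
    refine (lintegral_mono_set (Set.Ioc_subset_Ioc (le_min hb.1 ha.1) (max_le hb.2 ha.2))).trans ?_
    refine lintegral_mono fun t => ?_
    rw [mul_comm]
    exact ContinuousLinearMap.le_opENorm _ _
  have h3 : ‖v (x + a • h) - v (x + b • h)‖ₑ ^ 2 ≤ ENNReal.ofReal d * ‖h‖ₑ ^ 2 *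
        ∫⁻ t in Set.Ioc 0 d, ‖fderiv ℝ v (x + t • h)‖ₑ ^ 2 := by
    refine (pow_le_pow_left₀ zero_le h2 2).trans ?_
    have h4 := sq_lintegral_le (μ := volume.restrict (Set.Ioc 0 d)) (k := fun _ => 1)
      hc.enorm.aemeasurable aemeasurable_const
    simp only [one_mul, lintegral_const, Measure.restrict_apply MeasurableSet.univ,
      Set.univ_inter, Real.volume_Ioc, sub_zero] at h4
    rw [mul_pow, mul_comm (ENNReal.ofReal d), mul_assoc]
    gcongr
  have h5 := enorm_sq_add_le (v (x + b • h)) (v (x + a • h) - v (x + b • h))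
  rw [add_sub_cancel] at h5
  refine h5.trans ?_
  rw [mul_assoc 2]
  gcongr

end Line

/-! ### Boundary charts -/

section Chart

variable {N : ℕ} {U : Set (E N)} {p e : E N} {g : E N → ℝ} {L : NNReal} {R : ℝ}

/-- In the ball `B(p, R)`, the set `U` is the subgraph of the `L`-Lipschitz function `g` of the
coordinates orthogonal to the unit vector `e`. -/
structure IsChart (U : Set (E N)) (p e : E N) (g : E N → ℝ) (L : NNReal) (R : ℝ) : Prop where
  norm_eq : ‖e‖ = 1
  lip : LipschitzWith L g
  inv : ∀ (y : E N) (t : ℝ), g (y + t • e) = g y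
  pos : 0 < R
  mem_iff : ∀ y ∈ Metric.ball p R, (y ∈ U ↔ inner ℝ e y < g y)

lemma HasLipschitzBoundary.exists_isChart (hU : HasLipschitzBoundary U) (hp : p ∈ frontier U) :
    ∃ e g L R, IsChart U p e g L R := by
  obtain ⟨e, he, g, ⟨L, hL⟩, hinv, V, hV, h⟩ := hU p hp
  obtain ⟨R, hR, hRV⟩ := Metric.mem_nhds_iff.1 hV
  exact ⟨e, g, L, R, he, hL, hinv, hR, fun y hy => h y (hRV hy)⟩

namespace IsChart

lemma mem_of_inner_lt (h : IsChart U p e g L R) {y : E N} (hy : y ∈ Metric.ball p R)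
    (h2 : inner ℝ e y < g y) : y ∈ U := (h.mem_iff y hy).2 h2

lemma mono (h : IsChart U p e g L R) {r : ℝ} (hr : 0 < r) (hrR : r ≤ R) : IsChart U p e g L r :=
  ⟨h.norm_eq, h.lip, h.inv, hr, fun y hy => h.mem_iff y (Metric.ball_subset_ball hrR hy)⟩

lemma isOpen_below (h : IsChart U p e g L R) : IsOpen {y | inner ℝ e y < g y} :=
  isOpen_lt (by fun_prop) h.lip.continuous

lemma isOpen_above (h : IsChart U p e g L R) : IsOpen {y | g y < inner ℝ e y} :=
  isOpen_lt h.lip.continuous (by fun_prop)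

lemma not_mem_closure (h : IsChart U p e g L R) {y : E N} (hy : y ∈ Metric.ball p R)
    (h2 : g y < inner ℝ e y) : y ∉ closure U := by
  intro hc
  obtain ⟨z, ⟨hz1, hz2⟩, hz3⟩ := mem_closure_iff.1 hc _ (Metric.isOpen_ball.inter h.isOpen_above)
    ⟨hy, h2⟩
  exact absurd ((h.mem_iff z hz1).1 hz3) (not_lt.2 (le_of_lt hz2))

lemma sub_mem_ball (h : IsChart U p e g L R) {y : E N} {t : ℝ} {r : ℝ}
    (hy : y ∈ Metric.ball p r) (ht : |t| ≤ R - r) : y + t • e ∈ Metric.ball p R := by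
  rw [Metric.mem_ball, dist_eq_norm] at hy ⊢
  have : y + t • e - p = (y - p) + t • e := by abel
  rw [this]
  refine (norm_add_le _ _).trans_lt ?_
  rw [norm_smul, h.norm_eq, mul_one, Real.norm_eq_abs]
  linarith

lemma inner_add (h : IsChart U p e g L R) (x : E N) (s : ℝ) :
    inner ℝ e (x + s • e) = inner ℝ e x + s := inner_add_smul h.norm_eq x s

/-- Strictly below the graph is interior to `U`, strictly above is outside its closure. A point of
the graph is the limit of the points y + t e of `U` as t increases to 0. -/
lemma mem_frontier_iff (h : IsChart U p e g L R) {y : E N} (hy : y ∈ Metric.ball p R) :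
    y ∈ frontier U ↔ inner ℝ e y = g y := by
  constructor
  · intro hf
    rcases lt_trichotomy (inner ℝ e y) (g y) with h1 | h1 | h1
    · exact absurd (mem_interior.2 ⟨_, fun z hz => h.mem_of_inner_lt hz.1 hz.2,
        Metric.isOpen_ball.inter h.isOpen_below, ⟨hy, h1⟩⟩) hf.2
    · exact h1
    · exact absurd hf.1 (h.not_mem_closure hy h1)
  · intro h1
    refine ⟨?_, fun hi => absurd ((h.mem_iff y hy).1 (interior_subset hi)) (by rw [h1]; simp)⟩
    have hlim : Filter.Tendsto (fun t : ℝ => y + t • e) (𝓝[<] 0) (𝓝 y) := by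
      have : Continuous fun t : ℝ => y + t • e := by fun_prop
      simpa using (this.tendsto 0).mono_left nhdsWithin_le_nhds
    refine mem_closure_of_tendsto hlim ?_
    filter_upwards [hlim (Metric.isOpen_ball.mem_nhds hy), self_mem_nhdsWithin] with t ht1 ht2
    refine h.mem_of_inner_lt ht1 ?_
    rw [h.inner_add, h.inv, h1]
    have : t < 0 := ht2
    linarith

/-- The segment of length R/2 descending from a boundary point along -e stays in `U`. The value at
its top is bounded by the mean of the values on it and the derivative along it; Fubini turns these
into volume integrals. -/
lemma lintegral_surf_le (h : IsChart U p e g L R) (hU : IsOpen U) :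
    ∃ C : NNReal, ∀ v : E N → ℝ, ContDiff ℝ 1 v →
      ∫⁻ x in Metric.ball p (R / 2) ∩ frontier U, ‖v x‖ₑ ^ 2 ∂(surf N) ≤
        C * ∫⁻ x in U, (‖v x‖ₑ ^ 2 + ‖fderiv ℝ v x‖ₑ ^ 2) := by
  have hd : 0 < R / 2 := half_pos h.pos
  set d := R / 2 with hd_def
  set A := Metric.ball p d ∩ frontier U with hA
  set c : NNReal := Real.toNNReal d
  have hc : c ≠ 0 := by simpa [c] using hd
  have hcd : ENNReal.ofReal d = c := rfl
  have hAm : MeasurableSet A := Metric.isOpen_ball.measurableSet.inter isClosed_frontier.measurableSet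
  have hAR : ∀ x ∈ A, x ∈ Metric.ball p R := fun x hx =>
    Metric.ball_subset_ball (by rw [hd_def]; linarith) hx.1
  have hAg : ∀ x ∈ A, inner ℝ e x = g x := fun x hx => (h.mem_frontier_iff (hAR x hx)).1 hx.2
  refine ⟨c⁻¹ * (2 + 2 * c * c) * (1 + L) ^ (N - 1), fun v hv => ?_⟩
  set f : E N → ℝ≥0∞ := fun x => ‖v x‖ₑ ^ 2 + ‖fderiv ℝ v x‖ₑ ^ 2
  have hfd : Continuous (fderiv ℝ v) := hv.continuous_fderiv (by simp)
  have hfm : Measurable f :=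
    ((hv.continuous.enorm.measurable).pow_const 2).add ((hfd.enorm.measurable).pow_const 2)
  set F : E N → ℝ≥0∞ := U.indicator f with hF
  have hFm : Measurable F := hfm.indicator hU.measurableSet
  set Ψ : Hyp e → ℝ≥0∞ := fun y => ∫⁻ s : ℝ, F ((y : E N) + s • e)
  have hΨm : Measurable Ψ := by
    have : Measurable fun p : Hyp e × ℝ => F ((p.1 : E N) + p.2 • e) :=
      hFm.comp (measurePreserving_hyp h.norm_eq).measurable
    exact this.lintegral_prod_right'
  -- The line estimate is integrated over the free endpoint b in (0, d], which accounts for the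
  -- factor c = d on the left and for c * c in front of the gradient term.
  have key : ∀ x ∈ A, c * ‖v x‖ₑ ^ 2 ≤ (2 + 2 * c * c) * Ψ (hypProj e x) := by
    intro x hx
    have hmem : ∀ t ∈ Set.Ioc 0 d, x + t • (-e) ∈ U := by
      intro t ht
      rw [smul_neg, ← neg_smul]
      refine h.mem_of_inner_lt (h.sub_mem_ball hx.1 ?_) ?_
      · rw [abs_neg, abs_of_pos ht.1, hd_def]; have := ht.2; rw [hd_def] at this; linarith
      · rw [h.inner_add, h.inv, hAg x hx]; linarith [ht.1]
    have hcl : Continuous fun t : ℝ => x + t • (-e) := by fun_prop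
    have hm1 : Measurable fun t : ℝ => ‖v (x + t • (-e))‖ₑ ^ 2 :=
      ((hv.continuous.comp hcl).enorm.measurable).pow_const 2
    have h1 : c * ‖v x‖ₑ ^ 2 ≤ ∫⁻ b in Set.Ioc 0 d, (2 * ‖v (x + b • (-e))‖ₑ ^ 2 +
        2 * c * ∫⁻ t in Set.Ioc 0 d, ‖fderiv ℝ v (x + t • (-e))‖ₑ ^ 2) := by
      have : c * ‖v x‖ₑ ^ 2 = ∫⁻ b in Set.Ioc 0 d, ‖v x‖ₑ ^ 2 := by
        rw [lintegral_const, Measure.restrict_apply MeasurableSet.univ, Set.univ_inter,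
          Real.volume_Ioc, sub_zero, hcd, mul_comm]
      rw [this]
      refine setLIntegral_mono' measurableSet_Ioc fun b hb => ?_
      have h2 := enorm_sq_line_le hv x (-e) (d := d) (a := 0) (b := b) ⟨le_rfl, hd.le⟩
        ⟨hb.1.le, hb.2⟩
      have hn : ‖-e‖ₑ = 1 := by rw [enorm_neg, ← ofReal_norm, h.norm_eq, ENNReal.ofReal_one]
      rw [zero_smul, add_zero, hn, hcd] at h2
      simpa using h2
    refine h1.trans ?_
    rw [lintegral_add_left (hm1.const_mul 2), lintegral_const_mul _ hm1, lintegral_const,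
      Measure.restrict_apply MeasurableSet.univ, Set.univ_inter, Real.volume_Ioc, sub_zero, hcd]
    have h3 : ∫⁻ t in Set.Ioc 0 d, F (x + t • (-e)) ≤ Ψ (hypProj e x) := by
      refine (setLIntegral_le_lintegral _ _).trans (le_of_eq ?_)
      -- Substitution s = ⟨e, x⟩ - t: descending from x by t reaches the point of height s on the
      -- line through x.
      have h4 := lintegral_sub_left_eq_self (μ := (volume : Measure ℝ))
        (fun s => F ((hypProj e x : E N) + s • e)) (inner ℝ e x)
      refine Eq.trans (lintegral_congr fun t => ?_) h4
      congr 1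
      conv_lhs => rw [← hypProj_add h.norm_eq x]
      module
    have h4 : ∫⁻ t in Set.Ioc 0 d, ‖v (x + t • (-e))‖ₑ ^ 2 ≤ Ψ (hypProj e x) := by
      refine (setLIntegral_mono' measurableSet_Ioc fun t ht => ?_).trans h3
      rw [hF, Set.indicator_of_mem (hmem t ht)]
      exact le_self_add
    have h5 : ∫⁻ t in Set.Ioc 0 d, ‖fderiv ℝ v (x + t • (-e))‖ₑ ^ 2 ≤ Ψ (hypProj e x) := by
      refine (setLIntegral_mono' measurableSet_Ioc fun t ht => ?_).trans h3
      rw [hF, Set.indicator_of_mem (hmem t ht)]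
      exact le_add_self
    calc _ ≤ 2 * Ψ (hypProj e x) + 2 * c * Ψ (hypProj e x) * c := by gcongr
      _ = _ := by ring
  have h6 : c * ∫⁻ x in A, ‖v x‖ₑ ^ 2 ∂(surf N) ≤
      (2 + 2 * c * c) * ((1 + L : NNReal) ^ (N - 1) * ∫⁻ x in U, f x) := by
    rw [← lintegral_const_mul _ ((hv.continuous.enorm.measurable).pow_const 2)]
    refine (setLIntegral_mono' hAm key).trans ?_
    rw [lintegral_const_mul (f := fun x => Ψ (hypProj e x)) _ (hΨm.comp (hypProj e).measurable)]
    gcongr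
    rw [← lintegral_map hΨm (hypProj e).measurable]
    refine (lintegral_mono' (surf_map_hypProj_le h.norm_eq h.lip h.inv hAg) le_rfl).trans ?_
    rw [lintegral_smul_measure, smul_eq_mul, ← lintegral_eq_hyp h.norm_eq hFm, hF,
      lintegral_indicator hU.measurableSet]
  have h7 : ∀ a b : ℝ≥0∞, (c : ℝ≥0∞) * a ≤ b → a ≤ (c⁻¹ : NNReal) * b := by
    intro a b hab
    rw [ENNReal.coe_inv hc, mul_comm, ← div_eq_mul_inv,
      ENNReal.le_div_iff_mul_le (by simp [hc]) (by simp), mul_comm]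
    exact hab
  refine (h7 _ _ h6).trans (le_of_eq ?_)
  push_cast
  ring

/-- The same segments read the other way: an interior value is bounded by the boundary value above
it and the derivative in between. No term in the volume norm of `v` is needed on the right, which is
what a Poincaré inequality requires. -/
lemma lintegral_ball_le (h : IsChart U p e g L R) (hU : IsOpen U) (hp : p ∈ frontier U) :
    ∃ ρ : ℝ, 0 < ρ ∧ ∃ C : NNReal, ∀ v : E N → ℝ, ContDiff ℝ 1 v →
      ∫⁻ x in Metric.ball p ρ ∩ U, ‖v x‖ₑ ^ 2 ≤
        C * ((∫⁻ x in Metric.ball p (R / 2) ∩ frontier U, ‖v x‖ₑ ^ 2 ∂(surf N)) +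
          ∫⁻ x in U, ‖fderiv ℝ v x‖ₑ ^ 2) := by
  have hd : 0 < R / 2 := half_pos h.pos
  set d := R / 2 with hd_def
  set A := Metric.ball p d ∩ frontier U with hA
  set c : NNReal := Real.toNNReal d
  have hcd : ENNReal.ofReal d = c := rfl
  -- A point within ρ of p lies at most (L + 1)ρ below the graph, so the boundary point above it is
  -- within (L + 2)ρ = d of p.
  set ρ : ℝ := d / (L + 2) with hρ_def
  have hL2 : (0 : ℝ) < L + 2 := by positivity
  have hρ : 0 < ρ := div_pos hd hL2
  have hρd : (L + 2) * ρ = d := by rw [hρ_def]; field_simp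
  have hρd' : ρ ≤ d := by nlinarith [L.coe_nonneg]
  have hgp : g p = inner ℝ e p :=
    ((h.mem_frontier_iff (Metric.mem_ball_self h.pos)).1 hp).symm
  refine ⟨ρ, hρ, 2 * c + 2 * c * c, fun v hv => ?_⟩
  have hfd : Continuous (fderiv ℝ v) := hv.continuous_fderiv (by simp)
  set f : E N → ℝ≥0∞ := fun x => ‖v x‖ₑ ^ 2 with hf
  have hfm : Measurable f := (hv.continuous.enorm.measurable).pow_const 2
  set k : E N → ℝ≥0∞ := fun x => ‖fderiv ℝ v x‖ₑ ^ 2 with hk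
  have hkm : Measurable k := (hfd.enorm.measurable).pow_const 2
  set S := Metric.ball p ρ ∩ U with hS
  have hSm : MeasurableSet S := Metric.isOpen_ball.measurableSet.inter hU.measurableSet
  set G := graphMap e g
  have hGc : Continuous G := by
    have := h.lip.continuous
    simp only [G]; unfold graphMap; fun_prop
  have hGm : Measurable G := hGc.measurable
  set B : Set (Hyp e) := G ⁻¹' Metric.ball p d with hB
  have hBm : MeasurableSet B := hGm Metric.isOpen_ball.measurableSet
  have hGA : ∀ y ∈ B, G y ∈ A := by
    intro y hy
    refine ⟨hy, (h.mem_frontier_iff (Metric.ball_subset_ball ?_ hy)).2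
      (inner_graphMap h.norm_eq h.inv y)⟩
    rw [hd_def]; linarith [h.pos]
  have hmem : ∀ y ∈ B, ∀ t ∈ Set.Ioc 0 d, G y + t • (-e) ∈ U := by
    intro y hy t ht
    rw [smul_neg, ← neg_smul]
    refine h.mem_of_inner_lt (h.sub_mem_ball hy ?_) ?_
    · rw [abs_neg, abs_of_pos ht.1, hd_def]; have := ht.2; rw [hd_def] at this; linarith
    · rw [h.inner_add, h.inv, inner_graphMap h.norm_eq h.inv y]; linarith [ht.1]
  set I : Hyp e → ℝ≥0∞ := fun y => ∫⁻ t in Set.Ioc 0 d, k (G y + t • (-e)) with hI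
  have hline : Continuous fun q : Hyp e × ℝ => G q.1 + q.2 • (-e) := by fun_prop
  have hIm : Measurable I := by
    have : Measurable fun q : Hyp e × ℝ => k (G q.1 + q.2 • (-e)) := hkm.comp hline.measurable
    exact this.lintegral_prod_right'
  -- the estimate on a line
  have key : ∀ y : Hyp e, ∫⁻ s : ℝ, S.indicator f ((y : E N) + s • e) ≤
      B.indicator (fun y => c * (2 * f (G y) + 2 * c * I y)) y := by
    intro y
    have h1 : ∀ s : ℝ, S.indicator f ((y : E N) + s • e) ≤
        (Set.Ico (g y - d) (g y)).indicator
          (fun _ => B.indicator (fun y => 2 * f (G y) + 2 * c * I y) y) s := by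
      intro s
      by_cases hs : (y : E N) + s • e ∈ S
      · set x := (y : E N) + s • e with hx
        have hxp : ‖x - p‖ < ρ := by simpa [dist_eq_norm] using hs.1
        have hgx : g x = g y := h.inv _ _
        have hex : inner ℝ e x = s := by rw [hx, h.inner_add, inner_hyp, zero_add]
        have hlt : s < g y := by
          rw [← hgx, ← hex]
          refine (h.mem_iff x (Metric.ball_subset_ball ?_ hs.1)).1 hs.2
          rw [hd_def] at hρd'; linarith [h.pos]
        have h2 : |g x - g p| ≤ L * ‖x - p‖ := by
          simpa [dist_eq_norm] using h.lip.dist_le_mul x p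
        have h3 : |inner ℝ e x - inner ℝ e p| ≤ ‖x - p‖ := by
          rw [← inner_sub_right]
          simpa [h.norm_eq] using abs_real_inner_le_norm e (x - p)
        have h4 : g y - s ≤ (L + 1) * ‖x - p‖ := by
          rw [← hgx, ← hex]
          rw [hgp] at h2
          have := abs_le.1 h2; have := abs_le.1 h3
          linarith
        have h5 : (L + 1) * ‖x - p‖ ≤ (L + 1) * ρ :=
          mul_le_mul_of_nonneg_left hxp.le (by positivity)
        have h6 : g y - s ≤ d := by linarith
        have hGx : G y = x + (g y - s) • e := by
          simp only [G, graphMap, hx]; module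
        have hyB : y ∈ B := by
          change G y ∈ Metric.ball p d
          rw [hGx, Metric.mem_ball, dist_eq_norm]
          have : x + (g y - s) • e - p = (x - p) + (g y - s) • e := by abel
          rw [this]
          refine (norm_add_le _ _).trans_lt ?_
          rw [norm_smul, h.norm_eq, mul_one, Real.norm_eq_abs, abs_of_pos (by linarith)]
          linarith
        rw [Set.indicator_of_mem hs, Set.indicator_of_mem (by constructor <;> linarith),
          Set.indicator_of_mem hyB]
        have h7 := enorm_sq_line_le hv (G y) (-e) (d := d) (a := g y - s) (b := 0)
          ⟨by linarith, h6⟩ ⟨le_rfl, hd.le⟩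
        have hn : ‖-e‖ₑ = 1 := by rw [enorm_neg, ← ofReal_norm, h.norm_eq, ENNReal.ofReal_one]
        have hx2 : G y + (g y - s) • -e = x := by rw [hGx]; module
        rw [zero_smul, add_zero, hn, hcd, hx2] at h7
        rw [one_pow, mul_one] at h7
        exact h7
      · rw [Set.indicator_of_notMem hs]; exact zero_le
    refine (lintegral_mono h1).trans ?_
    rw [lintegral_indicator measurableSet_Ico, lintegral_const,
      Measure.restrict_apply MeasurableSet.univ, Set.univ_inter, Real.volume_Ico,
      sub_sub_cancel, hcd]
    by_cases hy : y ∈ B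
    · rw [Set.indicator_of_mem hy, Set.indicator_of_mem hy, mul_comm]
    · rw [Set.indicator_of_notMem hy, Set.indicator_of_notMem hy, zero_mul]
  have h8 : ∫⁻ y in B, f (G y) ≤ ∫⁻ x in A, f x ∂(surf N) := by
    rw [← lintegral_map hfm hGm]
    exact lintegral_mono' (map_graphMap_le_surf h.norm_eq h.lip.continuous hGA) le_rfl
  have h9 : ∫⁻ y in B, I y ≤ ∫⁻ x in U, k x := by
    rw [← lintegral_indicator hU.measurableSet,
      lintegral_eq_hyp h.norm_eq (hkm.indicator hU.measurableSet)]
    refine (setLIntegral_mono' hBm fun y hy => ?_).trans (setLIntegral_le_lintegral _ _)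
    have h10 := lintegral_sub_left_eq_self (μ := (volume : Measure ℝ))
      (fun s => U.indicator k ((y : E N) + s • e)) (g y)
    rw [← h10]
    refine (setLIntegral_mono' measurableSet_Ioc fun t ht => ?_).trans
      (setLIntegral_le_lintegral _ _)
    have : (y : E N) + (g y - t) • e = G y + t • (-e) := by simp only [G, graphMap]; module
    rw [this, Set.indicator_of_mem (hmem y hy t ht)]
  rw [← lintegral_indicator hSm, lintegral_eq_hyp h.norm_eq (hfm.indicator hSm)]
  refine (lintegral_mono key).trans ?_
  have hfG : Measurable fun y => f (G y) := hfm.comp hGm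
  rw [lintegral_indicator hBm, lintegral_const_mul (f := fun y => 2 * f (G y) + 2 * c * I y) _
      ((hfG.const_mul 2).add (hIm.const_mul _)),
    lintegral_add_left (hfG.const_mul 2), lintegral_const_mul _ hfG, lintegral_const_mul _ hIm]
  calc _ ≤ (c : ℝ≥0∞) * (2 * ∫⁻ x in A, f x ∂(surf N)) + c * (2 * c * ∫⁻ x in U, k x) := by
        rw [mul_add]; gcongr
    _ ≤ (2 * c + 2 * c * c) * (∫⁻ x in A, f x ∂(surf N)) +
        (2 * c + 2 * c * c) * ∫⁻ x in U, k x := by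
        rw [← mul_assoc, ← mul_assoc]
        refine add_le_add (mul_le_mul_left ?_ _) (mul_le_mul_left ?_ _)
        · rw [mul_comm]; exact le_self_add
        · refine le_trans (le_of_eq ?_) le_add_self; ring
    _ = _ := by push_cast; ring

end IsChart

/-- Integrates the line estimate over the segments from y to y + h. It lets an L² bound travel from
`A` to its translate at the price of a gradient term. -/
lemma lintegral_translate_le {A : Set (E N)} (hU : IsOpen U) (hA : MeasurableSet A) {h : E N}
    (hAU : ∀ y ∈ A, ∀ t ∈ Set.Icc (0 : ℝ) 1, y + t • h ∈ U) {v : E N → ℝ} (hv : ContDiff ℝ 1 v) :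
    ∫⁻ x in {x | x - h ∈ A}, ‖v x‖ₑ ^ 2 ≤ 2 * (∫⁻ x in A, ‖v x‖ₑ ^ 2) +
      2 * ‖h‖ₑ ^ 2 * ∫⁻ x in U, ‖fderiv ℝ v x‖ₑ ^ 2 := by
  have hfd : Continuous (fderiv ℝ v) := hv.continuous_fderiv (by simp)
  set f : E N → ℝ≥0∞ := fun x => ‖v x‖ₑ ^ 2 with hf
  have hfm : Measurable f := (hv.continuous.enorm.measurable).pow_const 2
  set k : E N → ℝ≥0∞ := fun x => ‖fderiv ℝ v x‖ₑ ^ 2 with hk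
  have hkm : Measurable k := (hfd.enorm.measurable).pow_const 2
  have hAm : MeasurableSet {x | x - h ∈ A} := (measurable_id.sub_const h) hA
  have e1 : ∫⁻ x in {x | x - h ∈ A}, f x = ∫⁻ y in A, f (y + h) := by
    rw [← lintegral_indicator hAm, ← lintegral_indicator hA,
      ← lintegral_add_right_eq_self _ h]
    refine lintegral_congr fun y => ?_
    have : y + h ∈ {x | x - h ∈ A} ↔ y ∈ A := by simp
    by_cases hy : y ∈ A
    · rw [Set.indicator_of_mem hy, Set.indicator_of_mem (this.2 hy)]
    · rw [Set.indicator_of_notMem hy, Set.indicator_of_notMem (mt this.1 hy)]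
  have e2 : ∀ y ∈ A, f (y + h) ≤ 2 * f y + 2 * ‖h‖ₑ ^ 2 * ∫⁻ t in Set.Ioc (0 : ℝ) 1,
      U.indicator k (y + t • h) := by
    intro y hy
    have h1 := enorm_sq_line_le hv y h (d := 1) (a := 1) (b := 0) (by simp) (by simp)
    rw [one_smul, zero_smul, add_zero, ENNReal.ofReal_one, one_mul] at h1
    refine h1.trans ?_
    gcongr 2 * _ + _ * ?_
    refine setLIntegral_mono' measurableSet_Ioc fun t ht => ?_
    rw [Set.indicator_of_mem (hAU y hy t ⟨ht.1.le, ht.2⟩)]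
  have hkU : Measurable (U.indicator k) := hkm.indicator hU.measurableSet
  have hjm : Measurable fun q : E N × ℝ => U.indicator k (q.1 + q.2 • h) :=
    hkU.comp (by fun_prop)
  rw [e1]
  refine (setLIntegral_mono' hA e2).trans ?_
  rw [lintegral_add_left (hfm.const_mul 2), lintegral_const_mul _ hfm,
    lintegral_const_mul _ hjm.lintegral_prod_right']
  gcongr 2 * _ + _ * ?_
  refine (setLIntegral_le_lintegral _ _).trans ?_
  rw [lintegral_lintegral_swap (f := fun y t => U.indicator k (y + t • h)) hjm.aemeasurable]
  have e3 : ∀ t : ℝ, ∫⁻ y, U.indicator k (y + t • h) = ∫⁻ x in U, k x := by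
    intro t
    rw [lintegral_add_right_eq_self (U.indicator k) (t • h), lintegral_indicator hU.measurableSet]
  simp only [e3, lintegral_const, Measure.restrict_apply MeasurableSet.univ, Set.univ_inter,
    Real.volume_Ioc, sub_zero, ENNReal.ofReal_one, mul_one, le_refl]

end Chart

/-! ### Square-integrable functions -/

section L2

variable {α F : Type*} [MeasurableSpace α] {μ : Measure α} [NormedAddCommGroup F]

lemma eLpNorm_two_sq (f : α → F) : eLpNorm f 2 μ ^ 2 = ∫⁻ x, ‖f x‖ₑ ^ 2 ∂μ := by
  have h := eLpNorm_nnreal_pow_eq_lintegral (μ := μ) (f := f) (p := 2) (by simp)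
  norm_num at h
  exact h

lemma enorm_sq_Lp (f : Lp F 2 μ) : ‖f‖ₑ ^ 2 = ∫⁻ x, ‖f x‖ₑ ^ 2 ∂μ := by
  rw [Lp.enorm_def, eLpNorm_two_sq]

lemma memLp_two_of_lintegral_lt_top {f : α → F} (hf : AEStronglyMeasurable f μ)
    (h : ∫⁻ x, ‖f x‖ₑ ^ 2 ∂μ < ⊤) : MemLp f 2 μ := by
  refine ⟨hf, lt_top_iff_ne_top.2 fun h0 => ?_⟩
  rw [← eLpNorm_two_sq, h0] at h
  simp at h

/-- The functional is the inner product with a fixed L² class. It makes each condition defining a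
weak gradient a closed one. -/
lemma continuous_integral_inner [InnerProductSpace ℝ F] {a : α → F} (ha : MemLp a 2 μ) :
    Continuous fun f : Lp F 2 μ => ∫ x, inner ℝ (a x) (f x) ∂μ := by
  have h : (fun f : Lp F 2 μ => ∫ x, inner ℝ (a x) (f x) ∂μ) =
      fun f => inner ℝ (ha.toLp a) f := by
    funext f
    rw [L2.inner_def]
    refine integral_congr_ae ?_
    filter_upwards [ha.coeFn_toLp] with x hx
    rw [hx]
  rw [h]
  fun_prop

/-- Restriction of square-integrable functions to a smaller set. -/
def restrictL2 {A B : Set α} (h : A ⊆ B) : Lp F 2 (μ.restrict B) →+ Lp F 2 (μ.restrict A) :=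
  AddMonoidHom.mk'
    (fun f => MemLp.toLp f ((Lp.memLp f).mono_measure (Measure.restrict_mono_set μ h)))
    fun f g => by
      rw [← MemLp.toLp_add]
      refine MemLp.toLp_congr _ _ ?_
      exact ae_mono (Measure.restrict_mono_set μ h) (Lp.coeFn_add f g)

lemma coeFn_restrictL2 {A B : Set α} (h : A ⊆ B) (f : Lp F 2 (μ.restrict B)) :
    restrictL2 h f =ᵐ[μ.restrict A] f :=
  MemLp.coeFn_toLp ((Lp.memLp f).mono_measure (Measure.restrict_mono_set μ h))

lemma enorm_sq_restrictL2 {A B : Set α} (h : A ⊆ B) (f : Lp F 2 (μ.restrict B)) :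
    ‖restrictL2 h f‖ₑ ^ 2 = ∫⁻ x in A, ‖f x‖ₑ ^ 2 ∂μ := by
  rw [enorm_sq_Lp]
  refine lintegral_congr_ae ?_
  filter_upwards [coeFn_restrictL2 h f] with x hx
  rw [hx]

lemma norm_restrictL2_le {A B : Set α} (h : A ⊆ B) (f : Lp F 2 (μ.restrict B)) :
    ‖restrictL2 h f‖ ≤ ‖f‖ := by
  rw [← enorm_le_iff_norm_le, ← ENNReal.pow_le_pow_left_iff (n := 2) (by norm_num),
    enorm_sq_restrictL2, enorm_sq_Lp]
  exact lintegral_mono_set h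

lemma continuous_restrictL2 {A B : Set α} (h : A ⊆ B) :
    Continuous (restrictL2 (F := F) (μ := μ) h) := by
  refine LipschitzWith.continuous (K := 1) (LipschitzWith.of_dist_le_mul fun f g => ?_)
  rw [dist_eq_norm, dist_eq_norm, ← map_sub, NNReal.coe_one, one_mul]
  exact norm_restrictL2_le h _

/-- The integral is the squared norm of the restriction. This allows inequalities proved for C¹
functions to pass to all of H¹ by density. -/
lemma continuous_setLIntegral_enorm_sq {A B : Set α} (h : A ⊆ B) :
    Continuous fun f : Lp F 2 (μ.restrict B) => ∫⁻ x in A, ‖f x‖ₑ ^ 2 ∂μ := by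
  simp only [← enorm_sq_restrictL2 h]
  exact (ENNReal.continuous_pow 2).comp (continuous_restrictL2 h).enorm

end L2

/-! ### Weak gradients -/

section WeakGradient

variable {N : ℕ} {U : Set (E N)} {u u' : E N → ℝ} {G G' : E N → E N}

lemma HasWeakGradient.congr (h : HasWeakGradient U u G) (hu : u =ᵐ[volume.restrict U] u')
    (hG : G =ᵐ[volume.restrict U] G') : HasWeakGradient U u' G' := by
  intro θ h1 h2 h3 v
  have e1 : ∫ x in U, u' x * fderiv ℝ θ x v = ∫ x in U, u x * fderiv ℝ θ x v :=
    integral_congr_ae (hu.mono fun x hx => by beta_reduce; rw [hx])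
  have e2 : ∫ x in U, inner ℝ (G' x) v * θ x = ∫ x in U, inner ℝ (G x) v * θ x :=
    integral_congr_ae (hG.mono fun x hx => by beta_reduce; rw [hx])
  rw [e1, e2, h θ h1 h2 h3 v]

lemma fderiv_eq_zero_of_notMem_tsupport {θ : E N → ℝ} {x : E N} (hx : x ∉ tsupport θ) :
    fderiv ℝ θ x = 0 := by
  by_contra h
  exact hx (support_fderiv_subset ℝ h)

lemma inner_gradient (v : E N → ℝ) (x w : E N) : inner ℝ (gradient v x) w = fderiv ℝ v x w := by
  simp [gradient, InnerProductSpace.toDual_symm_apply]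

lemma enorm_gradient (v : E N → ℝ) (x : E N) : ‖gradient v x‖ₑ = ‖fderiv ℝ v x‖ₑ := by
  rw [gradient, LinearIsometryEquiv.enorm_map]

lemma continuous_gradient {v : E N → ℝ} (hv : ContDiff ℝ 1 v) : Continuous (gradient v) :=
  (InnerProductSpace.toDual ℝ (E N)).symm.continuous.comp (hv.continuous_fderiv (by simp))

lemma hasWeakGradient_of_contDiff {v : E N → ℝ} (hv : ContDiff ℝ 1 v) :
    HasWeakGradient U v (gradient v) := by
  intro θ h1 h2 h3 w
  have hθd : Continuous (fun x => fderiv ℝ θ x w) :=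
    (h1.continuous_fderiv (by simp)).clm_apply continuous_const
  have hvd : Continuous (fun x => fderiv ℝ v x w) :=
    (hv.continuous_fderiv (by simp)).clm_apply continuous_const
  have e1 : ∫ x in U, v x * fderiv ℝ θ x w = ∫ x, v x * fderiv ℝ θ x w :=
    setIntegral_eq_integral_of_forall_compl_eq_zero fun x hx => by
      rw [fderiv_eq_zero_of_notMem_tsupport fun h => hx (h3 h)]; simp
  have e2 : ∫ x in U, inner ℝ (gradient v x) w * θ x = ∫ x, fderiv ℝ v x w * θ x := by
    simp only [inner_gradient]
    exact setIntegral_eq_integral_of_forall_compl_eq_zero fun x hx => by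
      rw [image_eq_zero_of_notMem_tsupport fun h => hx (h3 h)]; simp
  rw [e1, e2]
  refine integral_mul_fderiv_eq_neg_fderiv_mul_of_integrable ?_ ?_ ?_ ?_ ?_
  · exact (hvd.mul h1.continuous).integrable_of_hasCompactSupport h2.mul_left
  · exact (hv.continuous.mul hθd).integrable_of_hasCompactSupport (h2.fderiv_apply ℝ w).mul_left
  · exact (hv.continuous.mul h1.continuous).integrable_of_hasCompactSupport h2.mul_left
  · exact fun x _ => hv.differentiable (by simp) x
  · exact fun x _ => h1.differentiable (by simp) x

lemma MemLp.integrableOn_of_two {F : Type*} [NormedAddCommGroup F] {f : E N → F} {K : Set (E N)}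
    (hf : MemLp f 2 (volume.restrict U)) (hKU : K ⊆ U) (hK : IsCompact K) :
    IntegrableOn f K := by
  have : IsFiniteMeasure ((volume : Measure (E N)).restrict K) :=
    ⟨by simpa using hK.measure_lt_top⟩
  exact (hf.mono_measure (Measure.restrict_mono_set volume hKU)).integrable (by norm_num)

/-- The difference integrates to zero against every test function, so the fundamental lemma of the
calculus of variations applies. -/
lemma HasWeakGradient.unique (hU : IsOpen U) (h : HasWeakGradient U u G)
    (h' : HasWeakGradient U u G') (hG : MemLp G 2 (volume.restrict U))
    (hG' : MemLp G' 2 (volume.restrict U)) : G =ᵐ[volume.restrict U] G' := by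
  have hs := hG.sub hG'
  have hz : ∀ᵐ x, x ∈ U → (G - G') x = 0 := by
    refine hU.ae_eq_zero_of_integral_contDiff_smul_eq_zero ?_ ?_
    · refine (locallyIntegrableOn_iff hU.isLocallyClosed).2 fun K hKU hK => ?_
      exact MemLp.integrableOn_of_two hs hKU hK
    · intro θ h1 h2 h3
      have e0 : ∫ x, θ x • (G - G') x = ∫ x in U, θ x • (G - G') x :=
        (setIntegral_eq_integral_of_forall_compl_eq_zero fun x hx => by
          rw [image_eq_zero_of_notMem_tsupport fun h => hx (h3 h), zero_smul]).symm
      have hi : Integrable (fun x => θ x • (G - G') x) (volume.restrict U) := by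
        have hθ : MemLp θ 2 ((volume : Measure (E N)).restrict U) :=
          h1.continuous.memLp_of_hasCompactSupport h2
        exact memLp_one_iff_integrable.1 (hs.smul hθ)
      rw [e0]
      refine ext_inner_right ℝ fun w => ?_
      have j1 := integrable_mul_of_compactSupport (hG.inner_const w) h1.continuous h2
      have j2 := integrable_mul_of_compactSupport (hG'.inner_const w) h1.continuous h2
      rw [real_inner_comm, ← integral_inner hi, inner_zero_left]
      have e1 : ∀ x, inner ℝ w (θ x • (G - G') x) =
          inner ℝ (G x) w * θ x - inner ℝ (G' x) w * θ x := by
        intro x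
        rw [inner_smul_right, Pi.sub_apply, inner_sub_right, real_inner_comm w, real_inner_comm w]
        ring
      simp only [e1]
      rw [integral_sub j1 j2]
      have e2 := h θ h1 h2 h3 w
      rw [h' θ h1 h2 h3 w] at e2
      linarith
  rw [Filter.EventuallyEq, ae_restrict_iff' hU.measurableSet]
  filter_upwards [hz] with x hx hxU
  exact sub_eq_zero.1 (hx hxU)

/-- Test the weak gradient of `u` with ζθ and expand D(ζθ). -/
lemma HasWeakGradient.mul_smooth (h : HasWeakGradient U u G) (hu : MemLp u 2 (volume.restrict U))
    (hG : MemLp G 2 (volume.restrict U)) {ζ : E N → ℝ} (hζ : ContDiff ℝ ∞ ζ) :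
    HasWeakGradient U (fun x => ζ x * u x) (fun x => ζ x • G x + u x • gradient ζ x) := by
  intro θ h1 h2 h3 w
  have hζθ : ContDiff ℝ ∞ (fun x => ζ x * θ x) := hζ.mul h1
  have hcs : HasCompactSupport (fun x => ζ x * θ x) := h2.mul_left
  have hts : tsupport (fun x => ζ x * θ x) ⊆ U := (tsupport_mul_subset_right).trans h3
  have hd : ∀ x, fderiv ℝ (fun x => ζ x * θ x) x w = ζ x * fderiv ℝ θ x w + θ x * fderiv ℝ ζ x w := by
    intro x
    have := fderiv_mul (hζ.differentiable (by simp) x) (h1.differentiable (by simp) x)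
    change fderiv ℝ (ζ * θ) x w = _
    rw [this]; simp
  have hθd : Continuous (fun x => fderiv ℝ θ x w) :=
    (h1.continuous_fderiv (by simp)).clm_apply continuous_const
  have hζd : Continuous (fun x => fderiv ℝ ζ x w) :=
    (hζ.continuous_fderiv (by simp)).clm_apply continuous_const
  have i1 : Integrable (fun x => u x * (ζ x * fderiv ℝ θ x w)) (volume.restrict U) :=
    integrable_mul_of_compactSupport hu (hζ.continuous.mul hθd)
    (h2.fderiv_apply ℝ w).mul_left
  have i2 : Integrable (fun x => u x * (θ x * fderiv ℝ ζ x w)) (volume.restrict U) :=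
    integrable_mul_of_compactSupport hu (h1.continuous.mul hζd) h2.mul_right
  have i3 := integrable_mul_of_compactSupport (hG.inner_const w) hζθ.continuous hcs
  have e := h _ hζθ hcs hts w
  have e1 : ∫ x in U, u x * fderiv ℝ (fun x => ζ x * θ x) x w =
      (∫ x in U, u x * (ζ x * fderiv ℝ θ x w)) + ∫ x in U, u x * (θ x * fderiv ℝ ζ x w) := by
    rw [← integral_add i1 i2]
    exact integral_congr_ae (Filter.Eventually.of_forall fun x => by
      beta_reduce; rw [hd]; ring)
  have e2 : ∫ x in U, inner ℝ (ζ x • G x + u x • gradient ζ x) w * θ x =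
      (∫ x in U, inner ℝ (G x) w * (ζ x * θ x)) + ∫ x in U, u x * (θ x * fderiv ℝ ζ x w) := by
    rw [← integral_add i3 i2]
    exact integral_congr_ae (Filter.Eventually.of_forall fun x => by
      beta_reduce
      rw [inner_add_left, real_inner_smul_left, real_inner_smul_left, inner_gradient]; ring)
  have e3 : ∫ x in U, ζ x * u x * fderiv ℝ θ x w = ∫ x in U, u x * (ζ x * fderiv ℝ θ x w) :=
    integral_congr_ae (Filter.Eventually.of_forall fun x => by beta_reduce; ring)
  rw [e2, e3]
  rw [e1] at e
  linarith

end WeakGradient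

/-! ### The Sobolev space -/

section Sobolev

variable {N : ℕ} {U : Set (E N)}

/-- The function underlying an element of `H¹`. -/
def H1.fn : H1 U →L[ℝ] L2Vol U :=
  (WithLp.fstL 2 ℝ (L2Vol U) (L2VolVec U)).comp (H1 U).subtypeL

/-- The weak gradient of an element of `H¹`. -/
def H1.grad : H1 U →L[ℝ] L2VolVec U :=
  (WithLp.sndL 2 ℝ (L2Vol U) (L2VolVec U)).comp (H1 U).subtypeL

lemma H1.hasWeakGradient (u : H1 U) : HasWeakGradient U (H1.fn u) (H1.grad u) := u.2

lemma H1.exists_of_hasWeakGradient {u : E N → ℝ} {G : E N → E N}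
    (hu : MemLp u 2 (volume.restrict U)) (hG : MemLp G 2 (volume.restrict U))
    (h : HasWeakGradient U u G) :
    ∃ q : H1 U, H1.fn q =ᵐ[volume.restrict U] u ∧
      H1.grad q =ᵐ[volume.restrict U] G :=
  ⟨⟨WithLp.toLp 2 (hu.toLp u, hG.toLp G), h.congr hu.coeFn_toLp.symm hG.coeFn_toLp.symm⟩,
    hu.coeFn_toLp, hG.coeFn_toLp⟩

lemma H1.ext {u v : H1 U} (h1 : H1.fn u = H1.fn v) (h2 : H1.grad u = H1.grad v) : u = v :=
  Subtype.ext (WithLp.ofLp_injective 2 (Prod.ext h1 h2))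

lemma H1.norm_sq (u : H1 U) : ‖u‖ ^ 2 = ‖H1.fn u‖ ^ 2 + ‖H1.grad u‖ ^ 2 :=
  WithLp.prod_norm_sq_eq_of_L2 (u : WithLp 2 (L2Vol U × L2VolVec U))

lemma H1.enorm_sq (u : H1 U) : ‖u‖ₑ ^ 2 =
    (∫⁻ x in U, ‖H1.fn u x‖ₑ ^ 2) + ∫⁻ x in U, ‖H1.grad u x‖ₑ ^ 2 := by
  rw [← enorm_sq_Lp, ← enorm_sq_Lp, ← ofReal_norm, ← ofReal_norm, ← ofReal_norm,
    ← ENNReal.ofReal_pow (norm_nonneg _), ← ENNReal.ofReal_pow (norm_nonneg _),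
    ← ENNReal.ofReal_pow (norm_nonneg _), ← ENNReal.ofReal_add (by positivity) (by positivity),
    H1.norm_sq]

/-- For each test function and direction the defining identity equates two continuous functionals of
the pair. Completeness of H¹ follows. -/
lemma isClosed_H1 (U : Set (E N)) : IsClosed (H1 U : Set (WithLp 2 (L2Vol U × L2VolVec U))) := by
  have h : (H1 U : Set (WithLp 2 (L2Vol U × L2VolVec U))) =
      ⋂ (θ : E N → ℝ) (_ : ContDiff ℝ ∞ θ) (_ : HasCompactSupport θ) (_ : tsupport θ ⊆ U)
        (v : E N), {p : WithLp 2 (L2Vol U × L2VolVec U) |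
          ∫ x in U, p.fst x * fderiv ℝ θ x v = - ∫ x in U, inner ℝ (p.snd x) v * θ x} := by
    ext p
    simp only [Set.mem_iInter]
    rfl
  rw [h]
  refine isClosed_iInter fun θ => isClosed_iInter fun h1 => isClosed_iInter fun h2 =>
    isClosed_iInter fun h3 => isClosed_iInter fun v => ?_
  have m1 : MemLp (fun x => fderiv ℝ θ x v) 2 ((volume : Measure (E N)).restrict U) :=
    ((h1.continuous_fderiv (by simp)).clm_apply continuous_const).memLp_of_hasCompactSupport
      (h2.fderiv_apply ℝ v)
  have m2 : MemLp (fun x => θ x • v) 2 ((volume : Measure (E N)).restrict U) :=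
    (h1.continuous.smul continuous_const).memLp_of_hasCompactSupport h2.smul_right
  have c1 := (continuous_integral_inner m1).comp (WithLp.fstL 2 ℝ (L2Vol U) (L2VolVec U)).continuous
  have c2 := (continuous_integral_inner m2).comp (WithLp.sndL 2 ℝ (L2Vol U) (L2VolVec U)).continuous
  refine isClosed_eq (c1.congr fun p => ?_) (c2.neg.congr fun p => ?_)
  · rfl
  · simp only [real_inner_smul_left]
    refine congrArg _ (integral_congr_ae (Filter.Eventually.of_forall fun x => ?_))
    beta_reduce
    rw [mul_comm, real_inner_comm]
    rfl

instance : CompleteSpace (H1 U) := (isClosed_H1 U).completeSpace_coe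

end Sobolev

open scoped Convolution

/-! ### Mollification -/

section Mollify

variable {N : ℕ} {F : Type*} [NormedAddCommGroup F]

/-- Continuity of translations in L², read at z = 0. -/
lemma exists_eLpNorm_translate_sub_le {f : E N → F} (hf : MemLp f 2) {ε : ℝ≥0∞} (hε : 0 < ε) :
    ∃ s : ℝ, 0 < s ∧ ∀ z : E N, ‖z‖ < s → eLpNorm (fun y => f (y - z) - f y) 2 volume ≤ ε := by
  have mp : ∀ z : E N, MeasurePreserving (fun y => y - z) volume volume := fun z =>
    measurePreserving_sub_right volume z
  let g : E N → C(E N, E N) := fun z => ⟨fun y => y - z, by fun_prop⟩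
  have hg : Continuous g := by
    refine ContinuousMap.continuous_of_continuous_uncurry _ ?_
    simp only [Function.uncurry_def, g, ContinuousMap.coe_mk]
    fun_prop
  set f₀ : Lp F 2 (volume : Measure (E N)) := hf.toLp f with hf₀
  have hc : Continuous fun z => Lp.compMeasurePreserving (g z) (mp z) f₀ :=
    (continuous_const (y := f₀)).compMeasurePreservingLp hg mp (by simp)
  have h0 : ∀ z, ‖Lp.compMeasurePreserving (g z) (mp z) f₀ - f₀‖ₑ =
      eLpNorm (fun y => f (y - z) - f y) 2 volume := by
    intro z
    rw [Lp.enorm_def]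
    refine eLpNorm_congr_ae ?_
    have h1 := hf.coeFn_toLp
    have h2 := (mp z).quasiMeasurePreserving.ae_eq_comp h1
    filter_upwards [Lp.coeFn_sub (Lp.compMeasurePreserving (g z) (mp z) f₀) f₀, h1, h2,
      Lp.coeFn_compMeasurePreserving f₀ (mp z)] with y e1 e2 e3 e4
    rw [e1, Pi.sub_apply, e2]
    congr 1
    exact e4.trans e3
  have hz0 : Lp.compMeasurePreserving (g 0) (mp 0) f₀ - f₀ = 0 := by
    rw [← enorm_eq_zero, h0]
    simp
  have ht : Filter.Tendsto (fun z => ‖Lp.compMeasurePreserving (g z) (mp z) f₀ - f₀‖ₑ) (𝓝 0)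
      (𝓝 0) := by
    have hcc : Continuous fun z => ‖Lp.compMeasurePreserving (g z) (mp z) f₀ - f₀‖ₑ :=
      (hc.sub continuous_const).enorm
    have := hcc.tendsto 0
    rwa [hz0, enorm_zero] at this
  obtain ⟨s, hs, h⟩ := Metric.eventually_nhds_iff.1 (ht.eventually (ge_mem_nhds hε))
  refine ⟨s, hs, fun z hz => ?_⟩
  rw [← h0]
  exact h (by simpa using hz)

variable [NormedSpace ℝ F]

/-- Since `k` is a probability density, Cauchy–Schwarz gives |k ⋆ f - f|²(y) ≤ ∫ k(z) |f(y - z) -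
f(y)|² dz. Integrate in y and exchange the integrals. -/
lemma eLpNorm_convolution_sub_le [CompleteSpace F] {f : E N → F} (hfm : StronglyMeasurable f)
    (hf : MemLp f 2)
    {k : E N → ℝ} (hk : Continuous k) (hk0 : ∀ x, 0 ≤ k x) (hk1 : ∫ x, k x = 1)
    (hkc : HasCompactSupport k) {s : ℝ} {ε : ℝ≥0∞} (hks : ∀ z, k z ≠ 0 → ‖z‖ < s)
    (h : ∀ z : E N, ‖z‖ < s → eLpNorm (fun y => f (y - z) - f y) 2 volume ≤ ε) :
    eLpNorm (k ⋆[ContinuousLinearMap.lsmul ℝ ℝ, volume] f - f) 2 volume ≤ ε := by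
  have hki : Integrable k := hk.integrable_of_hasCompactSupport hkc
  have hk1' : ∫⁻ z, ‖k z‖ₑ = 1 := by
    have := ofReal_integral_eq_lintegral_ofReal hki (Filter.Eventually.of_forall hk0)
    rw [hk1, ENNReal.ofReal_one] at this
    rw [this]
    exact lintegral_congr fun z => Real.enorm_of_nonneg (hk0 z)
  have hex : ConvolutionExists k f (ContinuousLinearMap.lsmul ℝ ℝ) volume :=
    hkc.convolutionExists_left _ hk (hf.locallyIntegrable (by norm_num))
  have hmeas : StronglyMeasurable fun q : E N × E N => f (q.1 - q.2) - f q.1 :=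
    (hfm.comp_measurable (by fun_prop)).sub (hfm.comp_measurable (by fun_prop))
  have hpt : ∀ y, ‖(k ⋆[ContinuousLinearMap.lsmul ℝ ℝ, volume] f - f) y‖ₑ ^ 2 ≤
      ∫⁻ z, ‖k z‖ₑ * ‖f (y - z) - f y‖ₑ ^ 2 := by
    intro y
    have e1 : (k ⋆[ContinuousLinearMap.lsmul ℝ ℝ, volume] f - f) y =
        ∫ z, k z • (f (y - z) - f y) := by
      have hi1 : Integrable fun z => k z • f (y - z) := (hex y).integrable
      have hi2 : Integrable fun z => k z • f y := hki.smul_const _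
      simp only [smul_sub]
      rw [integral_sub hi1 hi2, integral_smul_const, hk1, one_smul, Pi.sub_apply,
        convolution_lsmul]
    have h1 : ‖(k ⋆[ContinuousLinearMap.lsmul ℝ ℝ, volume] f - f) y‖ₑ ≤
        ∫⁻ z, ‖k z‖ₑ * ‖f (y - z) - f y‖ₑ := by
      rw [e1]
      refine (enorm_integral_le_lintegral_enorm _).trans (le_of_eq ?_)
      exact lintegral_congr fun z => enorm_smul _ _
    refine (pow_le_pow_left₀ zero_le h1 2).trans ?_
    have hm1 : Measurable fun z => ‖f (y - z) - f y‖ₑ :=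
      (hmeas.comp_measurable (measurable_const.prodMk measurable_id)).enorm
    have := sq_lintegral_le (μ := (volume : Measure (E N))) hm1.aemeasurable
      hk.enorm.measurable.aemeasurable
    rwa [hk1', one_mul] at this
  rw [← ENNReal.pow_le_pow_left_iff (n := 2) (by norm_num), eLpNorm_two_sq]
  refine (lintegral_mono hpt).trans ?_
  have hm2 : Measurable fun q : E N × E N => ‖k q.2‖ₑ * ‖f (q.1 - q.2) - f q.1‖ₑ ^ 2 :=
    (hk.enorm.measurable.comp measurable_snd).mul (hmeas.enorm.pow_const 2)
  rw [lintegral_lintegral_swap (f := fun y z => ‖k z‖ₑ * ‖f (y - z) - f y‖ₑ ^ 2) hm2.aemeasurable]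
  calc ∫⁻ z, ∫⁻ y, ‖k z‖ₑ * ‖f (y - z) - f y‖ₑ ^ 2 ≤ ∫⁻ z, ‖k z‖ₑ * ε ^ 2 := by
        refine lintegral_mono fun z => ?_
        by_cases hz : k z = 0
        · simp [hz]
        · rw [lintegral_const_mul' _ _ (by simp), ← eLpNorm_two_sq]
          gcongr
          exact h z (hks z hz)
    _ = ε ^ 2 := by rw [lintegral_mul_const _ hk.enorm.measurable, hk1', one_mul]

end Mollify

/-! ### Density of smooth functions -/

section Density

variable {N : ℕ} {U : Set (E N)}

/-- The elements of `H¹(U)` that are restrictions of `C¹` functions on the whole space. -/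
def smoothH1 (U : Set (E N)) : Submodule ℝ (H1 U) where
  carrier := {u | ∃ v : E N → ℝ, ContDiff ℝ 1 v ∧ H1.fn u =ᵐ[volume.restrict U] v}
  zero_mem' := ⟨0, contDiff_const, by rw [map_zero]; exact Lp.coeFn_zero _ _ _⟩
  add_mem' := by
    rintro a b ⟨v, hv, hav⟩ ⟨w, hw, hbw⟩
    refine ⟨v + w, hv.add hw, ?_⟩
    rw [map_add]
    exact (Lp.coeFn_add _ _).trans (hav.add hbw)
  smul_mem' := by
    rintro c a ⟨v, hv, hav⟩
    refine ⟨c • v, contDiff_const.smul hv, ?_⟩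
    rw [map_smul]
    exact (Lp.coeFn_smul _ _).trans (hav.const_smul c)

lemma memLp_restrict_of_continuous {F : Type*} [NormedAddCommGroup F] (hU : IsOpen U)
    (hb : Bornology.IsBounded U) {f : E N → F} (hf : Continuous f) :
    MemLp f 2 ((volume : Measure (E N)).restrict U) := by
  have : IsFiniteMeasure ((volume : Measure (E N)).restrict U) := ⟨by simpa using hb.measure_lt_top⟩
  obtain ⟨C, hC⟩ := hb.isCompact_closure.exists_bound_of_continuousOn hf.continuousOn
  refine MemLp.of_bound hf.aestronglyMeasurable C ?_
  filter_upwards [ae_restrict_mem hU.measurableSet] with x hx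
  exact hC x (subset_closure hx)

lemma H1.grad_ae_eq_gradient (hU : IsOpen U) (hb : Bornology.IsBounded U) {u : H1 U} {v : E N → ℝ}
    (hv : ContDiff ℝ 1 v) (huv : H1.fn u =ᵐ[volume.restrict U] v) :
    H1.grad u =ᵐ[volume.restrict U] gradient v :=
  HasWeakGradient.unique hU ((H1.hasWeakGradient u).congr huv Filter.EventuallyEq.rfl)
    (hasWeakGradient_of_contDiff hv) (Lp.memLp _)
    (memLp_restrict_of_continuous hU hb (continuous_gradient hv))

lemma H1.exists_of_contDiff (hU : IsOpen U) (hb : Bornology.IsBounded U) {v : E N → ℝ}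
    (hv : ContDiff ℝ 1 v) : ∃ u : H1 U, H1.fn u =ᵐ[volume.restrict U] v := by
  obtain ⟨u, hu, -⟩ := H1.exists_of_hasWeakGradient
    (memLp_restrict_of_continuous hU hb hv.continuous)
    (memLp_restrict_of_continuous hU hb (continuous_gradient hv)) (hasWeakGradient_of_contDiff hv)
  exact ⟨u, hu⟩

lemma H1.ext_fn (hU : IsOpen U) {u v : H1 U} (h : H1.fn u = H1.fn v) : u = v := by
  refine H1.ext h (Lp.ext ?_)
  refine HasWeakGradient.unique hU (H1.hasWeakGradient u) ?_ (Lp.memLp _) (Lp.memLp _)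
  rw [h]
  exact H1.hasWeakGradient v

lemma memLp_indicator_of_subset {F : Type*} [NormedAddCommGroup F] {V : Set (E N)}
    (hVU : V ⊆ U) (hV : MeasurableSet V) (f : Lp F 2 ((volume : Measure (E N)).restrict U)) :
    MemLp (V.indicator f) 2 volume :=
  (memLp_indicator_iff_restrict hV).2
    ((Lp.memLp f).mono_measure (Measure.restrict_mono_set volume hVU))

/-- Elements of `H¹(U)` supported near a point at which `U` has the cone property are limits of
smooth functions. -/
lemma mem_closure_smoothH1_of_cone (hU : IsOpen U) (hb : Bornology.IsBounded U) {p e : E N}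
    {r ρ δ : ℝ} (hr : 0 < r) (hρ : 0 < ρ) (hδ : 0 < δ)
    (cone : ∀ y ∈ U, y ∈ Metric.ball p r → ∀ t ∈ Set.Ioo 0 δ, ∀ z ∈ Metric.ball e ρ, y - t • z ∈ U)
    (q : H1 U) (hq : ∀ᵐ x ∂(volume.restrict U), x ∉ Metric.ball p (r / 2) → H1.fn q x = 0)
    (hq' : ∀ᵐ x ∂(volume.restrict U), x ∉ Metric.ball p (r / 2) → H1.grad q x = 0) :
    q ∈ closure (smoothH1 U : Set (H1 U)) := by
  set V := U ∩ Metric.ball p (r / 2) with hVdef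
  have hVm : MeasurableSet V := hU.measurableSet.inter Metric.isOpen_ball.measurableSet
  have hVU : V ⊆ U := Set.inter_subset_left
  -- The function and its gradient are extended by zero separately; `W` need not be the weak
  -- gradient of `w` across the boundary of `U`.
  set w : E N → ℝ := V.indicator (H1.fn q) with hw
  set W : E N → E N := V.indicator (H1.grad q) with hW
  have hwm : MemLp w 2 volume := memLp_indicator_of_subset hVU hVm _
  have hWm : MemLp W 2 volume := memLp_indicator_of_subset hVU hVm _
  have hws : StronglyMeasurable w := (Lp.stronglyMeasurable _).indicator hVm
  have hWs : StronglyMeasurable W := (Lp.stronglyMeasurable _).indicator hVm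
  have hwq : w =ᵐ[volume.restrict U] H1.fn q := by
    filter_upwards [hq, ae_restrict_mem hU.measurableSet] with x hx hxU
    by_cases hxb : x ∈ Metric.ball p (r / 2)
    · have hxV : x ∈ V := ⟨hxU, hxb⟩
      rw [hw, Set.indicator_of_mem hxV]
    · rw [hw, Set.indicator_of_notMem (fun h : x ∈ V => hxb h.2), hx hxb]
  have hWq : W =ᵐ[volume.restrict U] H1.grad q := by
    filter_upwards [hq', ae_restrict_mem hU.measurableSet] with x hx hxU
    by_cases hxb : x ∈ Metric.ball p (r / 2)
    · have hxV : x ∈ V := ⟨hxU, hxb⟩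
      rw [hW, Set.indicator_of_mem hxV]
    · rw [hW, Set.indicator_of_notMem (fun h : x ∈ V => hxb h.2), hx hxb]
  have hwl : LocallyIntegrable w := hwm.locallyIntegrable (by norm_num)
  have hWl : LocallyIntegrable W := hWm.locallyIntegrable (by norm_num)
  refine Metric.mem_closure_iff.2 fun ε hε => ?_
  set η : ℝ≥0∞ := ENNReal.ofReal (ε / 2) with hη
  have hη0 : 0 < η := by rw [hη]; exact ENNReal.ofReal_pos.2 (by linarith)
  obtain ⟨s₁, hs₁, h₁⟩ := exists_eLpNorm_translate_sub_le hwm hη0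
  obtain ⟨s₂, hs₂, h₂⟩ := exists_eLpNorm_translate_sub_le hWm hη0
  -- the mollifier
  obtain ⟨t, ht0, htδ, hts⟩ : ∃ t : ℝ, 0 < t ∧ t < δ ∧
      t * (‖e‖ + ρ) < min (min s₁ s₂) (r / 2) := by
    have hm : 0 < min (min s₁ s₂) (r / 2) := lt_min (lt_min hs₁ hs₂) (by linarith)
    have hc : Filter.Tendsto (fun t : ℝ => t * (‖e‖ + ρ)) (𝓝[>] 0) (𝓝 0) := by
      have : Continuous fun t : ℝ => t * (‖e‖ + ρ) := by fun_prop
      simpa using (this.tendsto 0).mono_left nhdsWithin_le_nhds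
    have h3 := (hc.eventually (gt_mem_nhds hm)).and (Ioo_mem_nhdsGT hδ)
    obtain ⟨t, ht⟩ := h3.exists
    exact ⟨t, ht.2.1, ht.2.2, ht.1⟩
  have htρ : 0 < t * ρ := mul_pos ht0 hρ
  -- The bump is centered at t e, not at 0. Its support lies in t times the ball B(e, ρ), so y minus
  -- this support lies in `U` by the cone property.
  let φ : ContDiffBump (t • e) := ⟨t * ρ / 4, t * ρ / 2, by linarith, by linarith⟩
  set k : E N → ℝ := φ.normed volume with hkdef
  have hkt : tsupport k = Metric.closedBall (t • e) (t * ρ / 2) := φ.tsupport_normed_eq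
  have hkc : HasCompactSupport k := φ.hasCompactSupport_normed
  have hkd : ContDiff ℝ ∞ k := φ.contDiff_normed
  have hk0 : ∀ x, 0 ≤ k x := φ.nonneg_normed
  have hk1 : ∫ x, k x = 1 := φ.integral_normed
  have hkcone : ∀ z ∈ tsupport k, ∃ z' ∈ Metric.ball e ρ, z = t • z' := by
    intro z hz
    rw [hkt, Metric.mem_closedBall, dist_eq_norm] at hz
    refine ⟨t⁻¹ • z, ?_, by rw [smul_smul, mul_inv_cancel₀ ht0.ne', one_smul]⟩
    rw [Metric.mem_ball, dist_eq_norm]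
    have : t⁻¹ • z - e = t⁻¹ • (z - t • e) := by
      rw [smul_sub, smul_smul, inv_mul_cancel₀ ht0.ne', one_smul]
    rw [this, norm_smul, Real.norm_eq_abs, abs_of_pos (inv_pos.2 ht0), inv_mul_lt_iff₀ ht0]
    linarith
  have hknorm : ∀ z ∈ tsupport k, ‖z‖ < min (min s₁ s₂) (r / 2) := by
    intro z hz
    obtain ⟨z', hz', rfl⟩ := hkcone z hz
    refine lt_of_le_of_lt ?_ hts
    rw [norm_smul, Real.norm_eq_abs, abs_of_pos ht0]
    rw [Metric.mem_ball, dist_eq_norm] at hz'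
    have : ‖z'‖ ≤ ‖e‖ + ‖z' - e‖ := by simpa using norm_add_le e (z' - e)
    gcongr
    linarith
  have hksupp : ∀ z, k z ≠ 0 → ‖z‖ < min (min s₁ s₂) (r / 2) := fun z hz =>
    hknorm z (subset_tsupport _ hz)
  -- the smooth approximation
  set v : E N → ℝ := w ⋆[ContinuousLinearMap.mul ℝ ℝ, volume] k with hv
  have hvk : v = k ⋆[ContinuousLinearMap.lsmul ℝ ℝ, volume] w := by
    funext y
    rw [hv, convolution_lsmul_swap, convolution_mul]
    simp only [smul_eq_mul, mul_comm]
  have hvd : ContDiff ℝ 1 v :=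
    (hkc.contDiff_convolution_right _ hwl hkd).of_le (by simp)
  have happrox1 : eLpNorm (v - w) 2 volume ≤ η := by
    rw [hvk]
    exact eLpNorm_convolution_sub_le hws hwm hkd.continuous hk0 hk1 hkc
      (fun z hz => (hksupp z hz).trans_le ((min_le_left _ _).trans (min_le_left _ _))) h₁
  have happrox2 : eLpNorm (k ⋆[ContinuousLinearMap.lsmul ℝ ℝ, volume] W - W) 2 volume ≤ η :=
    eLpNorm_convolution_sub_le hWs hWm hkd.continuous hk0 hk1 hkc
      (fun z hz => (hksupp z hz).trans_le ((min_le_left _ _).trans (min_le_right _ _))) h₂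
  -- Near p, the function x ↦ k(y - x) has its support inside `U`, so it is an admissible test
  -- function, and the definition of the weak gradient is the claimed identity. No integration
  -- across the boundary occurs.
  have hgrad : ∀ y ∈ U, gradient v y = (k ⋆[ContinuousLinearMap.lsmul ℝ ℝ, volume] W) y := by
    intro y hy
    refine ext_inner_right ℝ fun h => ?_
    have hWex : Integrable fun x => k (y - x) • W x := by
      have := (hkc.convolutionExists_left (ContinuousLinearMap.lsmul ℝ ℝ) hkd.continuous hWl y)
      exact (convolutionExistsAt_iff_integrable_swap.1 this)
    have e1 : fderiv ℝ v y h = ∫ x, w x * fderiv ℝ k (y - x) h := by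
      have h1 := (hkc.hasFDerivAt_convolution_right (ContinuousLinearMap.mul ℝ ℝ) hwl
        (hkd.of_le (by simp)) y).fderiv
      rw [hv, h1, convolution_precompR_apply _ hwl (hkc.fderiv ℝ)
        (hkd.continuous_fderiv (by simp))]
      rfl
    have e2 : inner ℝ ((k ⋆[ContinuousLinearMap.lsmul ℝ ℝ, volume] W) y) h =
        ∫ x, inner ℝ (W x) h * k (y - x) := by
      rw [convolution_lsmul_swap, real_inner_comm, ← integral_inner hWex]
      refine integral_congr_ae (Filter.Eventually.of_forall fun x => ?_)
      beta_reduce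
      rw [inner_smul_right, real_inner_comm, mul_comm]
    rw [inner_gradient, e1, e2]
    by_cases hyr : y ∈ Metric.ball p r
    · set θ : E N → ℝ := fun x => k (y - x) with hθ
      have hθd : ContDiff ℝ ∞ θ := hkd.comp (contDiff_const.sub contDiff_id)
      have hθt : tsupport θ ⊆ (fun x => y - x) ⁻¹' tsupport k :=
        closure_minimal (fun x hx => subset_tsupport _ hx)
          ((isClosed_tsupport k).preimage (by fun_prop))
      have hθc : HasCompactSupport θ := by
        refine HasCompactSupport.intro (isCompact_closedBall y (r / 2)) fun x hx => ?_
        by_contra h0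
        refine hx ?_
        rw [Metric.mem_closedBall, dist_eq_norm, norm_sub_rev]
        exact ((hksupp _ h0).trans_le (min_le_right _ _)).le
      have hθU : tsupport θ ⊆ U := by
        intro x hx
        obtain ⟨z, hz, hz2⟩ := hkcone _ (hθt hx)
        have := cone y hy hyr t ⟨ht0, htδ⟩ z hz
        rwa [← hz2, sub_sub_cancel] at this
      have hθf : ∀ x, fderiv ℝ θ x h = - fderiv ℝ k (y - x) h := by
        intro x
        have h1 : HasFDerivAt (fun x : E N => y - x) (-(ContinuousLinearMap.id ℝ (E N))) x :=
          (hasFDerivAt_id x).const_sub y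
        have h2 := ((hkd.differentiable (by simp) (y - x)).hasFDerivAt).comp x h1
        have h3 : fderiv ℝ θ x = (fderiv ℝ k (y - x)).comp (-(ContinuousLinearMap.id ℝ (E N))) :=
          h2.fderiv
        rw [h3]; simp
      have h1 := H1.hasWeakGradient q θ hθd hθc hθU h
      have e3 : ∫ x, w x * fderiv ℝ k (y - x) h = - ∫ x in U, H1.fn q x * fderiv ℝ θ x h := by
        rw [← integral_neg, ← setIntegral_eq_integral_of_forall_compl_eq_zero (s := U)]
        · refine integral_congr_ae (hwq.mono fun x hx => ?_)
          beta_reduce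
          rw [hx, hθf]; ring
        · intro x hx
          rw [hw, Set.indicator_of_notMem fun h => hx h.1, zero_mul]
      have e4 : ∫ x, inner ℝ (W x) h * k (y - x) = ∫ x in U, inner ℝ (H1.grad q x) h * θ x := by
        rw [← setIntegral_eq_integral_of_forall_compl_eq_zero (s := U)]
        · refine integral_congr_ae (hWq.mono fun x hx => ?_)
          beta_reduce
          rw [hx]
        · intro x hx
          rw [hW, Set.indicator_of_notMem fun h => hx h.1, inner_zero_left, zero_mul]
      rw [e3, e4]
      rw [h1, neg_neg]
    -- Farther than r from p both convolutions vanish, since `w` and `W` vanish outside B(p, r/2)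
    -- and the kernel reaches less than r/2.
    · have hfar : ∀ x ∈ V, y - x ∉ tsupport k := by
        intro x hx hx2
        have h1 := (hknorm _ hx2).trans_le (min_le_right _ _)
        have h2 : dist x p < r / 2 := hx.2
        refine hyr ?_
        rw [Metric.mem_ball]
        have := dist_triangle y x p
        rw [dist_eq_norm y x] at this
        linarith
      have z1 : ∀ x, w x * fderiv ℝ k (y - x) h = 0 := by
        intro x
        by_cases hx : x ∈ V
        · rw [fderiv_eq_zero_of_notMem_tsupport (hfar x hx)]; simp
        · rw [hw, Set.indicator_of_notMem hx, zero_mul]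
      have z2 : ∀ x, inner ℝ (W x) h * k (y - x) = 0 := by
        intro x
        by_cases hx : x ∈ V
        · rw [image_eq_zero_of_notMem_tsupport (hfar x hx), mul_zero]
        · rw [hW, Set.indicator_of_notMem hx, inner_zero_left, zero_mul]
      simp only [z1, z2]
  obtain ⟨u, hu⟩ := H1.exists_of_contDiff hU hb hvd
  refine ⟨u, ⟨v, hvd, hu⟩, ?_⟩
  have hug := H1.grad_ae_eq_gradient hU hb hvd hu
  have hle : ‖q - u‖ₑ ^ 2 ≤ η ^ 2 + η ^ 2 := by
    rw [← enorm_neg, neg_sub, H1.enorm_sq]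
    refine add_le_add ?_ ?_
    · refine le_trans ?_ (pow_le_pow_left₀ zero_le happrox1 2)
      rw [eLpNorm_two_sq]
      refine le_trans (le_of_eq ?_) (setLIntegral_le_lintegral U _)
      refine lintegral_congr_ae ?_
      rw [map_sub]
      filter_upwards [Lp.coeFn_sub (H1.fn u) (H1.fn q), hu, hwq] with x e1 e2 e3
      rw [e1, Pi.sub_apply, Pi.sub_apply, e2, e3]
    · refine le_trans ?_ (pow_le_pow_left₀ zero_le happrox2 2)
      rw [eLpNorm_two_sq]
      refine le_trans (le_of_eq ?_) (setLIntegral_le_lintegral U _)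
      refine lintegral_congr_ae ?_
      rw [map_sub]
      filter_upwards [Lp.coeFn_sub (H1.grad u) (H1.grad q), hug, hWq,
        ae_restrict_mem hU.measurableSet] with x e1 e2 e3 e4
      rw [e1, Pi.sub_apply, Pi.sub_apply, e2, e3, hgrad x e4]
  rw [dist_eq_norm]
  have h5 : ‖q - u‖ ^ 2 ≤ (ε / 2) ^ 2 + (ε / 2) ^ 2 := by
    have h6 : (0 : ℝ) ≤ ε / 2 := by linarith
    rw [hη, ← ofReal_norm, ← ENNReal.ofReal_pow (norm_nonneg _), ← ENNReal.ofReal_pow h6,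
      ← ENNReal.ofReal_add (by positivity) (by positivity)] at hle
    exact (ENNReal.ofReal_le_ofReal_iff (by positivity)).1 hle
  nlinarith [norm_nonneg (q - u)]

end Density

section Density

variable {N : ℕ} {U : Set (E N)}

open scoped Manifold

/-- At an interior point any small displacement works. At a boundary point, moving by -t(e + z')
lowers the height by at least t(1 - ‖z'‖) and the graph by at most Lt‖z'‖, so the point stays below
the graph when (1 + L)‖z'‖ ≤ 1. -/
lemma HasLipschitzBoundary.exists_cone (hL : HasLipschitzBoundary U) (hU : IsOpen U) {p : E N}
    (hp : p ∈ closure U) : ∃ (e : E N) (r ρ δ : ℝ), 0 < r ∧ 0 < ρ ∧ 0 < δ ∧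
      ∀ y ∈ U, y ∈ Metric.ball p r → ∀ t ∈ Set.Ioo 0 δ, ∀ z ∈ Metric.ball e ρ, y - t • z ∈ U := by
  by_cases hpU : p ∈ U
  · obtain ⟨R, hR, hRU⟩ := Metric.isOpen_iff.1 hU p hpU
    refine ⟨0, R / 2, 1, R / 2, by linarith, by norm_num, by linarith, ?_⟩
    intro y _ hy t ht z hz
    refine hRU ?_
    rw [Metric.mem_ball, dist_eq_norm] at *
    rw [sub_zero] at hz
    have h1 : y - t • z - p = (y - p) - t • z := by abel
    rw [h1]
    refine (norm_sub_le _ _).trans_lt ?_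
    rw [norm_smul, Real.norm_eq_abs, abs_of_pos ht.1]
    nlinarith [ht.1, ht.2, norm_nonneg z]
  · have hpf : p ∈ frontier U := ⟨hp, fun h => hpU (interior_subset h)⟩
    obtain ⟨e, g, L, R, h⟩ := hL.exists_isChart hpf
    have hR := h.pos
    have hL1 : (0 : ℝ) < 1 + L := by positivity
    -- Since ‖z‖ ≤ 2, a displacement with t < R/4 is shorter than R/2 and keeps points of B(p, R/2)
    -- in the chart.
    refine ⟨e, R / 2, 1 / (1 + L), R / 4, by linarith, by positivity, by linarith, ?_⟩
    intro y hyU hy t ht z hz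
    have hρ : (1 + L) * (1 / (1 + L : ℝ)) = 1 := by field_simp
    set ρ : ℝ := 1 / (1 + L)
    have hρ0 : 0 < ρ := by positivity
    have hρ1 : ρ ≤ 1 := by nlinarith [L.coe_nonneg]
    rw [Metric.mem_ball, dist_eq_norm] at hz
    set z' := z - e with hz'
    have hzz : z = e + z' := by rw [hz']; abel
    have hyR : y ∈ Metric.ball p R := Metric.ball_subset_ball (by linarith) hy
    refine h.mem_of_inner_lt ?_ ?_
    · rw [Metric.mem_ball, dist_eq_norm] at hy ⊢
      have h1 : y - t • z - p = (y - p) - t • z := by abel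
      rw [h1]
      refine (norm_sub_le _ _).trans_lt ?_
      rw [norm_smul, Real.norm_eq_abs, abs_of_pos ht.1]
      have h2 : ‖z‖ ≤ 2 := by
        rw [hzz]
        refine (norm_add_le _ _).trans ?_
        rw [h.norm_eq]; linarith
      nlinarith [ht.1, ht.2, norm_nonneg z]
    · have h1 : y - t • z = (y - t • z') + (-t) • e := by rw [hzz]; module
      rw [h1, h.inner_add, h.inv, inner_sub_right, inner_smul_right]
      have h2 : |g (y - t • z') - g y| ≤ L * (t * ‖z'‖) := by
        have := h.lip.dist_le_mul (y - t • z') y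
        rwa [Real.dist_eq, dist_eq_norm, sub_sub_cancel_left, norm_neg, norm_smul,
          Real.norm_eq_abs, abs_of_pos ht.1] at this
      have h3 : |inner ℝ e z'| ≤ ‖z'‖ := by
        simpa [h.norm_eq] using abs_real_inner_le_norm e z'
      have h4 := (h.mem_iff y hyR).1 hyU
      have h5 := (abs_le.1 h2).1
      have h6 := (abs_le.1 h3).1
      have h7 : (1 + L) * (t * ‖z'‖) ≤ (1 + L) * (t * ρ) := by
        have := ht.1
        gcongr
      have h8 : t * (-‖z'‖) ≤ t * inner ℝ e z' := mul_le_mul_of_nonneg_left h6 ht.1.le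
      rw [mul_left_comm _ t ρ, hρ, add_mul, one_mul, mul_one] at h7
      rw [mul_neg] at h8
      linarith

/-- Compact support makes ζ and its gradient bounded, so the product rule stays in L². -/
lemma H1.exists_mul_smooth (u : H1 U) {ζ : E N → ℝ} (hζ : ContDiff ℝ ∞ ζ)
    (hc : HasCompactSupport ζ) : ∃ q : H1 U,
      H1.fn q =ᵐ[volume.restrict U] (fun x => ζ x * H1.fn u x) ∧
      H1.grad q =ᵐ[volume.restrict U] (fun x => ζ x • H1.grad u x + H1.fn u x • gradient ζ x) := by
  have hgc : Continuous (gradient ζ) := continuous_gradient (hζ.of_le (by simp))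
  have hgs : HasCompactSupport (gradient ζ) :=
    (hc.fderiv ℝ).comp_left (g := (InnerProductSpace.toDual ℝ (E N)).symm) (map_zero _)
  obtain ⟨C, hC⟩ := hc.exists_bound_of_continuous hζ.continuous
  obtain ⟨C', hC'⟩ := hgs.exists_bound_of_continuous hgc
  have m1 : MemLp (fun x => ζ x * H1.fn u x) 2 (volume.restrict U) := by
    refine (Lp.memLp (H1.fn u)).of_le_mul (c := C)
      (hζ.continuous.aestronglyMeasurable.mul (Lp.aestronglyMeasurable _)) ?_
    refine Filter.Eventually.of_forall fun x => ?_
    rw [norm_mul]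
    exact mul_le_mul_of_nonneg_right (hC x) (norm_nonneg _)
  have m2 : MemLp (fun x => ζ x • H1.grad u x) 2 (volume.restrict U) := by
    refine (Lp.memLp (H1.grad u)).of_le_mul (c := C)
      (hζ.continuous.aestronglyMeasurable.smul (Lp.aestronglyMeasurable _)) ?_
    refine Filter.Eventually.of_forall fun x => ?_
    rw [norm_smul]
    exact mul_le_mul_of_nonneg_right (hC x) (norm_nonneg _)
  have m3 : MemLp (fun x => H1.fn u x • gradient ζ x) 2 (volume.restrict U) := by
    refine (Lp.memLp (H1.fn u)).of_le_mul (c := C')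
      ((Lp.aestronglyMeasurable (H1.fn u)).smul hgc.aestronglyMeasurable) ?_
    refine Filter.Eventually.of_forall fun x => ?_
    rw [norm_smul, mul_comm]
    exact mul_le_mul_of_nonneg_right (hC' x) (norm_nonneg _)
  exact H1.exists_of_hasWeakGradient m1 (m2.add m3)
    ((H1.hasWeakGradient u).mul_smooth (Lp.memLp _) (Lp.memLp _) hζ)

/-- Smooth functions are dense in `H¹(U)`. -/
theorem dense_smoothH1 (hU : IsOpen U) (hb : Bornology.IsBounded U) (hL : HasLipschitzBoundary U) :
    Dense (smoothH1 U : Set (H1 U)) := by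
  intro u
  choose! e r ρ δ hr hρ hδ cone using fun p (hp : p ∈ closure U) => hL.exists_cone hU hp
  obtain ⟨t, ht, hcover⟩ := hb.isCompact_closure.elim_nhds_subcover
    (fun p => Metric.ball p (r p / 2)) fun p hp => Metric.ball_mem_nhds p (half_pos (hr p hp))
  -- Subordination to the balls of half radius matches the support condition of
  -- `mem_closure_smoothH1_of_cone`.
  obtain ⟨f, hf⟩ := SmoothPartitionOfUnity.exists_isSubordinate 𝓘(ℝ, E N)
    (isClosed_closure (s := U)) (fun p : t => Metric.ball (p : E N) (r p / 2))
    (fun _ => Metric.isOpen_ball) (by simpa [Set.iUnion_subtype] using hcover)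
  have hfd : ∀ i, ContDiff ℝ ∞ (f i) := fun i => (f i).contMDiff.contDiff
  have hfc : ∀ i, HasCompactSupport (f i) := fun i =>
    (isCompact_closedBall (i : E N) (r i / 2)).of_isClosed_subset (isClosed_tsupport _)
      ((hf i).trans Metric.ball_subset_closedBall)
  choose q hq1 hq2 using fun i => H1.exists_mul_smooth u (hfd i) (hfc i)
  have hqc : ∀ i, q i ∈ (smoothH1 U).topologicalClosure := by
    intro i
    have hi := ht i i.2
    refine mem_closure_smoothH1_of_cone hU hb (hr i hi) (hρ i hi) (hδ i hi) (cone i hi) (q i) ?_ ?_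
    · filter_upwards [hq1 i] with x hx hxb
      rw [hx, image_eq_zero_of_notMem_tsupport fun h => hxb (hf i h), zero_mul]
    · filter_upwards [hq2 i] with x hx hxb
      have h1 : x ∉ tsupport (f i) := fun h => hxb (hf i h)
      have h2 : gradient (f i) x = 0 := by
        rw [gradient, fderiv_eq_zero_of_notMem_tsupport h1, map_zero]
      rw [hx, image_eq_zero_of_notMem_tsupport h1, h2, zero_smul, smul_zero, add_zero]
  -- The function determines its weak gradient, so comparing functions almost everywhere on `U` is
  -- enough.
  have hsum : u = ∑ i, q i := by
    refine H1.ext_fn hU (Lp.ext ?_)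
    rw [map_sum]
    have hall : ∀ᵐ x ∂(volume.restrict U), ∀ i, H1.fn (q i) x = f i x * H1.fn u x :=
      ae_all_iff.2 hq1
    filter_upwards [Lp.coeFn_finsetSum Finset.univ (fun i => H1.fn (q i)), hall,
      ae_restrict_mem hU.measurableSet] with x h1 h2 h3
    have h4 := f.sum_eq_one (subset_closure h3)
    rw [finsum_eq_sum_of_fintype] at h4
    rw [h1, Finset.sum_apply]
    simp only [h2]
    rw [← Finset.sum_mul, h4, one_mul]
  change u ∈ (smoothH1 U).topologicalClosure
  rw [hsum]
  exact Submodule.sum_mem _ fun i _ => hqc i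

end Density

/-! ### The trace operator -/

section Trace

variable {N : ℕ} {U : Set (E N)}

/-- Compactness of the boundary reduces this to finitely many charts. -/
lemma exists_lintegral_frontier_le (hU : IsOpen U) (hb : Bornology.IsBounded U)
    (hL : HasLipschitzBoundary U) : ∃ C : NNReal, ∀ v : E N → ℝ, ContDiff ℝ 1 v →
      ∫⁻ x in frontier U, ‖v x‖ₑ ^ 2 ∂(surf N) ≤
        C * ∫⁻ x in U, (‖v x‖ₑ ^ 2 + ‖fderiv ℝ v x‖ₑ ^ 2) := by
  have hc : IsCompact (frontier U) :=
    hb.isCompact_closure.of_isClosed_subset isClosed_frontier frontier_subset_closure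
  suffices h : ∃ C : NNReal, ∀ v : E N → ℝ, ContDiff ℝ 1 v →
      ∫⁻ x in frontier U ∩ frontier U, ‖v x‖ₑ ^ 2 ∂(surf N) ≤
        C * ∫⁻ x in U, (‖v x‖ₑ ^ 2 + ‖fderiv ℝ v x‖ₑ ^ 2) by
    simpa only [Set.inter_self] using h
  refine hc.induction_on (p := fun A => ∃ C : NNReal, ∀ v : E N → ℝ, ContDiff ℝ 1 v →
      ∫⁻ x in A ∩ frontier U, ‖v x‖ₑ ^ 2 ∂(surf N) ≤
        C * ∫⁻ x in U, (‖v x‖ₑ ^ 2 + ‖fderiv ℝ v x‖ₑ ^ 2)) ?_ ?_ ?_ ?_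
  · exact ⟨0, fun v _ => by simp⟩
  · rintro A B hAB ⟨C, hC⟩
    exact ⟨C, fun v hv => (lintegral_mono_set (Set.inter_subset_inter_left _ hAB)).trans (hC v hv)⟩
  · rintro A B ⟨C, hC⟩ ⟨C', hC'⟩
    refine ⟨C + C', fun v hv => ?_⟩
    rw [Set.union_inter_distrib_right]
    refine (lintegral_union_le _ _ _).trans ?_
    rw [ENNReal.coe_add, add_mul]
    exact add_le_add (hC v hv) (hC' v hv)
  · intro p hp
    obtain ⟨e, g, L, R, h⟩ := hL.exists_isChart hp
    exact ⟨Metric.ball p (R / 2), mem_nhdsWithin_of_mem_nhds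
      (Metric.ball_mem_nhds p (half_pos h.pos)), h.lintegral_surf_le hU⟩

lemma H1.enorm_sq_of_contDiff (hU : IsOpen U) (hb : Bornology.IsBounded U) {u : H1 U}
    {v : E N → ℝ} (hv : ContDiff ℝ 1 v) (huv : H1.fn u =ᵐ[volume.restrict U] v) :
    ∫⁻ x in U, (‖v x‖ₑ ^ 2 + ‖fderiv ℝ v x‖ₑ ^ 2) = ‖u‖ₑ ^ 2 := by
  rw [H1.enorm_sq, ← lintegral_add_left' ((Lp.aestronglyMeasurable _).enorm.pow_const 2)]
  refine lintegral_congr_ae ?_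
  filter_upwards [huv, H1.grad_ae_eq_gradient hU hb hv huv] with x h1 h2
  rw [h1, h2, enorm_gradient]

/-- Existence and uniqueness of the Sobolev trace operator. -/
theorem existsUnique_isTraceOperator (hU : IsOpen U) (hb : Bornology.IsBounded U)
    (hL : HasLipschitzBoundary U) : ∃! T, IsTraceOperator U T := by
  obtain ⟨C, hC⟩ := exists_lintegral_frontier_le hU hb hL
  have hdense := dense_smoothH1 hU hb hL
  have hbd : ∀ (u : H1 U) (v : E N → ℝ), ContDiff ℝ 1 v → H1.fn u =ᵐ[volume.restrict U] v →
      ∫⁻ x in frontier U, ‖v x‖ₑ ^ 2 ∂(surf N) ≤ C * ‖u‖ₑ ^ 2 := by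
    intro u v hv huv
    rw [← H1.enorm_sq_of_contDiff hU hb hv huv]
    exact hC v hv
  choose v hv huv using fun s : smoothH1 U => s.2
  have hmem : ∀ s, MemLp (v s) 2 ((surf N).restrict (frontier U)) := by
    intro s
    refine memLp_two_of_lintegral_lt_top (hv s).continuous.aestronglyMeasurable ?_
    refine (hbd s (v s) (hv s) (huv s)).trans_lt ?_
    exact ENNReal.mul_lt_top (by simp) (ENNReal.pow_lt_top (by simp))
  -- Two C¹ functions equal almost everywhere on `U` have the same boundary values: apply the bound
  -- to their difference, which represents 0 in H¹. Hence the chosen representatives `v s` give a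
  -- linear map.
  have hae : ∀ (s : smoothH1 U) (w : E N → ℝ), ContDiff ℝ 1 w →
      H1.fn (s : H1 U) =ᵐ[volume.restrict U] w → v s =ᵐ[(surf N).restrict (frontier U)] w := by
    intro s w hw hsw
    have h1 := hbd 0 (v s - w) ((hv s).sub hw) (by
      rw [map_zero]
      filter_upwards [Lp.coeFn_zero ℝ 2 (volume.restrict U), huv s, hsw] with x e1 e2 e3
      rw [e1, Pi.sub_apply, ← e2, e3, sub_self]; rfl)
    have h0 : ‖(0 : H1 U)‖ₑ = 0 := by simp [enorm_eq_nnnorm]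
    rw [h0, zero_pow two_ne_zero, mul_zero, nonpos_iff_eq_zero] at h1
    have hm : Measurable fun x => ‖(v s - w) x‖ₑ ^ 2 :=
      ((hv s).sub hw).continuous.enorm.measurable.pow_const 2
    have h2 := (lintegral_eq_zero_iff hm).1 h1
    filter_upwards [h2] with x hx
    simpa [sub_eq_zero] using hx
  let T₀ : smoothH1 U →ₗ[ℝ] L2Surf (frontier U) :=
    { toFun := fun s => (hmem s).toLp (v s)
      map_add' := fun a b => by
        rw [← MemLp.toLp_add]
        refine MemLp.toLp_congr _ _ ?_
        refine hae (a + b) (v a + v b) ((hv a).add (hv b)) ?_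
        rw [Submodule.coe_add, map_add]
        exact (Lp.coeFn_add _ _).trans ((huv a).add (huv b))
      map_smul' := fun c a => by
        rw [RingHom.id_apply, ← MemLp.toLp_const_smul]
        refine MemLp.toLp_congr _ _ ?_
        refine hae (c • a) (c • v a) (contDiff_const.smul (hv a)) ?_
        rw [Submodule.coe_smul, map_smul]
        exact (Lp.coeFn_smul _ _).trans ((huv a).const_smul c) }
  have hT₀ : ∀ s, ‖T₀ s‖ ≤ (NNReal.sqrt C : ℝ) * ‖s‖ := by
    intro s
    have h1 : ‖T₀ s‖ₑ ^ 2 ≤ C * ‖(s : H1 U)‖ₑ ^ 2 := by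
      refine le_trans (le_of_eq ?_) (hbd s (v s) (hv s) (huv s))
      rw [enorm_sq_Lp]
      refine lintegral_congr_ae ?_
      filter_upwards [(hmem s).coeFn_toLp] with x hx
      simp only [T₀, LinearMap.coe_mk, AddHom.coe_mk, hx]
    have h2 : ‖T₀ s‖ₑ ≤ (NNReal.sqrt C : ℝ≥0∞) * ‖(s : H1 U)‖ₑ := by
      rw [← ENNReal.pow_le_pow_left_iff (n := 2) two_ne_zero, mul_pow]
      rwa [← ENNReal.coe_pow, NNReal.sq_sqrt]
    rw [enorm_eq_nnnorm, enorm_eq_nnnorm, ← ENNReal.coe_mul, ENNReal.coe_le_coe] at h2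
    exact NNReal.coe_le_coe.2 h2
  let T₁ : smoothH1 U →L[ℝ] L2Surf (frontier U) := T₀.mkContinuous _ hT₀
  have hdr : DenseRange (smoothH1 U).subtypeL := by
    rw [DenseRange]
    convert hdense using 1
    exact Subtype.range_coe
  let T : H1 U →L[ℝ] L2Surf (frontier U) := T₁.extend (smoothH1 U).subtypeL
  have hTs : ∀ s : smoothH1 U, T s = T₁ s := fun s =>
    T₁.extend_eq hdr (isUniformInducing_val _) s
  refine ⟨T, ?_, ?_⟩
  · intro w hw u huw
    have h1 := hTs ⟨u, w, hw, huw⟩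
    change T u = _ at h1
    rw [h1]
    exact (hmem _).coeFn_toLp.trans (hae _ w hw huw)
  · intro T' hT'
    refine ContinuousLinearMap.coeFn_injective (Continuous.ext_on hdense T'.continuous T.continuous ?_)
    intro u hu
    have h1 := hTs ⟨u, hu⟩
    change T u = _ at h1
    rw [h1]
    refine Lp.ext ((hT' _ (hv ⟨u, hu⟩) u (huv ⟨u, hu⟩)).trans ?_)
    exact (hmem _).coeFn_toLp.symm

lemma isTraceOperator_trace (hU : IsOpen U) (hb : Bornology.IsBounded U)
    (hL : HasLipschitzBoundary U) : IsTraceOperator U (trace U) := by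
  have h : ∃ T, IsTraceOperator U T := (existsUnique_isTraceOperator hU hb hL).exists
  rw [trace, dif_pos h]
  exact h.choose_spec

end Trace

/-! ### Common boundaries of nested Lipschitz domains -/

section Boundary

variable {N : ℕ} {U Ω : Set (E N)}

lemma mem_relInterior {A B : Set (E N)} {x : E N} :
    x ∈ relInterior A B ↔ x ∈ A ∧ ∃ O ∈ 𝓝 x, O ∩ A ⊆ B := by
  constructor
  · rintro ⟨y, hy, rfl⟩
    obtain ⟨O, hO, h⟩ := mem_nhds_induced Subtype.val y _ |>.1 (mem_interior_iff_mem_nhds.1 hy)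
    exact ⟨y.2, O, hO, fun z hz => h (a := ⟨z, hz.2⟩) hz.1⟩
  · rintro ⟨hx, O, hO, h⟩
    refine ⟨⟨x, hx⟩, mem_interior_iff_mem_nhds.2 ?_, rfl⟩
    exact (mem_nhds_induced Subtype.val _ _).2 ⟨O, hO, fun z hz => h ⟨hz, z.2⟩⟩

lemma measurableSet_relInterior {A B : Set (E N)} (hA : MeasurableSet A) :
    MeasurableSet (relInterior A B) :=
  hA.subtype_image isOpen_interior.measurableSet

/-- The points of a small cylinder above the graph form a connected set. -/
lemma IsChart.exists_isPreconnected_above {p e : E N} {g : E N → ℝ} {L : NNReal} {R : ℝ}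
    (h : IsChart U p e g L R) (hp : p ∈ frontier U) :
    ∃ a : ℝ, 0 < a ∧ a ≤ R ∧ ∃ X : Set (E N), IsPreconnected X ∧
      (∀ y ∈ X, y ∈ Metric.ball p R ∧ g y < inner ℝ e y) ∧
      ∀ y ∈ Metric.ball p a, g y < inner ℝ e y → y ∈ X := by
  have hR := h.pos
  have hgp : inner ℝ e p = g p := (h.mem_frontier_iff (Metric.mem_ball_self hR)).1 hp
  have hL2 : (0 : ℝ) < L + 2 := by positivity
  -- With b = (L + 1)a, a horizontal offset below a and a height below b in absolute value add up to
  -- less than (L + 2)a = R.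
  set a : ℝ := R / (L + 2) with ha
  have ha0 : 0 < a := div_pos hR hL2
  have haR : (L + 2) * a = R := by rw [ha]; field_simp
  set b : ℝ := (L + 1) * a with hb
  have hgc := h.lip.continuous
  -- The parameter s interpolates the height between the graph (s = 0) and the flat level b (s = 1),
  -- so the region is a continuous image of a connected product.
  let f : Hyp e × ℝ → E N := fun q =>
    p + (q.1 : E N) + ((1 - q.2) * (g (p + (q.1 : E N)) - g p) + q.2 * b) • e
  have hf : Continuous f := by simp only [f]; fun_prop
  have hgL : ∀ w : E N, ‖w‖ < a → |g (p + w) - g p| ≤ L * ‖w‖ := by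
    intro w _
    have := h.lip.dist_le_mul (p + w) p
    rwa [Real.dist_eq, dist_eq_norm, add_sub_cancel_left] at this
  refine ⟨a, ha0, by nlinarith [L.coe_nonneg], f '' (Metric.ball 0 a ×ˢ Set.Ioo 0 1), ?_, ?_, ?_⟩
  · exact (((convex_ball _ _).isPreconnected).prod isPreconnected_Ioo).image _ hf.continuousOn
  · rintro _ ⟨⟨w, s⟩, ⟨hw, hs⟩, rfl⟩
    have hw' : ‖(w : E N)‖ < a := by simpa using hw
    have h1 := hgL w hw'
    have h2 : (L : ℝ) * ‖(w : E N)‖ ≤ L * a := by gcongr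
    have hs0 : 0 < s := hs.1
    have hs1 : s < 1 := hs.2
    set γ := g (p + (w : E N)) - g p with hγ
    have hγb := abs_le.1 (h1.trans h2)
    have hτ : |(1 - s) * γ + s * b| < b := by
      rw [abs_lt, hb]
      constructor <;> nlinarith
    constructor
    · rw [Metric.mem_ball, dist_eq_norm]
      have h3 : f (w, s) - p = (w : E N) + ((1 - s) * γ + s * b) • e := by
        simp only [f, ← hγ]; abel
      rw [h3]
      refine (norm_add_le _ _).trans_lt ?_
      rw [norm_smul, h.norm_eq, mul_one, Real.norm_eq_abs]
      linarith
    · simp only [f]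
      rw [h.inv, h.inner_add, inner_add_right, inner_hyp, hgp, ← hγ]
      have : γ < (1 - s) * γ + s * b := by nlinarith
      have h4 : g (p + (w : E N)) = γ + g p := by rw [hγ]; ring
      rw [h4]
      linarith
  · intro y hy hgy
    rw [Metric.mem_ball, dist_eq_norm] at hy
    set w : Hyp e := hypProj e (y - p) with hw
    set τ : ℝ := inner ℝ e (y - p) with hτ
    have hyw : y = p + (w : E N) + τ • e := by
      rw [add_assoc, hypProj_add h.norm_eq]; abel
    have hwn : ‖w‖ < a := lt_of_le_of_lt (Submodule.norm_orthogonalProjectionOnto_apply_le _ _) hy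
    have hwn' : ‖(w : E N)‖ < a := hwn
    have hτa : |τ| ≤ ‖y - p‖ := by
      simpa [h.norm_eq] using abs_real_inner_le_norm e (y - p)
    have h1 := hgL w hwn'
    have h2 : (L : ℝ) * ‖(w : E N)‖ ≤ L * a := by gcongr
    set γ := g (p + (w : E N)) - g p with hγ
    have hγb := abs_le.1 (h1.trans h2)
    have hγτ : γ < τ := by
      rw [hyw, h.inv, h.inner_add, inner_add_right, inner_hyp, hgp] at hgy
      linarith
    have hτb : τ < b := by
      have := (abs_le.1 hτa).2
      have h5 : (0 : ℝ) ≤ L * a := by positivity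
      rw [hb]; linarith
    have hγb' : 0 < b - γ := by linarith
    refine ⟨(w, (τ - γ) / (b - γ)), ⟨by simpa using hwn, ?_, ?_⟩, ?_⟩
    · exact div_pos (by linarith) hγb'
    · rw [div_lt_one hγb']; linarith
    · have h6 : (1 - (τ - γ) / (b - γ)) * γ + (τ - γ) / (b - γ) * b = τ := by
        field_simp; ring
      simp only [f, ← hγ]
      rw [h6, ← hyw]

/-- Near an interior point of the common boundary, the boundary of the subdomain consists of such
points. -/
lemma exists_ball_inter_frontier_subset (hΩ : IsOpen Ω) (hUΩ : U ⊆ Ω)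
    (hLU : HasLipschitzBoundary U) (hLΩ : HasLipschitzBoundary Ω) {p : E N}
    (hp : p ∈ relInterior (frontier Ω) (frontier U ∩ frontier Ω)) :
    ∃ ρ : ℝ, 0 < ρ ∧
      Metric.ball p ρ ∩ frontier U ⊆ relInterior (frontier Ω) (frontier U ∩ frontier Ω) := by
  obtain ⟨hpΩ, O, hO, hOsub⟩ := mem_relInterior.1 hp
  have hpU : p ∈ frontier U := (hOsub ⟨mem_of_mem_nhds hO, hpΩ⟩).1
  obtain ⟨e, g, L, R₀, h₀⟩ := hLU.exists_isChart hpU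
  obtain ⟨R₁, hR₁, hRO⟩ := Metric.mem_nhds_iff.1 hO
  have h := h₀.mono (lt_min h₀.pos hR₁) (min_le_left R₀ R₁)
  set R := min R₀ R₁
  have hRO' : Metric.ball p R ⊆ O := (Metric.ball_subset_ball (min_le_right _ _)).trans hRO
  obtain ⟨a, ha, haR, X, hX, hX1, hX2⟩ := h.exists_isPreconnected_above hpU
  -- The region above the graph avoids the closure of `U`, and near p every boundary point of Ω is a
  -- boundary point of `U`.
  have hXU : ∀ y ∈ X, y ∉ frontier Ω := by
    intro y hy hyΩ
    have h1 := hX1 y hy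
    exact h.not_mem_closure h1.1 h1.2 (frontier_subset_closure (hOsub ⟨hRO' h1.1, hyΩ⟩).1)
  have hclU : closure U ⊆ closure Ω := closure_mono hUΩ
  have hfΩ : frontier Ω = closure Ω \ Ω := hΩ.frontier_eq
  -- a point of the exterior of `Ω`
  have hne : (X ∩ (closure Ω)ᶜ).Nonempty := by
    obtain ⟨e', g', L', R', h'⟩ := hLΩ.exists_isChart hpΩ
    have hm : 0 < min a R' := lt_min ha h'.pos
    set t := min a R' / 2 with ht
    have ht0 : 0 < t := half_pos hm
    have hyb : p + t • e' ∈ Metric.ball p (min a R') := by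
      rw [Metric.mem_ball, dist_eq_norm, add_sub_cancel_left, norm_smul, h'.norm_eq, mul_one,
        Real.norm_eq_abs, abs_of_pos ht0]
      linarith
    have hyΩ : p + t • e' ∉ closure Ω := by
      refine h'.not_mem_closure (Metric.ball_subset_ball (min_le_right _ _) hyb) ?_
      rw [h'.inv, h'.inner_add, (h'.mem_frontier_iff (Metric.mem_ball_self h'.pos)).1 hpΩ]
      linarith
    have hya : p + t • e' ∈ Metric.ball p a := Metric.ball_subset_ball (min_le_left _ _) hyb
    have hyR : p + t • e' ∈ Metric.ball p R := Metric.ball_subset_ball haR hya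
    refine ⟨p + t • e', hX2 _ hya ?_, hyΩ⟩
    rcases lt_trichotomy (inner ℝ e (p + t • e')) (g (p + t • e')) with h1 | h1 | h1
    · exact absurd (subset_closure (hUΩ (h.mem_of_inner_lt hyR h1))) hyΩ
    · exact absurd (hclU (frontier_subset_closure ((h.mem_frontier_iff hyR).2 h1))) hyΩ
    · exact h1
  -- A connected set that misses the boundary of Ω and contains one exterior point is entirely
  -- exterior.
  have hXΩ : X ⊆ (closure Ω)ᶜ := by
    refine hX.subset_left_of_subset_union isClosed_closure.isOpen_compl hΩ ?_ ?_ hne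
    · exact Set.disjoint_left.2 fun y hy hyΩ => hy (subset_closure hyΩ)
    · intro y hy
      by_cases hyΩ : y ∈ Ω
      · exact Or.inr hyΩ
      · refine Or.inl fun hc => hXU y hy ?_
        rw [hfΩ]; exact ⟨hc, hyΩ⟩
  refine ⟨a, ha, ?_⟩
  rintro q ⟨hqa, hqU⟩
  have hqR : q ∈ Metric.ball p R := Metric.ball_subset_ball haR hqa
  -- Otherwise points slightly above q would lie both in Ω and in the exterior region.
  have hqΩ : q ∉ Ω := by
    intro hq
    have hlim : Filter.Tendsto (fun t : ℝ => q + t • e) (𝓝[>] 0) (𝓝 q) := by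
      have : Continuous fun t : ℝ => q + t • e := by fun_prop
      simpa using (this.tendsto 0).mono_left nhdsWithin_le_nhds
    obtain ⟨t, ⟨ht1, ht2⟩, ht3⟩ := ((hlim.eventually (hΩ.mem_nhds hq)).and
      (hlim.eventually (Metric.isOpen_ball.mem_nhds hqa))).and self_mem_nhdsWithin |>.exists
    have ht0 : 0 < t := ht3
    refine hXΩ (hX2 _ ht2 ?_) (subset_closure ht1)
    rw [h.inv, h.inner_add, (h.mem_frontier_iff hqR).1 hqU]
    linarith
  refine mem_relInterior.2 ⟨?_, O, Filter.mem_of_superset (Metric.isOpen_ball.mem_nhds hqR) hRO',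
    hOsub⟩
  rw [hfΩ]
  exact ⟨hclU (frontier_subset_closure hqU), hqΩ⟩

end Boundary

/-! ### The Poincaré inequality -/

section Poincare

variable {N : ℕ} {U Γ : Set (E N)}

lemma continuous_lintegral_fn {A : Set (E N)} (hA : A ⊆ U) :
    Continuous fun u : H1 U => ∫⁻ x in A, ‖H1.fn u x‖ₑ ^ 2 :=
  (continuous_setLIntegral_enorm_sq hA).comp (H1.fn (U := U)).continuous

lemma continuous_lintegral_grad :
    Continuous fun u : H1 U => ∫⁻ x in U, ‖H1.grad u x‖ₑ ^ 2 :=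
  (continuous_setLIntegral_enorm_sq (le_refl U)).comp (H1.grad (U := U)).continuous

/-- Holds for C¹ functions and is a closed condition on H¹. -/
lemma H1.lintegral_translate_le (hU : IsOpen U) (hb : Bornology.IsBounded U)
    (hL : HasLipschitzBoundary U) {A : Set (E N)} (hA : MeasurableSet A) {h : E N}
    (hAU : ∀ y ∈ A, ∀ t ∈ Set.Icc (0 : ℝ) 1, y + t • h ∈ U) (u : H1 U) :
    ∫⁻ x in {x | x - h ∈ A}, ‖H1.fn u x‖ₑ ^ 2 ≤ 2 * (∫⁻ x in A, ‖H1.fn u x‖ₑ ^ 2) +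
      2 * ‖h‖ₑ ^ 2 * ∫⁻ x in U, ‖H1.grad u x‖ₑ ^ 2 := by
  have h1 : A ⊆ U := fun y hy => by simpa using hAU y hy 0 (by simp)
  have h2 : {x | x - h ∈ A} ⊆ U := fun y hy => by simpa using hAU (y - h) hy 1 (by simp)
  refine (dense_smoothH1 hU hb hL).induction (P := fun u => ∫⁻ x in {x | x - h ∈ A},
    ‖H1.fn u x‖ₑ ^ 2 ≤ 2 * (∫⁻ x in A, ‖H1.fn u x‖ₑ ^ 2) +
      2 * ‖h‖ₑ ^ 2 * ∫⁻ x in U, ‖H1.grad u x‖ₑ ^ 2) ?_ ?_ u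
  · rintro u ⟨v, hv, huv⟩
    have h3 := DomainDecomposition.lintegral_translate_le hU hA hAU hv
    have e1 : ∀ B ⊆ U, ∫⁻ x in B, ‖H1.fn u x‖ₑ ^ 2 = ∫⁻ x in B, ‖v x‖ₑ ^ 2 := by
      intro B hB
      refine lintegral_congr_ae ?_
      filter_upwards [ae_mono (Measure.restrict_mono_set volume hB) huv] with x hx
      rw [hx]
    have e2 : ∫⁻ x in U, ‖H1.grad u x‖ₑ ^ 2 = ∫⁻ x in U, ‖fderiv ℝ v x‖ₑ ^ 2 := by
      refine lintegral_congr_ae ?_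
      filter_upwards [H1.grad_ae_eq_gradient hU hb hv huv] with x hx
      rw [hx, enorm_gradient]
    rw [e1 _ h1, e1 _ h2, e2]
    exact h3
  · exact isClosed_le (continuous_lintegral_fn h2)
      (((ENNReal.continuous_const_mul (by simp)).comp (continuous_lintegral_fn h1)).add
      ((ENNReal.continuous_const_mul (by simp [ENNReal.mul_eq_top])).comp continuous_lintegral_grad))

/-- Density again; on C¹ functions the trace is the restriction. -/
lemma IsChart.lintegral_ball_le_trace (hU : IsOpen U) (hb : Bornology.IsBounded U)
    (hL : HasLipschitzBoundary U) {p e : E N} {g : E N → ℝ} {L : NNReal} {R : ℝ}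
    (h : IsChart U p e g L R) (hp : p ∈ frontier U) :
    ∃ ρ : ℝ, 0 < ρ ∧ ∃ C : NNReal, ∀ u : H1 U,
      ∫⁻ x in Metric.ball p ρ ∩ U, ‖H1.fn u x‖ₑ ^ 2 ≤
        C * ((∫⁻ x in Metric.ball p (R / 2) ∩ frontier U, ‖trace U u x‖ₑ ^ 2 ∂(surf N)) +
          ∫⁻ x in U, ‖H1.grad u x‖ₑ ^ 2) := by
  obtain ⟨ρ, hρ, C, hC⟩ := h.lintegral_ball_le hU hp
  refine ⟨ρ, hρ, C, fun u => ?_⟩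
  refine (dense_smoothH1 hU hb hL).induction (P := fun u =>
      ∫⁻ x in Metric.ball p ρ ∩ U, ‖H1.fn u x‖ₑ ^ 2 ≤
        C * ((∫⁻ x in Metric.ball p (R / 2) ∩ frontier U, ‖trace U u x‖ₑ ^ 2 ∂(surf N)) +
          ∫⁻ x in U, ‖H1.grad u x‖ₑ ^ 2)) ?_ ?_ u
  · rintro u ⟨v, hv, huv⟩
    have e1 : ∫⁻ x in Metric.ball p ρ ∩ U, ‖H1.fn u x‖ₑ ^ 2 =
        ∫⁻ x in Metric.ball p ρ ∩ U, ‖v x‖ₑ ^ 2 := by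
      refine lintegral_congr_ae ?_
      filter_upwards [ae_mono (Measure.restrict_mono_set volume Set.inter_subset_right) huv]
        with x hx
      rw [hx]
    have e2 : ∫⁻ x in U, ‖H1.grad u x‖ₑ ^ 2 = ∫⁻ x in U, ‖fderiv ℝ v x‖ₑ ^ 2 := by
      refine lintegral_congr_ae ?_
      filter_upwards [H1.grad_ae_eq_gradient hU hb hv huv] with x hx
      rw [hx, enorm_gradient]
    have e3 : ∫⁻ x in Metric.ball p (R / 2) ∩ frontier U, ‖trace U u x‖ₑ ^ 2 ∂(surf N) =
        ∫⁻ x in Metric.ball p (R / 2) ∩ frontier U, ‖v x‖ₑ ^ 2 ∂(surf N) := by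
      refine lintegral_congr_ae ?_
      filter_upwards [ae_mono (Measure.restrict_mono_set (surf N) Set.inter_subset_right)
        (isTraceOperator_trace hU hb hL v hv u huv)] with x hx
      rw [hx]
    rw [e1, e2, e3]
    exact hC v hv
  · exact isClosed_le (continuous_lintegral_fn Set.inter_subset_right)
      ((ENNReal.continuous_const_mul (by simp)).comp
      (((continuous_setLIntegral_enorm_sq Set.inter_subset_right).comp
        (trace U).continuous).add continuous_lintegral_grad))

/-- The Poincaré inequality for functions whose trace vanishes on a relatively open part of the
boundary that touches all the connected components. -/
theorem exists_poincare (hU : IsOpen U) (hb : Bornology.IsBounded U)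
    (hL : HasLipschitzBoundary U)
    (hΓ : ∀ p ∈ Γ, p ∈ frontier U ∧ ∃ ρ : ℝ, 0 < ρ ∧ Metric.ball p ρ ∩ frontier U ⊆ Γ)
    (hcomp : ∀ x ∈ U, (closure (connectedComponentIn U x) ∩ Γ).Nonempty) :
    ∃ C : NNReal, ∀ u ∈ traceZero U Γ,
      ∫⁻ x in U, ‖H1.fn u x‖ₑ ^ 2 ≤ C * ∫⁻ x in U, ‖H1.grad u x‖ₑ ^ 2 := by
  -- Good sets are those on which the Poincaré inequality holds with the gradient taken over all of
  -- `U`, uniformly over the subspace. The proof spreads goodness from Γ to the closure of `U`.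
  let good : Set (E N) → Prop := fun A => ∃ C : NNReal, ∀ u ∈ traceZero U Γ,
    ∫⁻ x in A ∩ U, ‖H1.fn u x‖ₑ ^ 2 ≤ C * ∫⁻ x in U, ‖H1.grad u x‖ₑ ^ 2
  have good_mono : ∀ A B, A ⊆ B → good B → good A := by
    rintro A B hAB ⟨C, hC⟩
    exact ⟨C, fun u hu => (lintegral_mono_set (Set.inter_subset_inter_left _ hAB)).trans (hC u hu)⟩
  have good_translate : ∀ (A : Set (E N)) (h : E N), MeasurableSet A →
      (∀ y ∈ A, ∀ t ∈ Set.Icc (0 : ℝ) 1, y + t • h ∈ U) → good A → good {x | x - h ∈ A} := by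
    rintro A h hA hAU ⟨C, hC⟩
    have h1 : A ⊆ U := fun y hy => by simpa using hAU y hy 0 (by simp)
    refine ⟨2 * C + 2 * ‖h‖₊ ^ 2, fun u hu => ?_⟩
    refine (lintegral_mono_set Set.inter_subset_left).trans ?_
    refine (H1.lintegral_translate_le hU hb hL hA hAU u).trans ?_
    have h2 := hC u hu
    rw [Set.inter_eq_left.2 h1] at h2
    calc _ ≤ 2 * (C * ∫⁻ x in U, ‖H1.grad u x‖ₑ ^ 2) +
          2 * ‖h‖ₑ ^ 2 * ∫⁻ x in U, ‖H1.grad u x‖ₑ ^ 2 := by gcongr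
      _ = _ := by rw [enorm_eq_nnnorm]; push_cast; ring
  -- points near `Γ`
  have good_Γ : ∀ p ∈ Γ, ∃ ρ : ℝ, 0 < ρ ∧ good (Metric.ball p ρ) := by
    intro p hp
    obtain ⟨hpU, ρ₀, hρ₀, hsub⟩ := hΓ p hp
    obtain ⟨e, g, L, R, h⟩ := hL.exists_isChart hpU
    -- The chart is shrunk until its boundary part lies in Γ, so that the trace term vanishes.
    have h' := h.mono (lt_min h.pos hρ₀) (min_le_left R ρ₀)
    obtain ⟨ρ, hρ, C, hC⟩ := h'.lintegral_ball_le_trace hU hb hL hpU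
    refine ⟨ρ, hρ, C, fun u hu => ?_⟩
    refine (hC u).trans (le_of_eq ?_)
    have hm : 0 < min R ρ₀ := h'.pos
    have hBsub : Metric.ball p (min R ρ₀ / 2) ∩ frontier U ⊆ Γ := by
      refine (Set.inter_subset_inter_left _ (Metric.ball_subset_ball ?_)).trans hsub
      linarith [min_le_right R ρ₀]
    have hz : ∫⁻ x in Metric.ball p (min R ρ₀ / 2) ∩ frontier U, ‖trace U u x‖ₑ ^ 2 ∂(surf N)
        = 0 := by
      rw [← lintegral_zero]
      refine lintegral_congr_ae ?_
      have hu' : ∀ᵐ x ∂((surf N).restrict (frontier U)), x ∈ Γ → trace U u x = 0 := hu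
      filter_upwards [ae_mono (Measure.restrict_mono_set (surf N) Set.inter_subset_right) hu',
        ae_restrict_mem (Metric.isOpen_ball.measurableSet.inter isClosed_frontier.measurableSet)]
        with x hx hxB
      rw [hx (hBsub hxB)]
      simp
    rw [hz, zero_add]
  -- the set of good points
  set W : Set (E N) := {x | ∃ ρ : ℝ, 0 < ρ ∧ good (Metric.ball x ρ)} with hW
  have hWo : IsOpen W := by
    refine Metric.isOpen_iff.2 ?_
    rintro x ⟨ρ, hρ, hx⟩
    refine ⟨ρ / 2, half_pos hρ, fun y hy => ⟨ρ / 2, half_pos hρ, good_mono _ _ ?_ hx⟩⟩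
    refine Metric.ball_subset_ball' ?_
    rw [Metric.mem_ball] at hy
    linarith
  -- Each component meets `W`, because its closure touches Γ and `W` is an open set containing Γ. It
  -- is then enough that `W` is relatively closed in the component.
  have hint : ∀ x ∈ U, x ∈ W := by
    intro x hx
    have hsub : connectedComponentIn U x ⊆ W := by
      refine isPreconnected_connectedComponentIn.subset_of_closure_inter_subset hWo ?_ ?_
      · obtain ⟨p, hp, hpΓ⟩ := hcomp x hx
        obtain ⟨y, hy1, hy2⟩ := mem_closure_iff.1 hp W hWo (good_Γ p hpΓ)
        exact ⟨y, hy2, hy1⟩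
      · rintro z ⟨hzW, hzc⟩
        -- A good ball around a nearby y is translated by z - y onto a ball around z; the sweep
        -- stays in a ball inside `U`.
        have hzU := connectedComponentIn_subset U x hzc
        obtain ⟨r, hr, hrU⟩ := Metric.isOpen_iff.1 hU z hzU
        obtain ⟨y, hyW, hyz⟩ := Metric.mem_closure_iff.1 hzW (r / 2) (half_pos hr)
        obtain ⟨ρ, hρ, hy⟩ := hyW
        have hm : 0 < min ρ (r / 2) := lt_min hρ (half_pos hr)
        have hy' := good_mono (Metric.ball y (min ρ (r / 2))) _
          (Metric.ball_subset_ball (min_le_left _ _)) hy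
        refine ⟨min ρ (r / 2), hm, good_mono _ _ ?_
          (good_translate _ (z - y) Metric.isOpen_ball.measurableSet ?_ hy')⟩
        · intro x' hx'
          change x' - (z - y) ∈ Metric.ball y _
          rw [Metric.mem_ball, dist_eq_norm] at hx' ⊢
          have : x' - (z - y) - y = x' - z := by abel
          rwa [this]
        · intro y' hy' t ht
          refine hrU ?_
          rw [Metric.mem_ball, dist_eq_norm] at hy' ⊢
          rw [dist_eq_norm] at hyz
          have e1 : y' + t • (z - y) - z = (y' - y) - (1 - t) • (z - y) := by module
          rw [e1]
          refine (norm_sub_le _ _).trans_lt ?_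
          rw [norm_smul, Real.norm_eq_abs, abs_of_nonneg (by linarith [ht.2])]
          have := min_le_right ρ (r / 2)
          nlinarith [norm_nonneg (z - y), ht.1, ht.2]
    exact hsub (mem_connectedComponentIn hx)
  have hbd : ∀ x ∈ frontier U, x ∈ W := by
    intro x hx
    obtain ⟨e, g, L, R, h⟩ := hL.exists_isChart hx
    have hR := h.pos
    set t₀ := R / 2 with ht₀
    have hmem : ∀ y ∈ Metric.ball x (R / 2), inner ℝ e y ≤ g y → ∀ t, 0 < t → t ≤ R / 2 →
        y + (-t) • e ∈ U := by
      intro y hy hyg t ht0 ht1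
      refine h.mem_of_inner_lt (h.sub_mem_ball hy ?_) ?_
      · rw [abs_neg, abs_of_pos ht0]; linarith
      · rw [h.inner_add, h.inv]; linarith
    have hxg := (h.mem_frontier_iff (Metric.mem_ball_self hR)).1 hx
    obtain ⟨ρ, hρ, hgood⟩ := hint _ (hmem x (Metric.mem_ball_self (half_pos hR)) hxg.le t₀
      (half_pos hR) le_rfl)
    have hm : 0 < min ρ (R / 2) := lt_min hρ (half_pos hR)
    -- `A` is the part of `U` near x pushed inward by t₀. It lies in a good interior ball, and
    -- translating it back along e stays in `U`.
    set A : Set (E N) := {y | y + t₀ • e ∈ Metric.ball x (min ρ (R / 2)) ∩ U} with hA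
    have hAm : MeasurableSet A :=
      (measurable_id.add_const (t₀ • e)) (Metric.isOpen_ball.measurableSet.inter hU.measurableSet)
    have hAgood : good A := by
      refine good_mono _ _ ?_ hgood
      rintro y ⟨hy, -⟩
      rw [Metric.mem_ball, dist_eq_norm] at hy ⊢
      have : y - (x + -t₀ • e) = y + t₀ • e - x := by module
      rw [this]
      exact hy.trans_le (min_le_left _ _)
    have hAU : ∀ y ∈ A, ∀ t ∈ Set.Icc (0 : ℝ) 1, y + t • (t₀ • e) ∈ U := by
      rintro y ⟨hy, hyU⟩ t ht
      have hy2 : y + t₀ • e ∈ Metric.ball x (R / 2) := Metric.ball_subset_ball (min_le_right _ _) hy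
      have hlt := (h.mem_iff _ (Metric.ball_subset_ball (by linarith) hy2)).1 hyU
      rcases eq_or_lt_of_le ht.2 with h1 | h1
      · rw [h1, one_smul]; exact hyU
      · have := hmem _ hy2 hlt.le ((1 - t) * t₀) (mul_pos (by linarith) (half_pos hR))
          (by rw [ht₀]; nlinarith [ht.1])
        have e1 : y + t₀ • e + (-((1 - t) * t₀)) • e = y + t • (t₀ • e) := by module
        rwa [e1] at this
    obtain ⟨C, hC⟩ := good_translate A (t₀ • e) hAm hAU hAgood
    refine ⟨min ρ (R / 2), hm, C, fun u hu => ?_⟩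
    refine le_trans (lintegral_mono_set ?_) (hC u hu)
    intro y hy
    refine ⟨?_, hy.2⟩
    change y - t₀ • e + t₀ • e ∈ Metric.ball x (min ρ (R / 2)) ∩ U
    rwa [sub_add_cancel]
  have hcl : ∀ x ∈ closure U, x ∈ W := by
    intro x hx
    by_cases hxU : x ∈ U
    · exact hint x hxU
    · exact hbd x ⟨hx, fun h => hxU (interior_subset h)⟩
  have hfin : good (closure U) := by
    refine hb.isCompact_closure.induction_on (p := good) ?_ (fun A B hAB hB => good_mono A B hAB hB)
      ?_ ?_
    · exact ⟨0, fun u _ => by simp⟩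
    · rintro A B ⟨C, hC⟩ ⟨C', hC'⟩
      refine ⟨C + C', fun u hu => ?_⟩
      rw [Set.union_inter_distrib_right]
      refine (lintegral_union_le _ _ _).trans ?_
      rw [ENNReal.coe_add, add_mul]
      exact add_le_add (hC u hu) (hC' u hu)
    · intro x hx
      obtain ⟨ρ, hρ, hx⟩ := hcl x hx
      exact ⟨_, mem_nhdsWithin_of_mem_nhds (Metric.ball_mem_nhds x hρ), hx⟩
  obtain ⟨C, hC⟩ := hfin
  refine ⟨C, fun u hu => ?_⟩
  have := hC u hu
  rwa [Set.inter_eq_right.2 subset_closure] at this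

end Poincare

/-! ### Hilbert spaces given by a seminorm -/

section Hilbert

variable {H : Type*} [SeminormedAddCommGroup H] [InnerProductSpace ℝ H] [CompleteSpace H]

/-- Riesz representation. The space carries only a seminorm instance, and `h0` upgrades it locally
to a norm. -/
lemma existsUnique_inner_eq (h0 : ∀ u : H, ‖u‖ = 0 → u = 0) (ℓ : H →L[ℝ] ℝ) :
    ∃! u : H, ∀ v, inner ℝ u v = ℓ v := by
  let _ : NormedAddCommGroup H := NormedAddCommGroup.ofSeparation h0
  refine ⟨(InnerProductSpace.toDual ℝ H).symm ℓ, fun v => ?_, fun w hw => ?_⟩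
  · exact InnerProductSpace.toDual_symm_apply
  · refine ext_inner_right ℝ fun v => ?_
    rw [hw v]
    exact InnerProductSpace.toDual_symm_apply.symm

/-- Existence is the projection theorem. For uniqueness, the midpoint of two minimizers is no closer
to `p₀`, and the parallelogram law makes their distance zero. -/
lemma existsUnique_closest (h0 : ∀ u : H, ‖u‖ = 0 → u = 0) {K : Set H} (hne : K.Nonempty)
    (hc : IsClosed K) (hK : Convex ℝ K) (p₀ : H) :
    ∃! p, p ∈ K ∧ ∀ q ∈ K, ‖p - p₀‖ ≤ ‖q - p₀‖ := by
  obtain ⟨p, hp, hmin⟩ : ∃ p ∈ K, ‖p₀ - p‖ = ⨅ w : K, ‖p₀ - w‖ := by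
    let _ : NormedAddCommGroup H := NormedAddCommGroup.ofSeparation h0
    exact exists_norm_eq_iInf_of_complete_convex hne hc.isComplete hK p₀
  have hp' : ∀ q ∈ K, ‖p - p₀‖ ≤ ‖q - p₀‖ := by
    intro q hq
    rw [norm_sub_rev p, norm_sub_rev q, hmin]
    exact ciInf_le ⟨0, by rintro _ ⟨w, rfl⟩; exact norm_nonneg _⟩ (⟨q, hq⟩ : K)
  refine ⟨p, ⟨hp, hp'⟩, fun q ⟨hq, hq'⟩ => ?_⟩
  have hm : (1 / 2 : ℝ) • p + (1 / 2 : ℝ) • q ∈ K :=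
    hK hp hq (by norm_num) (by norm_num) (by norm_num)
  have h1 := hp' _ hm
  have h2 : ‖p - p₀‖ = ‖q - p₀‖ := le_antisymm (hp' q hq) (hq' p hp)
  have h3 := parallelogram_law_with_norm ℝ (p - p₀) (q - p₀)
  have e1 : p - p₀ + (q - p₀) = (2 : ℝ) • ((1 / 2 : ℝ) • p + (1 / 2 : ℝ) • q - p₀) := by module
  have e2 : p - p₀ - (q - p₀) = p - q := by abel
  rw [e1, e2, norm_smul, Real.norm_eq_abs, abs_two, ← h2] at h3
  have h4 : ‖q - p‖ = 0 := by
    rw [norm_sub_rev]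
    nlinarith [norm_nonneg (p - q), norm_nonneg (p - p₀)]
  exact sub_eq_zero.1 (h0 _ h4)

end Hilbert

/-! ### Convex functions with values in the extended reals -/

section Convex

lemma EReal_coe_sum {ι : Type*} (s : Finset ι) (f : ι → ℝ) :
    ((∑ i ∈ s, f i : ℝ) : EReal) = ∑ i ∈ s, (f i : EReal) := by
  classical
  induction s using Finset.induction_on with
  | empty => simp
  | insert a s ha ih => rw [Finset.sum_insert ha, Finset.sum_insert ha, EReal.coe_add, ih]

lemma EReal_sum_ne_bot {ι : Type*} (s : Finset ι) {f : ι → EReal} (hf : ∀ i, f i ≠ ⊥) :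
    ∑ i ∈ s, f i ≠ ⊥ := by
  classical
  induction s using Finset.induction_on with
  | empty => simp
  | insert a s ha ih => rw [Finset.sum_insert ha]; simp [EReal.add_eq_bot_iff, hf a, ih]

lemma EReal_ne_top_of_sum_ne_top {ι : Type*} [Fintype ι] {f : ι → EReal} (hf : ∀ i, f i ≠ ⊥)
    (h : ∑ i, f i ≠ ⊤) (i : ι) : f i ≠ ⊤ := by
  classical
  intro hi
  refine h ?_
  rw [← Finset.add_sum_erase _ _ (Finset.mem_univ i), hi]
  exact EReal.top_add_of_ne_bot (EReal_sum_ne_bot _ hf)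

lemma EReal_coe_toReal {x : EReal} (h1 : x ≠ ⊥) (h2 : x ≠ ⊤) : ((x.toReal : ℝ) : EReal) = x :=
  EReal.coe_toReal h2 h1

/-- Lower semicontinuous convex functions with values in `]-∞, +∞]`. -/
structure IsLscConvex {H : Type*} [AddCommGroup H] [Module ℝ H] [TopologicalSpace H]
    (f : H → EReal) : Prop where
  ne_bot : ∀ u, f u ≠ ⊥
  lsc : LowerSemicontinuous f
  convex : ∀ u v : H, ∀ a b : ℝ, 0 < a → 0 < b → a + b = 1 →
    f (a • u + b • v) ≤ (a : EReal) * f u + (b : EReal) * f v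

lemma IsGammaZero.isLscConvex {H : Type*} [SeminormedAddCommGroup H] [InnerProductSpace ℝ H]
    {f : H → EReal} (hf : IsGammaZero f) : IsLscConvex f := ⟨hf.ne_bot, hf.lsc, hf.convex⟩

namespace IsLscConvex

variable {H : Type*} [AddCommGroup H] [Module ℝ H] [TopologicalSpace H] {f g : H → EReal}

/-- Properness is left out of `IsLscConvex` because a sum of proper functions can be identically +∞.
Excluding ⊥ is what makes addition continuous here. -/
lemma add (hf : IsLscConvex f) (hg : IsLscConvex g) : IsLscConvex fun u => f u + g u where
  ne_bot u := by simp [EReal.add_eq_bot_iff, hf.ne_bot u, hg.ne_bot u]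
  lsc := hf.lsc.add' hg.lsc fun x =>
    EReal.continuousAt_add (Or.inr (hg.ne_bot x)) (Or.inl (hf.ne_bot x))
  convex u v a b ha hb hab := by
    refine (add_le_add (hf.convex u v a b ha hb hab) (hg.convex u v a b ha hb hab)).trans
      (le_of_eq ?_)
    have ha' : (0 : EReal) ≤ a := by exact_mod_cast ha.le
    have hb' : (0 : EReal) ≤ b := by exact_mod_cast hb.le
    rw [EReal.left_distrib_of_nonneg_of_ne_top ha' (EReal.coe_ne_top a),
      EReal.left_distrib_of_nonneg_of_ne_top hb' (EReal.coe_ne_top b), add_add_add_comm]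

lemma of_linear (ℓ : H →L[ℝ] ℝ) : IsLscConvex fun u => ((ℓ u : ℝ) : EReal) where
  ne_bot u := EReal.coe_ne_bot _
  lsc := (continuous_coe_real_ereal.comp ℓ.continuous).lowerSemicontinuous
  convex u v a b _ _ _ := by
    rw [map_add, map_smul, map_smul, smul_eq_mul, smul_eq_mul]
    push_cast
    exact le_rfl

lemma sum {ι : Type*} (s : Finset ι) {f : ι → H → EReal} (hf : ∀ i, IsLscConvex (f i)) :
    IsLscConvex fun u => ∑ i ∈ s, f i u := by
  classical
  induction s using Finset.induction_on with
  | empty => simpa using of_linear (H := H) 0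
  | insert a s ha ih =>
    simp only [Finset.sum_insert ha]
    exact (hf a).add ih

lemma comp {H' : Type*} [AddCommGroup H'] [Module ℝ H'] [TopologicalSpace H']
    (hf : IsLscConvex f) (ℓ : H' →L[ℝ] H) : IsLscConvex fun u => f (ℓ u) where
  ne_bot u := hf.ne_bot _
  lsc := hf.lsc.comp ℓ.continuous
  convex u v a b ha hb hab := by
    rw [map_add, map_smul, map_smul]
    exact hf.convex _ _ a b ha hb hab

lemma isClosed_sublevel (hf : IsLscConvex f) (c : EReal) : IsClosed {u | f u ≤ c} :=
  hf.lsc.isClosed_preimage c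

lemma convex_sublevel (hf : IsLscConvex f) (c : EReal) : Convex ℝ {u | f u ≤ c} := by
  refine convex_iff_forall_pos.2 fun u hu v hv a b ha hb hab => ?_
  refine (hf.convex u v a b ha hb hab).trans ?_
  have ha' : (0 : EReal) ≤ a := by exact_mod_cast ha.le
  have hb' : (0 : EReal) ≤ b := by exact_mod_cast hb.le
  calc (a : EReal) * f u + b * f v ≤ a * c + b * c :=
        add_le_add (mul_le_mul_of_nonneg_left hu ha') (mul_le_mul_of_nonneg_left hv hb')
    _ = c := by
        rw [← EReal.right_distrib_of_nonneg ha' hb', ← EReal.coe_add, hab, EReal.coe_one, one_mul]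

end IsLscConvex

/-- The subdifferential of a separable sum. -/
lemma forall_mem_subdifferential_iff {ι : Type*} [Fintype ι] {X : ι → Type*}
    [∀ i, SeminormedAddCommGroup (X i)] [∀ i, InnerProductSpace ℝ (X i)]
    {f : (i : ι) → X i → EReal} (hf : ∀ i u, f i u ≠ ⊥) (hp : ∀ i, ∃ u, f i u ≠ ⊤)
    (x y : (i : ι) → X i) :
    (∀ i, y i ∈ subdifferential (f i) (x i)) ↔
      ∀ z : (i : ι) → X i, ∑ i, f i (x i) + ((∑ i, inner ℝ (z i - x i) (y i) : ℝ) : EReal) ≤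
        ∑ i, f i (z i) := by
  classical
  constructor
  · intro h z
    rw [EReal_coe_sum, ← Finset.sum_add_distrib]
    exact Finset.sum_le_sum fun i _ => h i (z i)
  · intro h
    -- Testing at a point where every summand is finite forces every f_i(x_i) to be finite, so that
    -- real terms can be cancelled below.
    choose z₀ hz₀ using hp
    have hfin : ∀ i, f i (x i) ≠ ⊤ := by
      refine EReal_ne_top_of_sum_ne_top (fun i => hf i _) fun htop => ?_
      have h1 := h z₀
      rw [htop, EReal.top_add_of_ne_bot (EReal.coe_ne_bot _), top_le_iff] at h1
      have h2 : ∑ i, f i (z₀ i) = ((∑ i, (f i (z₀ i)).toReal : ℝ) : EReal) := by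
        rw [EReal_coe_sum]
        exact Finset.sum_congr rfl fun i _ => (EReal_coe_toReal (hf i _) (hz₀ i)).symm
      rw [h2] at h1
      exact EReal.coe_ne_top _ h1
    intro i w
    by_cases hw : f i w = ⊤
    · rw [hw]; exact le_top
    -- Varying one coordinate leaves the other summands equal on both sides.
    have h1 := h (Function.update x i w)
    have e1 : ∑ j, f j (x j) = ((∑ j, (f j (x j)).toReal : ℝ) : EReal) := by
      rw [EReal_coe_sum]
      exact Finset.sum_congr rfl fun j _ => (EReal_coe_toReal (hf j _) (hfin j)).symm
    have e2 : ∑ j, f j (Function.update x i w j) =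
        ((∑ j, (f j (Function.update x i w j)).toReal : ℝ) : EReal) := by
      rw [EReal_coe_sum]
      refine Finset.sum_congr rfl fun j _ => (EReal_coe_toReal (hf j _) ?_).symm
      by_cases hj : j = i
      · subst hj; simpa using hw
      · rw [Function.update_of_ne hj]; exact hfin j
    have e3 : ∑ j, inner ℝ (Function.update x i w j - x j) (y j) = inner ℝ (w - x i) (y i) := by
      rw [Finset.sum_eq_single i]
      · simp
      · intro j _ hj
        rw [Function.update_of_ne hj, sub_self, inner_zero_left]
      · simp
    rw [e1, e2, e3, ← EReal.coe_add, EReal.coe_le_coe_iff,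
      ← Finset.add_sum_erase _ _ (Finset.mem_univ i),
      ← Finset.add_sum_erase (a := i) _ (fun j => (f j (Function.update x i w j)).toReal)
        (Finset.mem_univ i)] at h1
    have e4 : ∑ j ∈ Finset.univ.erase i, (f j (Function.update x i w j)).toReal =
        ∑ j ∈ Finset.univ.erase i, (f j (x j)).toReal :=
      Finset.sum_congr rfl fun j hj => by rw [Function.update_of_ne (Finset.ne_of_mem_erase hj)]
    rw [e4, Function.update_self] at h1
    rw [← EReal_coe_toReal (hf i _) (hfin i), ← EReal_coe_toReal (hf i _) hw, ← EReal.coe_add,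
      EReal.coe_le_coe_iff]
    linarith

/-- The same decoupling for two blocks: fix one variable at its base point, where its linear term
vanishes, and cancel. -/
lemma forall_add_le_add_iff {α β : Type*} {A : α → EReal} {B : β → EReal} {a : α → ℝ} {b : β → ℝ}
    (hA : ∀ x, A x ≠ ⊥) (hB : ∀ y, B y ≠ ⊥) {x₀ : α} {y₀ : β} (ha : a x₀ = 0) (hb : b y₀ = 0)
    (hA' : ∃ x, A x ≠ ⊤) (hB' : ∃ y, B y ≠ ⊤) :
    ((∀ x, A x₀ + a x ≤ A x) ∧ ∀ y, B y₀ + b y ≤ B y) ↔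
      ∀ x y, A x₀ + B y₀ + ((a x + b y : ℝ) : EReal) ≤ A x + B y := by
  constructor
  · rintro ⟨h1, h2⟩ x y
    refine le_trans (le_of_eq ?_) (add_le_add (h1 x) (h2 y))
    rw [EReal.coe_add, add_add_add_comm]
  · intro h
    obtain ⟨x₁, hx₁⟩ := hA'
    obtain ⟨y₁, hy₁⟩ := hB'
    have h1 : A x₀ + B y₀ ≠ ⊤ := by
      intro htop
      have h2 := h x₁ y₁
      rw [htop, EReal.top_add_of_ne_bot (EReal.coe_ne_bot _), top_le_iff,
        ← EReal_coe_toReal (hA x₁) hx₁, ← EReal_coe_toReal (hB y₁) hy₁, ← EReal.coe_add] at h2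
      exact EReal.coe_ne_top _ h2
    have hx₀ : A x₀ ≠ ⊤ := fun h0 => h1 (by rw [h0, EReal.top_add_of_ne_bot (hB _)])
    have hy₀ : B y₀ ≠ ⊤ := fun h0 => h1 (by rw [h0, EReal.add_top_of_ne_bot (hA _)])
    constructor
    · intro x
      by_cases hx : A x = ⊤
      · rw [hx]; exact le_top
      have h2 := h x y₀
      rw [hb, ← EReal_coe_toReal (hA x₀) hx₀, ← EReal_coe_toReal (hB y₀) hy₀,
        ← EReal_coe_toReal (hA x) hx, ← EReal.coe_add, ← EReal.coe_add, ← EReal.coe_add,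
        EReal.coe_le_coe_iff] at h2
      rw [← EReal_coe_toReal (hA x₀) hx₀, ← EReal_coe_toReal (hA x) hx, ← EReal.coe_add,
        EReal.coe_le_coe_iff]
      linarith
    · intro y
      by_cases hy : B y = ⊤
      · rw [hy]; exact le_top
      have h2 := h x₀ y
      rw [ha, ← EReal_coe_toReal (hA x₀) hx₀, ← EReal_coe_toReal (hB y₀) hy₀,
        ← EReal_coe_toReal (hB y) hy, ← EReal.coe_add, ← EReal.coe_add, ← EReal.coe_add,
        EReal.coe_le_coe_iff] at h2
      rw [← EReal_coe_toReal (hB y₀) hy₀, ← EReal_coe_toReal (hB y) hy, ← EReal.coe_add,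
        EReal.coe_le_coe_iff]
      linarith

section Conjugate

variable {H : Type*} [SeminormedAddCommGroup H] [InnerProductSpace ℝ H] {f : H → EReal} {u w : H}
  {r : ℝ}

lemma IsGammaZero.ne_top_of_mem_subdifferential (hf : IsGammaZero f)
    (h : w ∈ subdifferential f u) : f u ≠ ⊤ := by
  intro htop
  obtain ⟨v, hv⟩ := hf.proper
  have := h v
  rw [htop, EReal.top_add_of_ne_bot (EReal.coe_ne_bot _), top_le_iff] at this
  exact hv this

lemma coe_le_conjugate (hr : f u = r) (w : H) :
    ((inner ℝ u w - r : ℝ) : EReal) ≤ conjugate f w := by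
  rw [EReal.coe_sub, ← hr]
  exact le_iSup (fun u => ((inner ℝ u w : ℝ) : EReal) - f u) u

/-- The equality case of Fenchel–Young; `coe_le_conjugate` is the inequality. -/
lemma conjugate_le_coe (hf : IsGammaZero f) (hr : f u = r) (h : w ∈ subdifferential f u) :
    conjugate f w ≤ ((inner ℝ u w - r : ℝ) : EReal) := by
  refine iSup_le fun v => ?_
  by_cases hv : f v = ⊤
  · rw [hv]; simp
  have h1 := h v
  rw [hr, ← EReal_coe_toReal (hf.ne_bot v) hv, ← EReal.coe_add, EReal.coe_le_coe_iff,
    inner_sub_left] at h1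
  rw [← EReal_coe_toReal (hf.ne_bot v) hv, ← EReal.coe_sub, EReal.coe_le_coe_iff]
  linarith

end Conjugate

end Convex

/-! ### Completeness of H¹_{0,Γ} for the gradient norm. -/

variable {N : ℕ}

lemma measurableSet_relInterior_frontier (A B : Set (E N)) :
    MeasurableSet (relInterior (frontier A) B) :=
  measurableSet_relInterior isClosed_frontier.measurableSet

/-- Presents the subspace as the kernel of a continuous map, hence closed. -/
lemma mem_traceZero_iff {U Γ : Set (E N)} (hm : MeasurableSet Γ) (hΓ : Γ ⊆ frontier U) (u : H1 U) :
    u ∈ traceZero U Γ ↔ restrictL2 hΓ (trace U u) = 0 := by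
  change (∀ᵐ x ∂((surf N).restrict (frontier U)), x ∈ Γ → trace U u x = 0) ↔ _
  rw [← ae_restrict_iff' hm, Measure.restrict_restrict_of_subset hΓ, Lp.ext_iff]
  have h1 := coeFn_restrictL2 hΓ (trace U u)
  have h2 := Lp.coeFn_zero ℝ 2 ((surf N).restrict Γ)
  constructor
  · intro h
    filter_upwards [h, h1, h2] with x h h1 h2
    rw [h1, h2, h, Pi.zero_apply]
  · intro h
    filter_upwards [h, h1, h2] with x h h1 h2
    rw [← h1, h, h2, Pi.zero_apply]

lemma isClosed_traceZero {U Γ : Set (E N)} (hm : MeasurableSet Γ) (hΓ : Γ ⊆ frontier U) :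
    IsClosed (traceZero U Γ : Set (H1 U)) := by
  have h : (traceZero U Γ : Set (H1 U)) = (fun u => restrictL2 hΓ (trace U u)) ⁻¹' {0} := by
    ext u
    exact mem_traceZero_iff hm hΓ u
  rw [h]
  exact isClosed_singleton.preimage ((continuous_restrictL2 hΓ).comp (trace U).continuous)

namespace HZero

variable {U Γ : Set (E N)}

lemma toH1_injective : Function.Injective (toH1 : HZero U Γ → H1 U) := Subtype.val_injective

lemma norm_eq (u : HZero U Γ) : ‖u‖ = ‖H1.grad (toH1 u)‖ := rfl

/-- The bound on the inclusion in `H¹` given by the Poincaré inequality. -/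
lemma exists_norm_toH1_le {C : NNReal}
    (hC : ∀ u ∈ traceZero U Γ, ∫⁻ x in U, ‖H1.fn u x‖ₑ ^ 2 ≤ C * ∫⁻ x in U, ‖H1.grad u x‖ₑ ^ 2) :
    ∃ K : ℝ, ∀ u : HZero U Γ, ‖toH1 u‖ ≤ K * ‖u‖ := by
  refine ⟨Real.sqrt (C + 1), fun u => ?_⟩
  have h1 : ‖toH1 u‖ₑ ^ 2 ≤ ((C + 1 : NNReal) : ℝ≥0∞) * ‖H1.grad (toH1 u)‖ₑ ^ 2 := by
    rw [H1.enorm_sq, enorm_sq_Lp, ENNReal.coe_add, add_mul, ENNReal.coe_one, one_mul]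
    exact add_le_add (hC _ u.2) le_rfl
  have h2 : ‖toH1 u‖ ^ 2 ≤ ((C : ℝ) + 1) * ‖u‖ ^ 2 := by
    rw [norm_eq]
    have h3 : ‖toH1 u‖₊ ^ 2 ≤ (C + 1) * ‖H1.grad (toH1 u)‖₊ ^ 2 := by
      rw [enorm_eq_nnnorm, enorm_eq_nnnorm] at h1
      exact_mod_cast h1
    exact_mod_cast h3
  rw [← Real.sqrt_sq (norm_nonneg u), ← Real.sqrt_mul (by positivity)]
  exact Real.le_sqrt_of_sq_le h2

variable {K : ℝ}

lemma eq_zero_of_norm_eq_zero (hK : ∀ u : HZero U Γ, ‖toH1 u‖ ≤ K * ‖u‖) (u : HZero U Γ)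
    (hu : ‖u‖ = 0) : u = 0 := by
  have h := hK u
  rw [hu, mul_zero, norm_le_zero_iff] at h
  exact toH1_injective (h.trans (map_zero _).symm)

/-- By the bound `hK`, a sequence that is Cauchy for the gradient norm is Cauchy in H¹. Its limit
stays in the closed subspace, and the gradients converge. -/
lemma completeSpace (hK : ∀ u : HZero U Γ, ‖toH1 u‖ ≤ K * ‖u‖)
    (hc : IsClosed (traceZero U Γ : Set (H1 U))) : CompleteSpace (HZero U Γ) := by
  refine Metric.complete_of_cauchySeq_tendsto fun a ha => ?_
  let ι : HZero U Γ →L[ℝ] H1 U := LinearMap.mkContinuous toH1 K hK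
  have hb : CauchySeq fun n => ι (a n) := ha.map ι.uniformContinuous
  obtain ⟨u, hu⟩ := cauchySeq_tendsto_of_complete hb
  have hmem : u ∈ traceZero U Γ := hc.mem_of_tendsto hu (.of_forall fun n => (a n).2)
  let w : HZero U Γ := ⟨u, hmem⟩
  refine ⟨w, tendsto_iff_norm_sub_tendsto_zero.2 ?_⟩
  have h := (H1.grad.continuous.tendsto u).comp hu
  rw [tendsto_iff_norm_sub_tendsto_zero] at h
  refine h.congr fun n => ?_
  rw [norm_eq, map_sub, map_sub]
  rfl

end HZero

lemma integral_mul_eq_inner {α : Type*} [MeasurableSpace α] {μ : Measure α} (a b : Lp ℝ 2 μ) :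
    ∫ x, a x * b x ∂μ = inner ℝ a b := by
  rw [L2.inner_def]
  refine integral_congr_ae (.of_forall fun x => ?_)
  simp [mul_comm]

namespace Decomposition

variable {m : ℕ} {D : Decomposition N m}

/-! ### Well-posedness of the problems on the subdomains. -/

section Geometry

/-- The geometric assumptions are exactly those of the Poincaré inequality once Υ_ii is known to be
open in bdry Ω_i. -/
lemma exists_norm_toH1_le (hD : D.IsAdmissible) (i : Fin m) :
    ∃ K : ℝ, ∀ u : D.H i, ‖HZero.toH1 u‖ ≤ K * ‖u‖ := by
  have hΥ : D.Υ i i = relInterior (frontier D.Ω) (frontier (D.sub i) ∩ frontier D.Ω) := if_pos rfl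
  obtain ⟨C, hC⟩ := exists_poincare (Γ := D.Υ i i) (hD.isOpen_sub i)
    (hD.bounded.subset (hD.sub_subset i)) (hD.lipschitz_sub i)
    (fun p hp => ⟨D.Υ_subset_left i i hp, by
      rw [hΥ] at hp ⊢
      exact exists_ball_inter_frontier_subset hD.isOpen (hD.sub_subset i) (hD.lipschitz_sub i)
        hD.lipschitz hp⟩)
    (hD.component i)
  exact HZero.exists_norm_toH1_le hC

lemma eq_zero_of_norm_eq_zero (hD : D.IsAdmissible) (i : Fin m) (u : D.H i) (hu : ‖u‖ = 0) :
    u = 0 := by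
  obtain ⟨K, hK⟩ := exists_norm_toH1_le hD i
  exact HZero.eq_zero_of_norm_eq_zero hK u hu

lemma measurableSet_Υ (i j : Fin m) : MeasurableSet (D.Υ i j) := by
  unfold Υ
  split_ifs <;> exact measurableSet_relInterior_frontier _ _

lemma completeSpace (hD : D.IsAdmissible) (i : Fin m) : CompleteSpace (D.H i) := by
  obtain ⟨K, hK⟩ := exists_norm_toH1_le hD i
  exact HZero.completeSpace hK (isClosed_traceZero (measurableSet_Υ i i) (D.Υ_subset_left i i))

/-- The inclusion of `ℋ_i` in `H¹(Ω_i)`. -/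
def toH1L (hD : D.IsAdmissible) (i : Fin m) : D.H i →L[ℝ] H1 (D.sub i) :=
  LinearMap.mkContinuous HZero.toH1 (exists_norm_toH1_le hD i).choose
    (exists_norm_toH1_le hD i).choose_spec

/-- The trace on `A ⊆ bdry Ω_i` as a bounded linear operator on `ℋ_i`. -/
def traceOnL (hD : D.IsAdmissible) {i : Fin m} {A : Set (E N)} (hA : A ⊆ frontier (D.sub i)) :
    D.H i →L[ℝ] L2Surf A :=
  ((restrictL2 hA).toRealLinearMap (continuous_restrictL2 hA)).comp
    ((trace (D.sub i)).comp (toH1L hD i))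

/-- The right side of the weak formulation is a bounded functional of v, and the left side is the
scalar product of ℋ_i, so Riesz applies. -/
lemma existsUnique_isWeakSolution (hD : D.IsAdmissible) (i : Fin m) (f : L2Vol (D.sub i))
    (h : (j : D.J i) → L2Surf (D.Υ i j)) : ∃! u, D.IsWeakSolution i f h u := by
  have := completeSpace hD i
  let ℓ : D.H i →L[ℝ] ℝ := (innerSL ℝ f).comp (H1.fn.comp (toH1L hD i)) +
    ∑ j : D.J i, (if i < j.1 then (1 : ℝ) else -1) •
      (innerSL ℝ (h j)).comp (traceOnL hD (D.Υ_subset_left i j))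
  have e : ∀ u, D.IsWeakSolution i f h u ↔ ∀ v, inner ℝ u v = ℓ v := by
    intro u
    refine forall_congr' fun v => ?_
    have e1 : ℓ v = (∫ x in D.sub i, f x * HZero.fn v x) + ∑ j : D.J i,
        (if i < j.1 then 1 else -1) * ∫ x in D.Υ i j, h j x * D.T i j v x ∂(surf N) := by
      simp only [ℓ, integral_mul_eq_inner, add_apply,
        sum_apply, smul_apply, smul_eq_mul]
      rfl
    rw [e1]
    rfl
  simp only [e]
  exact existsUnique_inner_eq (eq_zero_of_norm_eq_zero hD i) ℓ

lemma isWeakSolution_Q (hD : D.IsAdmissible) (i : Fin m) (f : L2Vol (D.sub i))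
    (h : (j : D.J i) → L2Surf (D.Υ i j)) : D.IsWeakSolution i f h (D.Q i f h) := by
  have hu : ∃ u, D.IsWeakSolution i f h u := (existsUnique_isWeakSolution hD i f h).exists
  rw [Q, dif_pos hu]
  exact hu.choose_spec

lemma inner_Q_zero (hD : D.IsAdmissible) (i : Fin m) (h : (j : D.J i) → L2Surf (D.Υ i j))
    (v : D.H i) : inner ℝ v (D.Q i 0 h) =
      ∑ j : D.J i, (if i < j.1 then 1 else -1) * inner ℝ (h j) (D.T i j v) := by
  have h1 := isWeakSolution_Q hD i 0 h v
  rw [integral_mul_eq_inner, inner_zero_left, zero_add] at h1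
  simp only [integral_mul_eq_inner] at h1
  rw [real_inner_comm]
  exact h1

end Geometry

/-! ### The jump operator and its adjoint. -/

section Jump

/-- Υ_ij and Υ_ji are equal sets but give different L² types; `restrictSurf` acts as the transport
between them and is isometric. -/
lemma inner_restrictSurf {A B : Set (E N)} (h : A = B) (f g : L2Surf B) :
    inner ℝ (restrictSurf h.subset f) (restrictSurf h.subset g) = inner ℝ f g := by
  subst h
  have e : ∀ f : L2Surf A, restrictSurf (Set.Subset.refl A) f = f := fun f => Lp.toLp_coeFn _ _
  rw [e, e]

lemma restrictSurf_traceOn {U Γ A B : Set (E N)} (hAB : A ⊆ B) (hB : B ⊆ frontier U)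
    (v : HZero U Γ) :
    restrictSurf hAB (HZero.traceOn hB v) = HZero.traceOn (hAB.trans hB) v := by
  refine MemLp.toLp_congr _
    ((Lp.memLp _).mono_measure (Measure.restrict_mono_set _ (hAB.trans hB))) ?_
  exact ae_mono (Measure.restrict_mono_set _ hAB) (coeFn_restrictL2 hB _)

/-- The adjoint relation between the jumps and the operators `Q_i(0, ·)`. -/
lemma sum_inner_Q (hD : D.IsAdmissible) (v : D.Primal) (g : D.Dual) :
    ∑ i, inner ℝ (v i) (D.Q i 0 (D.interfaceData g i)) = ∑ k, inner ℝ (D.jump v k) (g k) := by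
  classical
  -- Extension by zero off `K` lets both sides be summed over all pairs. Neighbor j of i contributes
  -- a(i, j) if i < j and -b(j, i) if j < i, and exchanging indices in the double sum of b
  -- concludes.
  let a : Fin m × Fin m → ℝ := fun k => if h : k ∈ D.K then
    inner ℝ (g ⟨k, h⟩) (D.T k.1 k.2 (v k.1)) else 0
  let b : Fin m × Fin m → ℝ := fun k => if h : k ∈ D.K then
    inner ℝ (g ⟨k, h⟩) (D.T' k.1 k.2 (v k.2)) else 0
  have hR : ∑ k, inner ℝ (D.jump v k) (g k) = ∑ i, ∑ j, (a (i, j) - b (i, j)) := by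
    rw [← Fintype.sum_prod_type (f := fun k => a k - b k)]
    refine Fintype.sum_of_injective Subtype.val Subtype.val_injective _ _ ?_ ?_
    · intro k hk
      have hk' : k ∉ D.K := fun h => hk ⟨⟨k, h⟩, rfl⟩
      simp [a, b, hk']
    · intro k
      simp only [a, b, dif_pos k.2]
      rw [real_inner_comm, jump, inner_sub_right]
  have hL : ∀ i, inner ℝ (v i) (D.Q i 0 (D.interfaceData g i)) =
      ∑ j, (a (i, j) - b (j, i)) := by
    intro i
    rw [inner_Q_zero hD]
    refine Fintype.sum_of_injective Subtype.val Subtype.val_injective _ _ ?_ ?_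
    · intro j hj
      have hj' : j ∉ D.J i := fun h => hj ⟨⟨j, h⟩, rfl⟩
      have h1 : (i, j) ∉ D.K := fun h => hj' h.2
      have h2 : (j, i) ∉ D.K := fun h => hj' ⟨h.1.ne, by rw [D.Υ_comm]; exact h.2.2⟩
      simp [a, b, h1, h2]
    · rintro ⟨j, hj⟩
      by_cases hij : i < j
      · have h1 : (i, j) ∈ D.K := ⟨hij, hj⟩
        have h2 : (j, i) ∉ D.K := fun h => lt_asymm hij h.1
        simp [a, b, h1, h2, interfaceData, hij]
      · have h1 : (i, j) ∉ D.K := fun h => hij h.1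
        have h2 : (j, i) ∈ D.K := ⟨lt_of_le_of_ne (not_lt.mp hij) hj.1,
          hj.1.symm, by rw [D.Υ_comm]; exact hj.2⟩
        have e : D.T i j (v i) = restrictSurf (D.Υ_comm i j).subset (D.T' j i (v i)) :=
          (restrictSurf_traceOn _ _ _).symm
        simp only [a, b, h1, h2, interfaceData, hij, dif_pos, dif_neg, if_neg, not_false_eq_true]
        rw [e, inner_restrictSurf (D.Υ_comm i j)]
        ring
  rw [hR, Finset.sum_congr rfl fun i _ => hL i]
  simp only [Finset.sum_sub_distrib]
  rw [Finset.sum_comm (f := fun i j => b (j, i))]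

/-- The coordinate projections of the primal space. -/
def primalProj (D : Decomposition N m) (i : Fin m) : D.Primal →L[ℝ] D.H i where
  toLinearMap := PiLp.projₗ 2 (fun i => D.H i) i
  cont := PiLp.continuous_apply 2 (fun i => D.H i) i

/-- The jumps as a bounded linear operator. -/
def jumpL (hD : D.IsAdmissible) (k : D.K) : D.Primal →L[ℝ] L2Surf (D.Υ k.1.1 k.1.2) :=
  (traceOnL hD (D.Υ_subset_left k.1.1 k.1.2)).comp (D.primalProj k.1.1) -
    (traceOnL hD (D.Υ_subset_right k.1.1 k.1.2)).comp (D.primalProj k.1.2)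

end Jump

/-! ### The Hilbert structure of the product of the primal and dual spaces. -/

section Product

instance : InnerProductSpace ℝ (WithLp 2 (D.Primal × D.Dual)) where
  inner p q := ∑ i, inner ℝ (p.fst i) (q.fst i) + ∑ k, inner ℝ (p.snd k) (q.snd k)
  norm_smul_le := norm_smul_le
  norm_sq_eq_re_inner p := by
    rw [WithLp.prod_norm_sq_eq_of_L2, PiLp.norm_sq_eq_of_L2, PiLp.norm_sq_eq_of_L2]
    simp only [real_inner_self_eq_norm_sq, RCLike.re_to_real]
  conj_inner_symm p q := by simp only [conj_trivial, real_inner_comm]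
  add_left p q r := by
    simp only [WithLp.add_fst, WithLp.add_snd, PiLp.add_apply, inner_add_left,
      Finset.sum_add_distrib]
    ring
  smul_left p q c := by
    simp only [WithLp.smul_fst, WithLp.smul_snd, PiLp.smul_apply, inner_smul_left,
      Finset.mul_sum, mul_add]

lemma prod_eq_zero_of_norm_eq_zero (hD : D.IsAdmissible) (p : WithLp 2 (D.Primal × D.Dual))
    (hp : ‖p‖ = 0) : p = 0 := by
  have h := WithLp.prod_norm_sq_eq_of_L2 p
  rw [hp, PiLp.norm_sq_eq_of_L2, PiLp.norm_sq_eq_of_L2, zero_pow two_ne_zero] at h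
  have n1 : 0 ≤ ∑ i, ‖p.fst i‖ ^ 2 := Finset.sum_nonneg fun i _ => by positivity
  have n2 : 0 ≤ ∑ k, ‖p.snd k‖ ^ 2 := Finset.sum_nonneg fun i _ => by positivity
  have h1 : ∑ i, ‖p.fst i‖ ^ 2 = 0 := by linarith
  have h2 : ∑ k, ‖p.snd k‖ ^ 2 = 0 := by linarith
  rw [Finset.sum_eq_zero_iff_of_nonneg fun i _ => by positivity] at h1 h2
  have e1 : p.fst = 0 := PiLp.ext fun i =>
    eq_zero_of_norm_eq_zero hD i _ (pow_eq_zero_iff two_ne_zero |>.1 (h1 i (Finset.mem_univ i)))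
  have e2 : p.snd = 0 := PiLp.ext fun k =>
    norm_eq_zero.1 (pow_eq_zero_iff two_ne_zero |>.1 (h2 k (Finset.mem_univ k)))
  exact WithLp.ofLp_injective 2 (Prod.ext e1 e2)

end Product

/-! ### Convexity of the Kuhn–Tucker set and optimality of its points. -/

section Optimality

variable {φ : (i : Fin m) → D.H i → EReal} {ψ : (k : D.K) → L2Surf (D.Υ k.1.1 k.1.2) → EReal}

/-- The pairing of `w - (jump v)` with `g`, as a bounded linear functional of the dual variable. -/
def pairingL (v : D.Primal) (w : D.Dual) : WithLp 2 (D.Primal × D.Dual) →L[ℝ] ℝ :=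
  ∑ k, (innerSL ℝ (w k - D.jump v k)).comp
    ((PiLp.proj 2 (fun k : D.K => L2Surf (D.Υ k.1.1 k.1.2)) k).comp
      (WithLp.sndL 2 ℝ D.Primal D.Dual))

lemma pairingL_apply (v : D.Primal) (w : D.Dual) (p : WithLp 2 (D.Primal × D.Dual)) :
    pairingL v w p = ∑ k, inner ℝ (w k - D.jump v k) (p.snd k) := by
  simp only [pairingL, sum_apply]
  rfl

/-- The optimality set as the solution set of a family of convex inequalities. -/
lemma mem_optimalitySet_iff (hD : D.IsAdmissible) (hφ : ∀ i, IsGammaZero (φ i))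
    (hψ : ∀ k, IsGammaZero (ψ k)) (p : WithLp 2 (D.Primal × D.Dual)) :
    p ∈ D.optimalitySet φ ψ ↔ ∀ (v : D.Primal) (w : D.Dual),
      D.primalObjective φ ψ p.fst + (pairingL v w p : EReal) ≤
        ∑ i, φ i (v i) + ∑ k, ψ k (w k) := by
  choose u₁ hu₁ using fun i => (hφ i).proper
  choose w₁ hw₁ using fun k => (hψ k).proper
  have hsum : ∀ {ι : Type} [Fintype ι] (f : ι → EReal), (∀ i, f i ≠ ⊥) → (∀ i, f i ≠ ⊤) →
      ∑ i, f i ≠ ⊤ := by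
    intro ι _ f h1 h2
    rw [Finset.sum_congr rfl fun i _ => (EReal_coe_toReal (h1 i) (h2 i)).symm, ← EReal_coe_sum]
    exact EReal.coe_ne_top _
  change ((∀ k, p.snd k ∈ subdifferential (ψ k) (D.jump p.fst k)) ∧
    ∀ i, -D.Q i 0 (D.interfaceData p.snd i) ∈ subdifferential (φ i) (p.fst i)) ↔ _
  rw [and_comm, forall_mem_subdifferential_iff (fun i => (hφ i).ne_bot) (fun i => (hφ i).proper)
      (fun i => p.fst i) (fun i => -D.Q i 0 (D.interfaceData p.snd i)),
    forall_mem_subdifferential_iff (fun k => (hψ k).ne_bot) (fun k => (hψ k).proper)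
      (fun k => D.jump p.fst k) (fun k => p.snd k),
    forall_add_le_add_iff (A := fun x : (i : Fin m) → D.H i => ∑ i, φ i (x i))
      (B := fun y : (k : D.K) → L2Surf (D.Υ k.1.1 k.1.2) => ∑ k, ψ k (y k))
      (x₀ := fun i => p.fst i) (y₀ := fun k => D.jump p.fst k)
      (a := fun z => ∑ i, inner ℝ (z i - p.fst i) (-D.Q i 0 (D.interfaceData p.snd i)))
      (b := fun z => ∑ k, inner ℝ (z k - D.jump p.fst k) (p.snd k))
      (fun x => EReal_sum_ne_bot _ fun i => (hφ i).ne_bot _)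
      (fun y => EReal_sum_ne_bot _ fun k => (hψ k).ne_bot _) (by simp) (by simp)
      ⟨u₁, hsum _ (fun i => (hφ i).ne_bot _) hu₁⟩ ⟨w₁, hsum _ (fun k => (hψ k).ne_bot _) hw₁⟩]
  -- By the adjoint relation the terms in (u, g) cancel, so the linear part depends on g only. The
  -- bilinear term would otherwise spoil convexity.
  have key : ∀ (v : D.Primal) (w : D.Dual),
      ∑ i, inner ℝ (v i - p.fst i) (-D.Q i 0 (D.interfaceData p.snd i)) +
        ∑ k, inner ℝ (w k - D.jump p.fst k) (p.snd k) = pairingL v w p := by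
    intro v w
    have h1 := sum_inner_Q hD v p.snd
    have h2 := sum_inner_Q hD p.fst p.snd
    rw [pairingL_apply]
    simp only [inner_sub_left, inner_neg_right, Finset.sum_sub_distrib, Finset.sum_neg_distrib]
    rw [h1, h2]
    ring
  constructor
  · intro h v w
    rw [← key v w]
    exact h v w
  · intro h v w
    have h1 := h (WithLp.toLp 2 v) (WithLp.toLp 2 w)
    rw [← key] at h1
    exact h1

lemma isClosed_and_convex_optimalitySet (hD : D.IsAdmissible) (hφ : ∀ i, IsGammaZero (φ i))
    (hψ : ∀ k, IsGammaZero (ψ k)) :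
    IsClosed (D.optimalitySet φ ψ) ∧ Convex ℝ (D.optimalitySet φ ψ) := by
  have h1 : IsLscConvex fun p : WithLp 2 (D.Primal × D.Dual) => D.primalObjective φ ψ p.fst :=
    (IsLscConvex.sum Finset.univ fun i => (hφ i).isLscConvex.comp
      ((D.primalProj i).comp (WithLp.fstL 2 ℝ D.Primal D.Dual))).add
    (IsLscConvex.sum Finset.univ fun k => (hψ k).isLscConvex.comp
      ((jumpL hD k).comp (WithLp.fstL 2 ℝ D.Primal D.Dual)))
  have h2 : ∀ (v : D.Primal) (w : D.Dual), IsLscConvex fun p : WithLp 2 (D.Primal × D.Dual) =>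
      D.primalObjective φ ψ p.fst + (pairingL v w p : EReal) := fun v w =>
    h1.add (IsLscConvex.of_linear _)
  have e : D.optimalitySet φ ψ = ⋂ (v : D.Primal) (w : D.Dual),
      {p | D.primalObjective φ ψ p.fst + (pairingL v w p : EReal) ≤
        ∑ i, φ i (v i) + ∑ k, ψ k (w k)} := by
    ext p
    simp only [Set.mem_iInter]
    exact mem_optimalitySet_iff hD hφ hψ p
  rw [e]
  exact ⟨isClosed_iInter fun v => isClosed_iInter fun w => (h2 v w).isClosed_sublevel _,
    convex_iInter fun v => convex_iInter fun w => (h2 v w).convex_sublevel _⟩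

lemma primalObjective_le (hD : D.IsAdmissible) (hφ : ∀ i, IsGammaZero (φ i))
    (hψ : ∀ k, IsGammaZero (ψ k)) {p : WithLp 2 (D.Primal × D.Dual)}
    (hp : p ∈ D.optimalitySet φ ψ) (u : D.Primal) :
    D.primalObjective φ ψ p.fst ≤ D.primalObjective φ ψ u := by
  -- Taking w to be the jump of the competitor makes the pairing vanish.
  have h := (mem_optimalitySet_iff hD hφ hψ p).1 hp u (WithLp.toLp 2 fun k => D.jump u k)
  simpa [pairingL_apply] using! h

lemma dualObjective_le (hD : D.IsAdmissible) (hφ : ∀ i, IsGammaZero (φ i))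
    (hψ : ∀ k, IsGammaZero (ψ k)) {p : WithLp 2 (D.Primal × D.Dual)}
    (hp : p ∈ D.optimalitySet φ ψ) (g : D.Dual) :
    D.dualObjective φ ψ p.snd ≤ D.dualObjective φ ψ g := by
  have hr : ∀ i, φ i (p.fst i) = ((φ i (p.fst i)).toReal : EReal) := fun i =>
    (EReal_coe_toReal ((hφ i).ne_bot _) ((hφ i).ne_top_of_mem_subdifferential (hp.2 i))).symm
  have hs : ∀ k, ψ k (D.jump p.fst k) = ((ψ k (D.jump p.fst k)).toReal : EReal) := fun k =>
    (EReal_coe_toReal ((hψ k).ne_bot _) ((hψ k).ne_top_of_mem_subdifferential (hp.1 k))).symm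
  -- With u fixed, the Fenchel–Young lower bounds add up to minus the primal value, independently of
  -- g. They are attained at `p.snd`.
  have e : ∀ g : D.Dual, ∑ i, ((inner ℝ (p.fst i) (-D.Q i 0 (D.interfaceData g i)) -
        (φ i (p.fst i)).toReal : ℝ) : EReal) + ∑ k, ((inner ℝ (D.jump p.fst k) (g k) -
        (ψ k (D.jump p.fst k)).toReal : ℝ) : EReal) =
      ((-∑ i, (φ i (p.fst i)).toReal - ∑ k, (ψ k (D.jump p.fst k)).toReal : ℝ) : EReal) := by
    intro g
    rw [← EReal_coe_sum, ← EReal_coe_sum, ← EReal.coe_add, EReal.coe_eq_coe_iff]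
    simp only [inner_neg_right, Finset.sum_sub_distrib, Finset.sum_neg_distrib]
    rw [sum_inner_Q hD]
    ring
  calc D.dualObjective φ ψ p.snd
      ≤ _ := add_le_add
        (Finset.sum_le_sum fun i _ => conjugate_le_coe (hφ i) (hr i) (hp.2 i))
        (Finset.sum_le_sum fun k _ => conjugate_le_coe (hψ k) (hs k) (hp.1 k))
    _ = _ := (e p.snd).trans (e g).symm
    _ ≤ D.dualObjective φ ψ g := add_le_add
        (Finset.sum_le_sum fun i _ => coe_le_conjugate (hr i) _)
        (Finset.sum_le_sum fun k _ => coe_le_conjugate (hs k) _)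

end Optimality

end Decomposition

end DomainDecomposition

end

/-! ### The proposition. -/

theorem proposition3p3 {N m : ℕ} (hm : 2 ≤ m)
    (D : DomainDecomposition.Decomposition N m) (hD : D.IsAdmissible)
    (φ : (i : Fin m) → D.H i → EReal)
    (ψ : (k : D.K) → DomainDecomposition.L2Surf (D.Υ k.1.1 k.1.2) → EReal)
    (hφ : ∀ i, DomainDecomposition.IsGammaZero (φ i))
    (hψ : ∀ k, DomainDecomposition.IsGammaZero (ψ k))
    (hne : (D.optimalitySet φ ψ).Nonempty)
    (p₀ : WithLp 2 (D.Primal × D.Dual)) :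
    -- the trace operators, the Hilbert spaces and the operators `Q_i` are well defined
    (∀ i, ∃! T, DomainDecomposition.IsTraceOperator (D.sub i) T) ∧
    (∀ i, (∀ u : D.H i, ‖u‖ = 0 → u = 0) ∧ CompleteSpace (D.H i)) ∧
    (∀ i f h, ∃! u, D.IsWeakSolution i f h u) ∧
    -- existence and uniqueness of the solution, and its primal and dual optimality
    (∃! p, D.IsSolution φ ψ p₀ p) ∧
    (∀ p, D.IsSolution φ ψ p₀ p →
      (∀ u, D.primalObjective φ ψ p.fst ≤ D.primalObjective φ ψ u) ∧
      (∀ g, D.dualObjective φ ψ p.snd ≤ D.dualObjective φ ψ g)) := by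
  refine ⟨fun i => DomainDecomposition.existsUnique_isTraceOperator (hD.isOpen_sub i)
      (hD.bounded.subset (hD.sub_subset i)) (hD.lipschitz_sub i),
    fun i => ⟨DomainDecomposition.Decomposition.eq_zero_of_norm_eq_zero hD i,
      DomainDecomposition.Decomposition.completeSpace hD i⟩,
    DomainDecomposition.Decomposition.existsUnique_isWeakSolution hD, ?_, fun p hp =>
      ⟨DomainDecomposition.Decomposition.primalObjective_le hD hφ hψ hp.1,
        DomainDecomposition.Decomposition.dualObjective_le hD hφ hψ hp.1⟩⟩
  have := DomainDecomposition.Decomposition.completeSpace hD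
  obtain ⟨hc, hK⟩ :=
    DomainDecomposition.Decomposition.isClosed_and_convex_optimalitySet hD hφ hψ
  exact DomainDecomposition.existsUnique_closest
    (DomainDecomposition.Decomposition.prod_eq_zero_of_norm_eq_zero hD) hne hc hK p₀
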